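/- **Setting.** Let $\Gamma$ be a finite connected distance-regular graph with vertex set $X$, diameter $D\ge 3$, valency at least $3$, intersection numbers $p^h_{ij}$, distance matrices $A_i$ and adjacency matrix $A=A_1$; assume $\Gamma$ is $Q$-polynomial with respect to the ordering $E_0=|X|^{-1}J,E_1,\dots,E_D$ of its primitive idempotents, with Krein parameters $q^h_{ij}$, where $E_i\circ E_j=|X|^{-1}\sum_h q^h_{ij}E_h$. Fix $x\in X$. Let $E^*_i$ be the diagonal matrix with $(y,y)$-entry $1$ if $\partial(x,y)=i$ and $0$ otherwise, let $A^*$ be the diagonal matrix with $(y,y)$-entry $|X|(E_1)_{xy}$, and write $A=\sum_i\theta_iE_i$, $A^*=\sum_i\theta^*_iE^*_i$. Let $T=T(x)$ be the algebra generated by all $A_i,E^*_i$. A $T$-module is a $T$-invariant subspace $W$ of $\mathbb C^X$; an irreducible one is thin if $\dim E^*_iW\le 1$ for all $i$; its endpoint is $r=\min\{i:E^*_iW\ne0\}$, its dual endpoint is $t=\min\{i:E_iW\neq 0\}$, its diameter is $d=|\{i:E^*_iW\ne0\}|-1$. The trivial module is the irreducible one with $r=t=0$, $d=D$. For a thin irreducible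 $W$ with $d>0$: - The first split sequence $\varphi_i(W)$ $(1\le i\le d)$ consists of the eigenvalue of $(A-\theta_{t+i-1}I)(A^*-\theta^*_{r+i}I)$ on the nonzero space $\prod_{h=0}^{i-1}(A-\theta_{t+h}I)\,E^*_rW$; the second split sequence $\phi_i(W)$ consists of the eigenvalue of $(A-\theta_{t+d-i+1}I)(A^*-\theta^*_{r+i}I)$ on the nonzero space $\prod_{h=0}^{i-1}(A-\theta_{t+d-h}I)\,E^*_rW$. - Put $a_i(W)=\mathrm{tr}_W(E^*_{r+i}A)$, $x_i(W)=\mathrm{tr}_W(E^*_{r+i}AE^*_{r+i-1}A)$; define $p_{-1}=0$, $p_0=1$, $\lambda p_i=p_{i+1}+a_i(W)p_i+x_i(W)p_{i-1}$, and $u_i=p_i/p_i(\theta_t)$ $(0\le i\le d)$. - $b_i(W)$ and $c_i(W)$ are the $(i,i+1)$- and $(i,i-1)$-entries of the matrix of $A$ with respect to a basis $\{E^*_{r+i}u\}_{i=0}^d$, $0\ne u\in E_tW$ (standard basis); $b^*_i(W),c^*_i(W)$ are the corresponding entries of the matrix of $A^*$ with respect to a basis $\{E_{t+i}v\}_{i=0}^d$,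 $0\ne v\in E^*_rW$ (dual standard basis); $a^*_i(W)=\mathrm{tr}_W(E_{t+i}A^*)$; $b_d(W)=c_0(W)=b^*_d(W)=c^*_0(W)=0$. Assume $\Gamma$ has *$q$-Racah type*: there are complex $q,h,h^*,r_1,r_2,s,s^*$ with $q\notin\{-1,0,1\}$, $hh^*ss^*\ne0$, $r_1r_2=ss^*q^{D+1}$ such that $\theta_i=\theta_0+hq^{-i}(1-q^i)(1-sq^{i+1})$ and $\theta^*_i=\theta^*_0+h^*q^{-i}(1-q^i)(1-s^*q^{i+1})$ for $0\le i\le D$, and the split sequences of the trivial module are, for $1\le i\le D$, $$hh^*q^{1-2i}(1-q^i)(1-q^{i-D-1})(1-r_1q^i)(1-r_2q^i),$$ $$hh^*q^{1-2i}(1-q^i)(1-q^{i-D-1})(r_1-s^*q^i)(r_2-s^*q^i)/s^*.$$ **Theorem.** (I) Let $W$ be a thin irreducible $T$-module with endpoint $r$, dual endpoint $t$ and diameter $d>0$. There is a unique $\tau(W)\in\mathbb C$ such that for $1\le i\le d$ $$\varphi_i(W)=hh^*(1-q^i)(1-q^{d-i+1})(\tau(W)-ss^*q^{r+t+i+1}-q^{-r-t-i-d}),$$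 $$\phi_i(W)=hh^*(1-q^i)(1-q^{d-i+1})(\tau(W)-s^*q^{r-t-d+i}-sq^{t-r-i+1}).$$ Let $r_1(W),r_2(W)$ be the two roots (with multiplicity) of $\lambda^2-\tau(W)q^{r+t+d}\lambda+ss^*q^{2r+2t+d+1}$. Then: (a) for $1\le i\le d$, $$\varphi_i(W)=hh^*q^{1-2i-t-r}(1-q^i)(1-q^{i-d-1})(1-r_1(W)q^i)(1-r_2(W)q^i),$$ $$\phi_i(W)=hh^*q^{1-2i-t-r}(1-q^i)(1-q^{i-d-1})\frac{(r_1(W)-s^*q^{i+2r})(r_2(W)-s^*q^{i+2r})}{s^*q^{2r}}.$$ (b) for $0\le i,j\le d$, $$u_i(\theta_{t+j})={}_4\phi_3\!\left(\begin{matrix}q^{-i},\;s^*q^{2r+i+1},\;q^{-j},\;sq^{2t+j+1}\\ r_1(W)q,\;r_2(W)q,\;q^{-d}\end{matrix}\;\Big|\;q,q\right),$$ a series that terminates: the numerators of its terms of index $n>\min(i,j)$ vanish, and the denominators of its terms of index $n\le\min(i,j)$ do not. (c) Standard bases and dual standard bases of $W$ exist, and with respect to any of them, with nonvanishing denominators,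 $$b_0(W)=\frac{hq^{-t}(1-q^{-d})(1-r_1(W)q)(1-r_2(W)q)}{1-s^*q^{2r+2}},$$ $$b_i(W)=\frac{hq^{-t}(1-q^{i-d})(1-s^*q^{2r+i+1})(1-r_1(W)q^{i+1})(1-r_2(W)q^{i+1})}{(1-s^*q^{2r+2i+1})(1-s^*q^{2r+2i+2})}\quad(1\le i\le d-1),$$ $$c_i(W)=\frac{hq^{-t}(1-q^i)(1-s^*q^{2r+i+d+1})(r_1(W)-s^*q^{2r+i})(r_2(W)-s^*q^{2r+i})}{s^*q^{2r+d}(1-s^*q^{2r+2i})(1-s^*q^{2r+2i+1})}\quad(1\le i\le d-1),$$ $$c_d(W)=\frac{hq^{-t}(1-q^d)(r_1(W)-s^*q^{2r+d})(r_2(W)-s^*q^{2r+d})}{s^*q^{2r+d}(1-s^*q^{2r+2d})},$$ $$a_i(W)=\theta_t-b_i(W)-c_i(W)\quad(0\le i\le d).$$ The dual intersection numbers $a^*_i(W),b^*_i(W),c^*_i(W)$ are given by the same formulas with $(h,s^*,r,t,\theta_t)$ replaced by $(h^*,s,t,r,\theta^*_r)$. (II) The intersection numbers $a_i=p^i_{1,i}$,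 $b_i=p^i_{1,i+1}$, $c_i=p^i_{1,i-1}$ of $\Gamma$ (with $b_D=c_0=0$) are given by the formulas in (c) with $r=t=0$, $d=D$ and $r_1,r_2$ in place of $r_1(W),r_2(W)$. Its dual intersection numbers $a^*_i=q^i_{1,i}$, $b^*_i=q^i_{1,i+1}$, $c^*_i=q^i_{1,i-1}$ (with $b^*_D=c^*_0=0$) are given by the same formulas with $(h,s^*,\theta_0)$ replaced by $(h^*,s,\theta^*_0)$. -/

import Mathlib

open Matrix Polynomial

noncomputable section

namespace DRG

variable {X : Type*} [Fintype X] [DecidableEq X]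

/-! ### Distance-regular graphs and their Bose-Mesner algebra -/

/-- The `i`th distance matrix `A_i`; the adjacency matrix is `A = A_1`. -/
def distMatrix (G : SimpleGraph X) (i : ℕ) : Matrix X X ℂ :=
  Matrix.of fun y z => if G.dist y z = i then 1 else 0

/-- `p h i j = p^h_{ij}` are the intersection numbers of `G`
(for a connected graph, their existence says that `G` is distance-regular). -/
def IsIntersectionNumbers (G : SimpleGraph X) (p : ℕ → ℕ → ℕ → ℕ) : Prop :=
  ∀ h i j, h ≤ G.diam → i ≤ G.diam → j ≤ G.diam → ∀ y z, G.dist y z = h →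
    (Finset.univ.filter fun w => G.dist y w = i ∧ G.dist z w = j).card = p h i j

/-- The Bose-Mesner algebra `M`, as the span of the distance matrices. -/
def boseMesner (G : SimpleGraph X) : Submodule ℂ (Matrix X X ℂ) :=
  Submodule.span ℂ (Set.range fun i : Fin (G.diam + 1) => distMatrix G i)

/-- `E_0, …, E_D` is an ordering of the primitive idempotents of `G`:  it is a basis of the
Bose-Mesner algebra consisting of mutually orthogonal idempotents that sum to `I`,
with `E_0 = |X|⁻¹ J`. -/
structure IsPrimitiveIdempotents (G : SimpleGraph X) (E : ℕ → Matrix X X ℂ) : Prop where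
  zero : E 0 = (Fintype.card X : ℂ)⁻¹ • Matrix.of fun _ _ => 1
  sum_eq_one : ∑ i ∈ Finset.range (G.diam + 1), E i = 1
  mul : ∀ i j, i ≤ G.diam → j ≤ G.diam → E i * E j = if i = j then E i else 0
  linearIndependent : LinearIndependent ℂ fun i : Fin (G.diam + 1) => E i
  span_eq : Submodule.span ℂ (Set.range fun i : Fin (G.diam + 1) => E i) = boseMesner G

/-- `q h i j = q^h_{ij}` are the Krein parameters (dual intersection numbers) of `G` with
respect to `E`:  the coefficients of the entrywise products `E_i ∘ E_j`. -/
def IsKreinParameters (G : SimpleGraph X) (E : ℕ → Matrix X X ℂ) (q : ℕ → ℕ → ℕ → ℂ) : Prop :=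
  ∀ i j, i ≤ G.diam → j ≤ G.diam →
    E i ⊙ E j = (Fintype.card X : ℂ)⁻¹ • ∑ h ∈ Finset.range (G.diam + 1), q h i j • E h

/-- The `Q`-polynomial property, in terms of the Krein parameters. -/
structure IsQPolynomial (G : SimpleGraph X) (q : ℕ → ℕ → ℕ → ℂ) : Prop where
  eq_zero : ∀ h i j, h ≤ G.diam → i ≤ G.diam → j ≤ G.diam →
    (i + j < h ∨ h + j < i ∨ h + i < j) → q h i j = 0
  ne_zero : ∀ h i j, h ≤ G.diam → i ≤ G.diam → j ≤ G.diam →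
    (h = i + j ∨ i = h + j ∨ j = h + i) → q h i j ≠ 0

/-- `θ_i` is the eigenvalue of `G` associated with `E_i`. -/
def IsEigenvalues (G : SimpleGraph X) (E : ℕ → Matrix X X ℂ) (θ : ℕ → ℂ) : Prop :=
  distMatrix G 1 = ∑ i ∈ Finset.range (G.diam + 1), θ i • E i

/-! ### The dual objects with respect to a vertex, and the Terwilliger algebra -/

/-- The `i`th dual primitive idempotent `E*_i = E*_i(x)`. -/
def dualIdem (G : SimpleGraph X) (x : X) (i : ℕ) : Matrix X X ℂ :=
  Matrix.diagonal fun y => if G.dist x y = i then 1 else 0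

/-- The dual Bose-Mesner algebra `M* = M*(x)`, as the span of the `E*_i`. -/
def dualBoseMesner (G : SimpleGraph X) (x : X) : Submodule ℂ (Matrix X X ℂ) :=
  Submodule.span ℂ (Set.range fun i : Fin (G.diam + 1) => dualIdem G x i)

/-- The dual adjacency matrix `A* = A*(x)`, whose `(y,y)` entry is `|X| (E_1)_{xy}`. -/
def dualAdj (E : ℕ → Matrix X X ℂ) (x : X) : Matrix X X ℂ :=
  Matrix.diagonal fun y => (Fintype.card X : ℂ) * E 1 x y

/-- `θ*_i` is the dual eigenvalue of `G` associated with `E*_i`. -/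
def IsDualEigenvalues (G : SimpleGraph X) (E : ℕ → Matrix X X ℂ) (x : X) (θs : ℕ → ℂ) : Prop :=
  dualAdj E x = ∑ i ∈ Finset.range (G.diam + 1), θs i • dualIdem G x i

/-- The Terwilliger algebra `T = T(x)`, generated by `M` and `M*`. -/
def terwilliger (G : SimpleGraph X) (x : X) : Subalgebra ℂ (Matrix X X ℂ) :=
  Algebra.adjoin ℂ ((boseMesner G : Set (Matrix X X ℂ)) ∪ dualBoseMesner G x)

/-! ### `T`-modules -/

/-- The subspace `W` of the standard module `V = ℂ^X` is a `T`-module. -/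
def IsTModule (G : SimpleGraph X) (x : X) (W : Submodule ℂ (X → ℂ)) : Prop :=
  ∀ B ∈ terwilliger G x, ∀ w ∈ W, B *ᵥ w ∈ W

structure IsIrreducible (G : SimpleGraph X) (x : X) (W : Submodule ℂ (X → ℂ)) : Prop where
  isTModule : IsTModule G x W
  ne_bot : W ≠ ⊥
  eq_bot_or_eq : ∀ W' ≤ W, IsTModule G x W' → W' = ⊥ ∨ W' = W

/-- The subspace `B W`. -/
def image (B : Matrix X X ℂ) (W : Submodule ℂ (X → ℂ)) : Submodule ℂ (X → ℂ) :=
  W.map (Matrix.toLin' B)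

def IsThin (G : SimpleGraph X) (x : X) (W : Submodule ℂ (X → ℂ)) : Prop :=
  ∀ i, i ≤ G.diam → Module.finrank ℂ (image (dualIdem G x i) W) ≤ 1

/-- The endpoint `r` of `W`. -/
def endpoint (G : SimpleGraph X) (x : X) (W : Submodule ℂ (X → ℂ)) : ℕ :=
  sInf {i | i ≤ G.diam ∧ image (dualIdem G x i) W ≠ ⊥}

/-- The dual endpoint `t` of `W`. -/
def dualEndpoint (G : SimpleGraph X) (E : ℕ → Matrix X X ℂ) (W : Submodule ℂ (X → ℂ)) : ℕ :=
  sInf {i | i ≤ G.diam ∧ image (E i) W ≠ ⊥}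

/-- The diameter `d` of the (nonzero) module `W`. -/
def diameter (G : SimpleGraph X) (x : X) (W : Submodule ℂ (X → ℂ)) : ℕ :=
  {i | i ≤ G.diam ∧ image (dualIdem G x i) W ≠ ⊥}.ncard - 1

/-- `W` is the trivial `T`-module:  irreducible, of endpoint `0`, dual endpoint `0` and
diameter `D`. -/
structure IsTrivialModule (G : SimpleGraph X) (E : ℕ → Matrix X X ℂ) (x : X)
    (W : Submodule ℂ (X → ℂ)) : Prop where
  isIrreducible : IsIrreducible G x W
  endpoint_eq : endpoint G x W = 0
  dualEndpoint_eq : dualEndpoint G E W = 0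
  diameter_eq : diameter G x W = G.diam

open Classical in
/-- The action of `B` on `W`, for a matrix `B` with `B W ⊆ W`
(in particular for `B ∈ T` if `W` is a `T`-module); the value `0` for other `B` is never used. -/
def actOn (W : Submodule ℂ (X → ℂ)) (B : Matrix X X ℂ) : Module.End ℂ W :=
  if hB : ∀ w ∈ W, Matrix.toLin' B w ∈ W then (Matrix.toLin' B).restrict hB else 0

/-- `tr_W B`, the trace of the action of `B` on `W`. -/
def trOn (W : Submodule ℂ (X → ℂ)) (B : Matrix X X ℂ) : ℂ :=
  LinearMap.trace ℂ W (actOn W B)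

/-! ### Intersection numbers of `W`

In the next four definitions `(F, B, m)` is `(E*, A, r)` for the intersection numbers `a_i(W)`,
`b_i(W)`, `c_i(W)`, and it is `(E, A*, t)` for the dual intersection numbers. -/

/-- `a_i(W) = tr_W(E*_{r+i} A)`, resp. `a*_i(W) = tr_W(E_{t+i} A*)`. -/
def aNum (F : ℕ → Matrix X X ℂ) (B : Matrix X X ℂ) (m : ℕ) (W : Submodule ℂ (X → ℂ))
    (i : ℕ) : ℂ :=
  trOn W (F (m + i) * B)

/-- For `(F, m, F', m') = (E*, r, E, t)`:  `β` is a standard basis `(E*_{r+i} u)_{0 ≤ i ≤ d}` of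
`W`, where `u` is a nonzero vector in `E_t W`.
For `(F, m, F', m') = (E, t, E*, r)`:  `β` is a dual standard basis. -/
def IsStandardBasis (F : ℕ → Matrix X X ℂ) (m : ℕ) (F' : ℕ → Matrix X X ℂ) (m' : ℕ)
    (W : Submodule ℂ (X → ℂ)) {d : ℕ} (β : Module.Basis (Fin (d + 1)) ℂ W) : Prop :=
  ∃ u ∈ image (F' m') W, u ≠ 0 ∧ ∀ i : Fin (d + 1), (β i : X → ℂ) = F (m + i) *ᵥ u

/-- `b_i(W)`, the `(i,i+1)` entry of the matrix representing `A` with respect to a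
standard basis `β` (resp. `A*` and a dual standard basis), with `b_d(W) = 0`. -/
def bNum (B : Matrix X X ℂ) (W : Submodule ℂ (X → ℂ)) {d : ℕ}
    (β : Module.Basis (Fin (d + 1)) ℂ W) (i : ℕ) : ℂ :=
  if hi : i < d then LinearMap.toMatrix β β (actOn W B) ⟨i, by omega⟩ ⟨i + 1, by omega⟩ else 0

/-- `c_i(W)`, the `(i,i-1)` entry of the same matrix, with `c_0(W) = 0`. -/
def cNum (B : Matrix X X ℂ) (W : Submodule ℂ (X → ℂ)) {d : ℕ}
    (β : Module.Basis (Fin (d + 1)) ℂ W) (i : ℕ) : ℂ :=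
  if hi : 1 ≤ i ∧ i ≤ d then
    LinearMap.toMatrix β β (actOn W B) ⟨i, by omega⟩ ⟨i - 1, by omega⟩ else 0

/-! ### The polynomials `p_i` and `u_i` -/

/-- `x_i(W) = tr_W(E*_{r+i} A E*_{r+i-1} A)` for `i ≥ 1`, and `x_0(W) = 0`. -/
def xNum (G : SimpleGraph X) (x : X) (r : ℕ) (W : Submodule ℂ (X → ℂ)) (i : ℕ) : ℂ :=
  if i = 0 then 0
  else trOn W (dualIdem G x (r + i) * distMatrix G 1 * dualIdem G x (r + i - 1) * distMatrix G 1)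

/-- The polynomials `p_i`, given by `p_0 = 1` and `λ p_i = p_{i+1} + a_i(W) p_i + x_i(W) p_{i-1}`
with `p_{-1} = 0`. -/
def pPoly (G : SimpleGraph X) (x : X) (r : ℕ) (W : Submodule ℂ (X → ℂ)) : ℕ → ℂ[X]
  | 0 => 1
  | 1 => Polynomial.X - C (aNum (dualIdem G x) (distMatrix G 1) r W 0)
  | i + 2 =>
      (Polynomial.X - C (aNum (dualIdem G x) (distMatrix G 1) r W (i + 1))) *
          pPoly G x r W (i + 1)
        - C (xNum G x r W (i + 1)) * pPoly G x r W i

/-- The polynomials `u_i = p_i / p_i(θ_t)`. -/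
def uPoly (G : SimpleGraph X) (x : X) (θ : ℕ → ℂ) (r t : ℕ) (W : Submodule ℂ (X → ℂ))
    (i : ℕ) : ℂ[X] :=
  C ((pPoly G x r W i).eval (θ t))⁻¹ * pPoly G x r W i

/-! ### The split sequences of `W` -/

/-- `τ_i(λ) = (λ - θ_t)(λ - θ_{t+1}) ⋯ (λ - θ_{t+i-1})`. -/
def tauPoly (θ : ℕ → ℂ) (t i : ℕ) : ℂ[X] :=
  ∏ h ∈ Finset.range i, (Polynomial.X - C (θ (t + h)))

/-- `η_i(λ) = (λ - θ_{t+d})(λ - θ_{t+d-1}) ⋯ (λ - θ_{t+d-i+1})`. -/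
def etaPoly (θ : ℕ → ℂ) (t d i : ℕ) : ℂ[X] :=
  ∏ h ∈ Finset.range i, (Polynomial.X - C (θ (t + d - h)))

/-- `U_i = τ_i(A) E*_r W`. -/
def splitSpace (G : SimpleGraph X) (x : X) (θ : ℕ → ℂ) (r t : ℕ) (W : Submodule ℂ (X → ℂ))
    (i : ℕ) : Submodule ℂ (X → ℂ) :=
  image (aeval (distMatrix G 1) (tauPoly θ t i)) (image (dualIdem G x r) W)

/-- `U_i^⇓ = η_i(A) E*_r W`. -/
def splitSpaceDown (G : SimpleGraph X) (x : X) (θ : ℕ → ℂ) (r t d : ℕ)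
    (W : Submodule ℂ (X → ℂ)) (i : ℕ) : Submodule ℂ (X → ℂ) :=
  image (aeval (distMatrix G 1) (etaPoly θ t d i)) (image (dualIdem G x r) W)

/-- The nonzero subspace `U` is contained in the eigenspace of `B` for the eigenvalue `c`. -/
def IsEigenvalueOn (B : Matrix X X ℂ) (U : Submodule ℂ (X → ℂ)) (c : ℂ) : Prop :=
  U ≠ ⊥ ∧ ∀ w ∈ U, B *ᵥ w = c • w

/-- `φ_1, …, φ_d` is the first split sequence of `W`:  `φ_i` is the eigenvalue of
`(A - θ_{t+i-1} I)(A* - θ*_{r+i} I)` on `U_i`. -/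
def IsFirstSplitSequence (G : SimpleGraph X) (E : ℕ → Matrix X X ℂ) (x : X) (θ θs : ℕ → ℂ)
    (r t d : ℕ) (W : Submodule ℂ (X → ℂ)) (φ : ℕ → ℂ) : Prop :=
  ∀ i, 1 ≤ i → i ≤ d →
    IsEigenvalueOn ((distMatrix G 1 - θ (t + i - 1) • (1 : Matrix X X ℂ)) *
        (dualAdj E x - θs (r + i) • (1 : Matrix X X ℂ)))
      (splitSpace G x θ r t W i) (φ i)

/-- `φ_1, …, φ_d` is the second split sequence of `W`:  `φ_i` is the eigenvalue of
`(A - θ_{t+d-i+1} I)(A* - θ*_{r+i} I)` on `U_i^⇓`. -/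
def IsSecondSplitSequence (G : SimpleGraph X) (E : ℕ → Matrix X X ℂ) (x : X) (θ θs : ℕ → ℂ)
    (r t d : ℕ) (W : Submodule ℂ (X → ℂ)) (φ : ℕ → ℂ) : Prop :=
  ∀ i, 1 ≤ i → i ≤ d →
    IsEigenvalueOn ((distMatrix G 1 - θ (t + d - i + 1) • (1 : Matrix X X ℂ)) *
        (dualAdj E x - θs (r + i) • (1 : Matrix X X ℂ)))
      (splitSpaceDown G x θ r t d W i) (φ i)

/-! ### `q`-Racah type -/

/-- `G` has `q`-Racah type, with the scalars `q, h, h*, r₁, r₂, s, s*`.  The parameter array of `G`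
consists of its eigenvalues, its dual eigenvalues, and the first and second split sequence of the
trivial `T(x)`-module. -/
structure IsQRacahType (G : SimpleGraph X) (E : ℕ → Matrix X X ℂ) (x : X) (θ θs : ℕ → ℂ)
    (q h hs r₁ r₂ s ss : ℂ) : Prop where
  q_ne_neg_one : q ≠ -1
  q_ne_zero : q ≠ 0
  q_ne_one : q ≠ 1
  mul_ne_zero : h * hs * s * ss ≠ 0
  mul_eq : r₁ * r₂ = s * ss * q ^ (G.diam + 1)
  eigenvalue : ∀ i : ℕ, i ≤ G.diam →
    θ i = θ 0 + h * q ^ (-(i : ℤ)) * (1 - q ^ i) * (1 - s * q ^ (i + 1))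
  dualEigenvalue : ∀ i : ℕ, i ≤ G.diam →
    θs i = θs 0 + hs * q ^ (-(i : ℤ)) * (1 - q ^ i) * (1 - ss * q ^ (i + 1))
  split : ∃ W₀ : Submodule ℂ (X → ℂ), IsTrivialModule G E x W₀ ∧
    IsFirstSplitSequence G E x θ θs 0 0 G.diam W₀ (fun i =>
      h * hs * q ^ (1 - 2 * (i : ℤ)) * (1 - q ^ i) * (1 - q ^ ((i : ℤ) - G.diam - 1)) *
        (1 - r₁ * q ^ i) * (1 - r₂ * q ^ i)) ∧
    IsSecondSplitSequence G E x θ θs 0 0 G.diam W₀ (fun i =>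
      h * hs * q ^ (1 - 2 * (i : ℤ)) * (1 - q ^ i) * (1 - q ^ ((i : ℤ) - G.diam - 1)) *
        (r₁ - ss * q ^ i) * (r₂ - ss * q ^ i) / ss)

/-- The defining property of the scalar `τ(W)`. -/
def IsTau (G : SimpleGraph X) (E : ℕ → Matrix X X ℂ) (x : X) (θ θs : ℕ → ℂ)
    (q h hs s ss : ℂ) (r t d : ℕ) (W : Submodule ℂ (X → ℂ)) (τ : ℂ) : Prop :=
  IsFirstSplitSequence G E x θ θs r t d W (fun i =>
    h * hs * (1 - q ^ i) * (1 - q ^ ((d : ℤ) - i + 1)) *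
      (τ - s * ss * q ^ (r + t + i + 1) - q ^ (-(r : ℤ) - t - i - d))) ∧
  IsSecondSplitSequence G E x θ θs r t d W (fun i =>
    h * hs * (1 - q ^ i) * (1 - q ^ ((d : ℤ) - i + 1)) *
      (τ - ss * q ^ ((r : ℤ) - t - d + i) - s * q ^ ((t : ℤ) - r - i + 1)))

/-! ### Basic hypergeometric series -/

/-- The `q`-shifted factorial `(a;q)_n`. -/
def qPoch (a q : ℂ) (n : ℕ) : ℂ := ∏ k ∈ Finset.range n, (1 - a * q ^ k)

/-- The numerator of the `n`th coefficient of a `₄φ₃` series. -/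
def phi43Num (a₁ a₂ a₃ a₄ q : ℂ) (n : ℕ) : ℂ :=
  qPoch a₁ q n * qPoch a₂ q n * qPoch a₃ q n * qPoch a₄ q n

/-- The denominator of the `n`th coefficient of a `₄φ₃` series. -/
def phi43Den (b₁ b₂ b₃ q : ℂ) (n : ℕ) : ℂ :=
  qPoch q q n * qPoch b₁ q n * qPoch b₂ q n * qPoch b₃ q n

/-- The basic hypergeometric series `₄φ₃(a₁, a₂, a₃, a₄; b₁, b₂, b₃ | q, z)`.  A terminating
series is read as usual:  terms with numerator zero vanish. -/
def phi43 (a₁ a₂ a₃ a₄ b₁ b₂ b₃ q z : ℂ) : ℂ :=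
  ∑' n : ℕ, phi43Num a₁ a₂ a₃ a₄ q n / phi43Den b₁ b₂ b₃ q n * z ^ n

/-! ### The explicit intersection numbers -/

/-- The explicit formulas for `a_i, b_i, c_i` in terms of `q, h, σ, ρ₁, ρ₂, r, t, d` and `θ_t`.
The field `den_ne_zero` says that no denominator vanishes. -/
structure QRacahFormulas (q h σ ρ₁ ρ₂ θt : ℂ) (r t d : ℕ) (a b c : ℕ → ℂ) : Prop where
  den_ne_zero : q ≠ 0 ∧ σ ≠ 0 ∧ ∀ k, 2 * r + 2 ≤ k → k ≤ 2 * r + 2 * d → 1 - σ * q ^ k ≠ 0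
  b_zero : b 0 = h * q ^ (-(t : ℤ)) * (1 - q ^ (-(d : ℤ))) * (1 - ρ₁ * q) * (1 - ρ₂ * q) /
    (1 - σ * q ^ (2 * r + 2))
  b_eq : ∀ i : ℕ, 1 ≤ i → i + 1 ≤ d →
    b i = h * q ^ (-(t : ℤ)) * (1 - q ^ ((i : ℤ) - d)) * (1 - σ * q ^ (2 * r + i + 1)) *
        (1 - ρ₁ * q ^ (i + 1)) * (1 - ρ₂ * q ^ (i + 1)) /
      ((1 - σ * q ^ (2 * r + 2 * i + 1)) * (1 - σ * q ^ (2 * r + 2 * i + 2)))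
  c_eq : ∀ i : ℕ, 1 ≤ i → i + 1 ≤ d →
    c i = h * q ^ (-(t : ℤ)) * (1 - q ^ i) * (1 - σ * q ^ (2 * r + i + d + 1)) *
        (ρ₁ - σ * q ^ (2 * r + i)) * (ρ₂ - σ * q ^ (2 * r + i)) /
      (σ * q ^ (2 * r + d) * (1 - σ * q ^ (2 * r + 2 * i)) * (1 - σ * q ^ (2 * r + 2 * i + 1)))
  c_last : c d = h * q ^ (-(t : ℤ)) * (1 - q ^ d) *
        (ρ₁ - σ * q ^ (2 * r + d)) * (ρ₂ - σ * q ^ (2 * r + d)) /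
      (σ * q ^ (2 * r + d) * (1 - σ * q ^ (2 * r + 2 * d)))
  a_eq : ∀ i : ℕ, i ≤ d → a i = θt - b i - c i

end DRG

end

open Matrix Polynomial

noncomputable section

namespace DRG

section

/-! ### Systems of rank one idempotents -/

section Abstract

variable {K V : Type*} [Field K] [AddCommGroup V] [Module K V]

/-! On a thin irreducible module `W` the pair (A, A*) acts as a Leonard pair. A is tridiagonal with
respect to the lines E*_{r+i}W, A* is tridiagonal with respect to the lines E_{t+i}W, and
irreducibility makes all off-diagonal entries nonzero (`exists_leonardSystem`,
`QPolynomialGraph.leonardSystem`). The graph enters through the triangle inequality, through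
q^1_{ij} = 0 for |i-j| > 1 (`QPolynomialGraph.E_far`), and through the fact that A and A* generate
the two Bose-Mesner algebras and so have distinct eigenvalues.

For 0 ≠ u in E*_rW the vectors τ_n(A)u form a basis in which A and A* are bidiagonal in opposite
directions, and the off-diagonal entries of A* are the first split sequence φ_n. Eigenvalues of the
form α + βq^i + γq^{-i} force a cubic relation between A and A* (`tridiagonal_relation`). Read in
the split basis, it is a third-order recurrence for φ_n whose homogeneous part has characteristic
roots 1, q, q^{-1}. Together with φ_0 = φ_{d+1} = 0 this leaves one free constant (`splitSeq_form`).
Reversing the order of the eigenvalues treats the second split sequence φ'_n in the same way, and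
comparing φ_1 with φ'_1 identifies the two constants: their common value is τ(W), up to the factor
hh*.

This argument needs q^k ≠ 1 for 1 ≤ k ≤ d+1, while distinct eigenvalues give it only for k ≤ D. If d
= D, however, then r = t = 0 and `W` is the trivial module, whose split sequences are part of the
hypotheses (`exists_moduleSystem`).

The rest is read off from the two split sequences. The polynomial ∑ τ*_n(θ*_i)τ_n/(φ_1⋯φ_n) at A
sends u to an eigenvector of A* for θ*_i, so it is a multiple of p_i, and its value 1 at the first
eigenvalue makes it u_i (`B_awPoly`, `recPoly_normalized`). Its values at the eigenvalues of A are
the ₄φ₃ series term by term (`awPoly_eval`). In a standard basis the rows of A have constant sum, so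
b_0⋯b_{i-1} is the value of p_i at the first eigenvalue, which yields b_i; the three-term recurrence
at the last eigenvalue, where the second split sequence gives the values of p_i, yields c_i
(`bSeq_eq`, `cSeq_eq`). Exchanging A and A* keeps the first split sequence and reverses the second
(`QRacahSystem.exists_dual`), so the dual numbers obey the same formulas.

For the graph itself, the standard basis of the trivial module consists of multiples of the
characteristic vectors of the spheres around x, and the dual one of multiples of the vectors E_i x̂,
where x̂ is the characteristic vector of {x}. The matrix entries are then p^i_{1j} and q^i_{1j}. -/

/-- `F_0, …, F_d` are mutually orthogonal rank one idempotents that sum to the identity. -/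
structure RankOneIdempotents (d : ℕ) (F : ℕ → Module.End K V) : Prop where
  mul : ∀ i j, i ≤ d → j ≤ d → F i * F j = if i = j then F i else 0
  sum : ∑ i ∈ Finset.range (d + 1), F i = 1
  rank_one : ∀ i, i ≤ d → ∃ w, w ≠ 0 ∧ F i w = w ∧ ∀ v, ∃ c : K, F i v = c • w

namespace RankOneIdempotents

variable {d : ℕ} {F : ℕ → Module.End K V}

theorem reverse (hF : RankOneIdempotents d F) : RankOneIdempotents d (fun i => F (d - i)) where
  mul i j hi hj := by
    rw [hF.mul _ _ (by omega) (by omega)]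
    by_cases h : i = j
    · simp [h]
    · rw [if_neg h, if_neg (by omega)]
  sum := by
    rw [← hF.sum]
    exact Finset.sum_flip F
  rank_one i _ := hF.rank_one _ (by omega)

theorem apply_self (hF : RankOneIdempotents d F) {i : ℕ} (hi : i ≤ d) (v : V) :
    F i (F i v) = F i v := by
  rw [← Module.End.mul_apply, hF.mul i i hi hi, if_pos rfl]

theorem apply_of_ne (hF : RankOneIdempotents d F) {i j : ℕ} (hi : i ≤ d) (hj : j ≤ d)
    (hij : i ≠ j) (v : V) : F i (F j v) = 0 := by
  rw [← Module.End.mul_apply, hF.mul i j hi hj, if_neg hij, LinearMap.zero_apply]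

theorem sum_apply (hF : RankOneIdempotents d F) (v : V) :
    ∑ i ∈ Finset.range (d + 1), F i v = v := by
  rw [← LinearMap.sum_apply, hF.sum, Module.End.one_apply]

theorem eq_zero (hF : RankOneIdempotents d F) {v : V} (h : ∀ i, i ≤ d → F i v = 0) : v = 0 := by
  rw [← hF.sum_apply v]
  exact Finset.sum_eq_zero fun i hi => h i (by simpa [Nat.lt_succ_iff] using hi)

theorem exists_eq_smul (hF : RankOneIdempotents d F) {i : ℕ} (hi : i ≤ d) {w : V} (hw : w ≠ 0)
    (hFw : F i w = w) (v : V) : ∃ c : K, F i v = c • w := by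
  obtain ⟨w', -, -, h⟩ := hF.rank_one i hi
  obtain ⟨a, ha⟩ := h w
  obtain ⟨b, hb⟩ := h v
  rw [hFw] at ha
  have ha0 : a ≠ 0 := by
    rintro rfl
    exact hw (by rw [ha, zero_smul])
  refine ⟨b * a⁻¹, ?_⟩
  rw [hb, ha, smul_smul, mul_assoc, inv_mul_cancel₀ ha0, mul_one]

/-- Nonzero vectors in the images of the idempotents form a basis. -/
theorem exists_basis (hF : RankOneIdempotents d F) {w : ℕ → V} (hw : ∀ i, i ≤ d → w i ≠ 0)
    (hFw : ∀ i, i ≤ d → F i (w i) = w i) :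
    ∃ b : Module.Basis (Fin (d + 1)) K V, (∀ i : Fin (d + 1), b i = w i) ∧
      ∀ (i : Fin (d + 1)) v, F i v = b.repr v i • w i := by
  have hFj : ∀ i j : Fin (d + 1), i ≠ j → F j (w i) = 0 := fun i j hij => by
    rw [← hFw i (by omega), hF.apply_of_ne (by omega) (by omega) (by simpa [Fin.ext_iff] using hij.symm)]
  have hli : LinearIndependent K fun i : Fin (d + 1) => w i := by
    rw [Fintype.linearIndependent_iff]
    intro g hg i
    have := congrArg (F i) hg
    rw [map_sum, Finset.sum_eq_single i, map_zero, map_smul, hFw i (by omega)] at this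
    · exact (smul_eq_zero.1 this).resolve_right (hw i (by omega))
    · intro j _ hj
      rw [map_smul, hFj j i hj, smul_zero]
    · simp
  have hsp : ⊤ ≤ Submodule.span K (Set.range fun i : Fin (d + 1) => w i) := by
    intro v _
    rw [← hF.sum_apply v]
    refine Submodule.sum_mem _ fun i hi => ?_
    have hi' : i < d + 1 := by simpa using hi
    obtain ⟨c, hc⟩ := hF.exists_eq_smul (by omega) (hw i (by omega)) (hFw i (by omega)) v
    rw [hc]
    exact Submodule.smul_mem _ _ (Submodule.subset_span ⟨⟨i, hi'⟩, rfl⟩)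
  refine ⟨Module.Basis.mk hli hsp, fun i => by simp, fun i v => ?_⟩
  set b := Module.Basis.mk hli hsp
  have hb : ∀ i, b i = w i := fun i => by simp [b]
  conv_lhs => rw [← b.sum_repr v]
  rw [map_sum, Finset.sum_eq_single i, map_smul, hb, hFw i (by omega)]
  · intro j _ hj
    rw [map_smul, hb, hFj j i hj, smul_zero]
  · simp

theorem exists_adapted_basis (hF : RankOneIdempotents d F) :
    ∃ b : Module.Basis (Fin (d + 1)) K V,
      (∀ i : Fin (d + 1), F i (b i) = b i) ∧ ∀ (i : Fin (d + 1)) v, F i v = b.repr v i • b i := by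
  choose! w hw hFw _ using hF.rank_one
  obtain ⟨b, hb, hr⟩ := hF.exists_basis hw hFw
  exact ⟨b, fun i => by rw [hb, hFw i (by omega)], fun i v => by rw [hb, hr]⟩

theorem finite (hF : RankOneIdempotents d F) : Module.Finite K V := by
  obtain ⟨b, -⟩ := hF.exists_adapted_basis
  exact Module.Finite.of_basis b

theorem finrank_eq (hF : RankOneIdempotents d F) : Module.finrank K V = d + 1 := by
  obtain ⟨b, -⟩ := hF.exists_adapted_basis
  rw [Module.finrank_eq_card_basis b, Fintype.card_fin]

/-- In an adapted basis `F i * M` is a rank one map whose trace is the i-th diagonal entry of `M`.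
This turns the trace definitions of a_i and x_i into statements about vectors. -/
theorem apply_eq_trace_smul (hF : RankOneIdempotents d F) {i : ℕ} (hi : i ≤ d) {w : V}
    (hFw : F i w = w) (M : Module.End K V) :
    F i (M w) = LinearMap.trace K V (F i * M) • w := by
  have := hF.finite
  obtain ⟨b, hb, hr⟩ := hF.exists_adapted_basis
  let k : Fin (d + 1) := ⟨i, by omega⟩
  have hr' : ∀ v, F i v = b.repr v k • b k := hr k
  have e : F i * M = (b.coord k ∘ₗ M).smulRight (b k) := by
    ext v
    simp [hr']
  rw [e, LinearMap.trace_smulRight, ← hFw, hr' w, hr', map_smul]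
  simp [smul_smul, mul_comm]

end RankOneIdempotents

/-! ### Monic polynomials of a three-term recurrence -/

/-- The polynomials given by `p_0 = 1` and `λ p_i = p_{i+1} + a_i p_i + x_i p_{i-1}`. -/
def recPoly (a x : ℕ → K) : ℕ → K[X]
  | 0 => 1
  | 1 => X - C (a 0)
  | i + 2 => (X - C (a (i + 1))) * recPoly a x (i + 1) - C (x (i + 1)) * recPoly a x i

theorem recPoly_monic (a x : ℕ → K) :
    ∀ i, (recPoly a x i).Monic ∧ (recPoly a x i).natDegree = i
  | 0 => by simp [recPoly]
  | 1 => by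
    rw [recPoly]
    exact ⟨monic_X_sub_C _, natDegree_X_sub_C _⟩
  | i + 2 => by
    obtain ⟨h1, h1'⟩ := recPoly_monic a x (i + 1)
    obtain ⟨h0, h0'⟩ := recPoly_monic a x i
    rw [recPoly]
    have hm : ((X - C (a (i + 1))) * recPoly a x (i + 1)).Monic := (monic_X_sub_C _).mul h1
    have hd : ((X - C (a (i + 1))) * recPoly a x (i + 1)).natDegree = i + 2 := by
      rw [(monic_X_sub_C _).natDegree_mul h1, natDegree_X_sub_C, h1']
      ring
    have hlt : (C (x (i + 1)) * recPoly a x i).degree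
        < ((X - C (a (i + 1))) * recPoly a x (i + 1)).degree := by
      rw [degree_eq_natDegree hm.ne_zero, hd]
      refine lt_of_le_of_lt degree_le_natDegree ?_
      exact_mod_cast lt_of_le_of_lt (natDegree_C_mul_le _ _) (by omega)
    refine ⟨hm.sub_of_left hlt, ?_⟩
    rw [natDegree_sub_eq_left_of_natDegree_lt, hd]
    rw [hd]
    exact lt_of_le_of_lt (natDegree_C_mul_le _ _) (by omega)

/-! ### Leonard systems -/

/-- The data `(A; A*; {E_i}; {E*_i})` of a Leonard system of diameter `d`, with eigenvalue
sequence `θ` and dual eigenvalue sequence `θs`; here `B` is `A*` and `F_i` is `E*_i`. -/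
structure LeonardSystem (d : ℕ) (A B : Module.End K V) (E F : ℕ → Module.End K V)
    (θ θs : ℕ → K) : Prop where
  idemE : RankOneIdempotents d E
  idemF : RankOneIdempotents d F
  A_mul : ∀ i, i ≤ d → A * E i = θ i • E i
  B_mul : ∀ i, i ≤ d → B * F i = θs i • F i
  θ_inj : ∀ i j, i ≤ d → j ≤ d → θ i = θ j → i = j
  θs_inj : ∀ i j, i ≤ d → j ≤ d → θs i = θs j → i = j
  E_far : ∀ i j, i ≤ d → j ≤ d → (i + 1 < j ∨ j + 1 < i) → E i * B * E j = 0
  F_far : ∀ i j, i ≤ d → j ≤ d → (i + 1 < j ∨ j + 1 < i) → F i * A * F j = 0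
  E_near : ∀ i, i < d → E (i + 1) * B * E i ≠ 0 ∧ E i * B * E (i + 1) ≠ 0
  F_near : ∀ i, i < d → F (i + 1) * A * F i ≠ 0 ∧ F i * A * F (i + 1) ≠ 0

/-- `τ_n = (λ - θ_0) ⋯ (λ - θ_{n-1})`. -/
def nodePoly (θ : ℕ → K) (n : ℕ) : K[X] := ∏ h ∈ Finset.range n, (X - C (θ h))

theorem nodePoly_monic (θ : ℕ → K) (n : ℕ) : (nodePoly θ n).Monic :=
  monic_prod_of_monic _ _ fun _ _ => monic_X_sub_C _

theorem nodePoly_natDegree (θ : ℕ → K) (n : ℕ) : (nodePoly θ n).natDegree = n := by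
  rw [nodePoly, natDegree_prod_of_monic _ _ fun _ _ => monic_X_sub_C _]
  simp

theorem nodePoly_succ (θ : ℕ → K) (n : ℕ) :
    nodePoly θ (n + 1) = (X - C (θ n)) * nodePoly θ n := by
  rw [nodePoly, Finset.prod_range_succ, mul_comm]
  rfl

theorem nodePoly_eval_eq_zero (θ : ℕ → K) {n j : ℕ} (h : j < n) : (nodePoly θ n).eval (θ j) = 0 := by
  rw [nodePoly, eval_prod]
  exact Finset.prod_eq_zero (Finset.mem_range.2 h) (by simp)

theorem nodePoly_zero (θ : ℕ → K) : nodePoly θ 0 = 1 := rfl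

theorem nodePoly_eval (θ : ℕ → K) (n : ℕ) (c : K) :
    (nodePoly θ n).eval c = ∏ h ∈ Finset.range n, (c - θ h) := by
  simp [nodePoly, eval_prod]

namespace LeonardSystem

variable {d : ℕ} {A B : Module.End K V} {E F : ℕ → Module.End K V} {θ θs : ℕ → K}

theorem dual (L : LeonardSystem d A B E F θ θs) : LeonardSystem d B A F E θs θ :=
  ⟨L.idemF, L.idemE, L.B_mul, L.A_mul, L.θs_inj, L.θ_inj, L.F_far, L.E_far, L.F_near, L.E_near⟩

/-- The second split sequence is the first split sequence of this system, so everything proved about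
the first applies to both. -/
theorem reverse (L : LeonardSystem d A B E F θ θs) :
    LeonardSystem d A B (fun i => E (d - i)) F (fun i => θ (d - i)) θs where
  idemE := L.idemE.reverse
  idemF := L.idemF
  A_mul i _ := L.A_mul _ (by omega)
  B_mul := L.B_mul
  θ_inj i j hi hj h := by
    have := L.θ_inj _ _ (by omega) (by omega) h
    omega
  θs_inj := L.θs_inj
  E_far i j hi hj h := L.E_far _ _ (by omega) (by omega) (by omega)
  F_far := L.F_far
  E_near i hi := by
    have h := L.E_near (d - (i + 1)) (by omega)
    rw [show d - (i + 1) + 1 = d - i by omega] at h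
    exact h.symm
  F_near := L.F_near

theorem eval_ne_zero (L : LeonardSystem d A B E F θ θs) {n j : ℕ} (hnj : n ≤ j) (hj : j ≤ d) :
    (nodePoly θ n).eval (θ j) ≠ 0 := by
  rw [nodePoly_eval, Finset.prod_ne_zero_iff]
  intro h hh
  have hh' := Finset.mem_range.1 hh
  rw [sub_ne_zero]
  intro he
  have := L.θ_inj _ _ hj (by omega) he
  omega

theorem A_eq_sum (L : LeonardSystem d A B E F θ θs) :
    A = ∑ i ∈ Finset.range (d + 1), θ i • E i := by
  conv_lhs => rw [← mul_one A, ← L.idemE.sum, Finset.mul_sum]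
  exact Finset.sum_congr rfl fun i hi =>
    L.A_mul i (by simpa [Nat.lt_succ_iff] using hi)

theorem A_apply (L : LeonardSystem d A B E F θ θs) {i : ℕ} (hi : i ≤ d) (v : V) :
    A (E i v) = θ i • E i v := by
  rw [← Module.End.mul_apply, L.A_mul i hi, LinearMap.smul_apply]

theorem mul_A (L : LeonardSystem d A B E F θ θs) {i : ℕ} (hi : i ≤ d) : E i * A = θ i • E i := by
  conv_lhs => rw [L.A_eq_sum, Finset.mul_sum]
  rw [Finset.sum_eq_single i]
  · rw [mul_smul_comm, L.idemE.mul i i hi hi, if_pos rfl]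
  · intro j hj hji
    rw [mul_smul_comm, L.idemE.mul i j hi (by simpa [Nat.lt_succ_iff] using hj), if_neg hji.symm,
      smul_zero]
  · simp; omega

theorem apply_A (L : LeonardSystem d A B E F θ θs) {i : ℕ} (hi : i ≤ d) (v : V) :
    E i (A v) = θ i • E i v := by
  rw [← Module.End.mul_apply, L.mul_A hi, LinearMap.smul_apply]

theorem apply_aeval (L : LeonardSystem d A B E F θ θs) {i : ℕ} (hi : i ≤ d) (g : K[X]) (v : V) :
    E i (aeval A g v) = g.eval (θ i) • E i v := by
  induction g using Polynomial.induction_on' with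
  | add p q hp hq => simp [hp, hq, add_smul]
  | monomial n a =>
    have : ∀ n, E i ((A ^ n) v) = θ i ^ n • E i v := by
      intro n
      induction n with
      | zero => simp
      | succ n ih => rw [pow_succ', Module.End.mul_apply, L.apply_A hi, ih, smul_smul, pow_succ']
    simp [aeval_monomial, this, smul_smul]

/-! #### The vectors `p_i(A) u` -/

/-- `a_i = tr(E*_i A)`. -/
def aSeq (A : Module.End K V) (F : ℕ → Module.End K V) (i : ℕ) : K :=
  LinearMap.trace K V (F i * A)

/-- `x_i = tr(E*_i A E*_{i-1} A)`. -/
def xSeq (A : Module.End K V) (F : ℕ → Module.End K V) (i : ℕ) : K :=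
  LinearMap.trace K V (F i * A * F (i - 1) * A)

/-- Tridiagonality: each application of A moves at most one step up, so A^k u has no component
beyond index k. -/
theorem F_A_pow (L : LeonardSystem d A B E F θ θs) {u : V} (hu : F 0 u = u) :
    ∀ k m, k < m → m ≤ d → F m ((A ^ k) u) = 0 := by
  intro k
  induction k with
  | zero =>
    intro m hm hmd
    rw [pow_zero, Module.End.one_apply, ← hu, L.idemF.apply_of_ne hmd (by omega) (by omega)]
  | succ k ih =>
    intro m hm hmd
    rw [pow_succ', Module.End.mul_apply, ← L.idemF.sum_apply ((A ^ k) u), map_sum, map_sum]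
    refine Finset.sum_eq_zero fun j hj => ?_
    have hj' : j < d + 1 := by simpa using hj
    by_cases hjk : k < j
    · rw [ih j hjk (by omega), map_zero, map_zero]
    · have := L.F_far m j hmd (by omega) (by omega)
      exact LinearMap.congr_fun this ((A ^ k) u)

theorem F_aeval (L : LeonardSystem d A B E F θ θs) {u : V} (hu : F 0 u = u) {g : K[X]} {n : ℕ}
    (hn : n ≤ d) (hg : g.natDegree ≤ n) :
    F n (aeval A g u) = g.coeff n • F n ((A ^ n) u) := by
  rw [aeval_eq_sum_range' (Nat.lt_succ_of_le hg), LinearMap.sum_apply, map_sum,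
    Finset.sum_range_succ, Finset.sum_eq_zero, zero_add, LinearMap.smul_apply, map_smul]
  intro i hi
  rw [LinearMap.smul_apply, map_smul, L.F_A_pow hu i n (by simpa using hi) hn, smul_zero]

theorem F_A_pow_self_ne_zero (L : LeonardSystem d A B E F θ θs) {u : V} (hu : F 0 u = u)
    (hu0 : u ≠ 0) : ∀ n, n ≤ d → F n ((A ^ n) u) ≠ 0 := by
  intro n
  induction n with
  | zero => intro _; simpa [hu] using hu0
  | succ n ih =>
    intro hn
    have e : F (n + 1) ((A ^ (n + 1)) u) = F (n + 1) (A (F n ((A ^ n) u))) := by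
      rw [pow_succ', Module.End.mul_apply]
      conv_lhs => rw [← L.idemF.sum_apply ((A ^ n) u), map_sum, map_sum]
      refine Finset.sum_eq_single n (fun j hj hjn => ?_) (by simp; omega)
      have hj' : j < d + 1 := by simpa using hj
      rcases lt_or_gt_of_ne hjn with h | h
      · exact LinearMap.congr_fun (L.F_far (n + 1) j hn (by omega) (by omega)) ((A ^ n) u)
      · rw [L.F_A_pow hu n j h (by omega), map_zero, map_zero]
    rw [e]
    intro h0
    refine (L.F_near n hn).1 (LinearMap.ext fun v => ?_)
    obtain ⟨c, hc⟩ := L.idemF.exists_eq_smul (by omega) (ih (by omega))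
      (L.idemF.apply_self (by omega) _) v
    simp [hc, h0]

theorem F_aeval_eq_zero (L : LeonardSystem d A B E F θ θs) {u : V} (hu : F 0 u = u) {g : K[X]}
    {n : ℕ} (hn : n ≤ d) (hg : g.natDegree < n) : F n (aeval A g u) = 0 := by
  rw [L.F_aeval hu hn hg.le, coeff_eq_zero_of_natDegree_lt hg, zero_smul]

/-- The leading term of g is the only one that reaches the component of index deg g, and it is
nonzero there. Hence deg g can be read off from the highest nonzero component of g(A)u. -/
theorem degree_lt_of_F_aeval (L : LeonardSystem d A B E F θ θs) {u : V} (hu : F 0 u = u)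
    (hu0 : u ≠ 0) {g : K[X]} (hg : g.natDegree ≤ d) {n : ℕ}
    (h : ∀ m, n ≤ m → m ≤ d → F m (aeval A g u) = 0) : g.degree < n := by
  by_contra hlt
  rw [not_lt] at hlt
  have hg0 : g ≠ 0 := by
    rintro rfl
    simp at hlt
  have hn : n ≤ g.natDegree := by rwa [degree_eq_natDegree hg0, Nat.cast_le] at hlt
  have := h _ hn hg
  rw [L.F_aeval hu hg le_rfl] at this
  rcases smul_eq_zero.1 this with h | h
  · exact hg0 (leadingCoeff_eq_zero.1 h)
  · exact L.F_A_pow_self_ne_zero hu hu0 _ hg h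

theorem eq_zero_of_aeval (L : LeonardSystem d A B E F θ θs) {u : V} (hu : F 0 u = u)
    (hu0 : u ≠ 0) {g : K[X]} (hg : g.natDegree ≤ d) (h : aeval A g u = 0) : g = 0 := by
  have := L.degree_lt_of_F_aeval hu hu0 hg (n := 0) (fun m _ _ => by rw [h, map_zero])
  simpa using this

/-- The vectors `p_i(A) u` lie in `E*_i V`, are nonzero, and satisfy the recurrence. -/
theorem recPoly_apply (L : LeonardSystem d A B E F θ θs) {u : V} (hu : F 0 u = u) :
    ∀ i, i ≤ d → F i (aeval A (recPoly (aSeq A F) (xSeq A F) i) u)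
      = aeval A (recPoly (aSeq A F) (xSeq A F) i) u ∧
    aeval A (recPoly (aSeq A F) (xSeq A F) (i + 1)) u
      = ∑ j ∈ Finset.Ioc i d, F j (A (aeval A (recPoly (aSeq A F) (xSeq A F) i) u)) := by
  have split : ∀ i, i ≤ d → ∀ v, v = (∑ j ∈ Finset.range i, F j v) + F i v +
      ∑ j ∈ Finset.Ioc i d, F j v := by
    intro i hi v
    conv_lhs => rw [← L.idemF.sum_apply v, Finset.range_eq_Ico,
      ← Finset.sum_Ico_consecutive _ (Nat.zero_le (i + 1)) (by omega), ← Finset.range_eq_Ico,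
      Finset.sum_range_succ]
    congr 2
    ext j
    simp only [Finset.mem_Ico, Finset.mem_Ioc]
    omega
  -- Above index i only the component i+1 of A v survives when i < d. For i = d the index set is
  -- empty, which later gives p_{d+1}(A)u = 0.
  have hsing : ∀ i, i + 1 ≤ d → ∀ v, F i v = v →
      ∑ j ∈ Finset.Ioc i d, F j (A v) = F (i + 1) (A v) := by
    intro i hi v hv
    refine Finset.sum_eq_single (i + 1) (fun j hj hji => ?_) (fun h => ?_)
    · rw [Finset.mem_Ioc] at hj
      rw [← hv]
      exact LinearMap.congr_fun (L.F_far j i hj.2 (by omega) (by omega)) v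
    · exact absurd (Finset.mem_Ioc.2 ⟨by omega, hi⟩) h
  intro i
  induction i using Nat.strong_induction_on with
  | _ i ih =>
  intro hi
  have h1 : F i (aeval A (recPoly (aSeq A F) (xSeq A F) i) u)
      = aeval A (recPoly (aSeq A F) (xSeq A F) i) u := by
    cases i with
    | zero => simpa [recPoly] using hu
    | succ i =>
      obtain ⟨h1, h2⟩ := ih i (by omega) (by omega)
      rw [h2, hsing i hi _ h1, L.idemF.apply_self hi]
  refine ⟨h1, ?_⟩
  set w := aeval A (recPoly (aSeq A F) (xSeq A F) i) u with hw
  have ha : F i (A w) = aSeq A F i • w := L.idemF.apply_eq_trace_smul hi h1 A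
  have hs := split i hi (A w)
  rw [ha] at hs
  cases i with
  | zero =>
    rw [Finset.range_zero, Finset.sum_empty, zero_add] at hs
    have : aeval A (recPoly (aSeq A F) (xSeq A F) (0 + 1)) u = A w - aSeq A F 0 • w := by
      simp [recPoly, hw, Algebra.algebraMap_eq_smul_one]
    rw [this, sub_eq_iff_eq_add, add_comm]
    exact hs
  | succ i =>
    obtain ⟨g1, g2⟩ := ih i (by omega) (by omega)
    set w' := aeval A (recPoly (aSeq A F) (xSeq A F) i) u with hw'
    rw [← hw, hsing i hi _ g1] at g2
    have hlow : ∑ j ∈ Finset.range (i + 1), F j (A w) = xSeq A F (i + 1) • w' := by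
      rw [Finset.sum_range_succ, Finset.sum_eq_zero, zero_add]
      · rw [g2]
        have := L.idemF.apply_eq_trace_smul (by omega) g1 (A * F (i + 1) * A)
        simp only [Module.End.mul_apply] at this
        -- Projecting to F_i V produces tr(F_i A F_{i+1} A), whereas x_{i+1} is tr(F_{i+1} A F_i A);
        -- cyclicity of the trace identifies them.
        have hc := LinearMap.trace_mul_comm K (F i * A) (F (i + 1) * A)
        simp only [mul_assoc] at hc
        rw [this, xSeq, Nat.add_sub_cancel]
        simp only [mul_assoc]
        rw [hc]
      · intro j hj
        have hj' := Finset.mem_range.1 hj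
        rw [← h1]
        exact LinearMap.congr_fun (L.F_far j (i + 1) (by omega) hi (by omega)) w
    rw [hlow] at hs
    have : aeval A (recPoly (aSeq A F) (xSeq A F) (i + 1 + 1)) u
        = A w - aSeq A F (i + 1) • w - xSeq A F (i + 1) • w' := by
      simp [recPoly, hw, hw', Algebra.algebraMap_eq_smul_one, sub_mul]
    rw [this]
    conv_lhs => rw [hs]
    abel

theorem recPoly_apply_ne_zero (L : LeonardSystem d A B E F θ θs) {u : V} (hu : F 0 u = u)
    (hu0 : u ≠ 0) {i : ℕ} (hi : i ≤ d) :
    aeval A (recPoly (aSeq A F) (xSeq A F) i) u ≠ 0 := fun h =>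
  (recPoly_monic (aSeq A F) (xSeq A F) i).1.ne_zero
    (L.eq_zero_of_aeval hu hu0 ((recPoly_monic _ _ i).2.trans_le hi) h)

theorem recPoly_last (L : LeonardSystem d A B E F θ θs) {u : V} (hu : F 0 u = u) :
    aeval A (recPoly (aSeq A F) (xSeq A F) (d + 1)) u = 0 := by
  rw [(L.recPoly_apply hu d le_rfl).2, Finset.Ioc_self, Finset.sum_empty]

theorem exists_aeval (L : LeonardSystem d A B E F θ θs) {u : V} (hu : F 0 u = u) (hu0 : u ≠ 0)
    (v : V) : ∃ g : K[X], g.natDegree ≤ d ∧ v = aeval A g u := by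
  have : ∀ i, ∃ c : K, i ≤ d → F i v = c • aeval A (recPoly (aSeq A F) (xSeq A F) i) u := by
    intro i
    by_cases hi : i ≤ d
    · obtain ⟨c, hc⟩ := L.idemF.exists_eq_smul hi (L.recPoly_apply_ne_zero hu hu0 hi)
        (L.recPoly_apply hu i hi).1 v
      exact ⟨c, fun _ => hc⟩
    · exact ⟨0, fun h => absurd h hi⟩
  choose c hc using this
  refine ⟨∑ i ∈ Finset.range (d + 1), c i • recPoly (aSeq A F) (xSeq A F) i, ?_, ?_⟩
  · refine natDegree_sum_le_of_forall_le _ _ fun i hi => ?_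
    refine (natDegree_smul_le _ _).trans ?_
    rw [(recPoly_monic _ _ i).2]
    simpa [Nat.lt_succ_iff] using hi
  · rw [map_sum, LinearMap.sum_apply]
    conv_lhs => rw [← L.idemF.sum_apply v]
    refine Finset.sum_congr rfl fun i hi => ?_
    rw [hc i (by simpa [Nat.lt_succ_iff] using hi), map_smul, LinearMap.smul_apply]

/-- Since u is cyclic for A and E_j g(A)u = g(θ_j) E_j u, the equation E_j u = 0 would make E_j
vanish identically. -/
theorem E_apply_ne_zero (L : LeonardSystem d A B E F θ θs) {u : V} (hu : F 0 u = u) (hu0 : u ≠ 0)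
    {j : ℕ} (hj : j ≤ d) : E j u ≠ 0 := by
  intro h
  obtain ⟨w, hw, hEw, -⟩ := L.idemE.rank_one j hj
  obtain ⟨g, -, rfl⟩ := L.exists_aeval hu hu0 w
  rw [L.apply_aeval hj, h, smul_zero] at hEw
  exact hw hEw.symm

end LeonardSystem

end Abstract

end

section

section Abstract

variable {K V : Type*} [Field K] [AddCommGroup V] [Module K V]

/-! ### Split sequences of a Leonard system -/

/-- The vector `τ_n(A) u`. -/
def splitVec (A : Module.End K V) (θ : ℕ → K) (u : V) (n : ℕ) : V := aeval A (nodePoly θ n) u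

theorem A_splitVec (A : Module.End K V) (θ : ℕ → K) (u : V) (n : ℕ) :
    A (splitVec A θ u n) = θ n • splitVec A θ u n + splitVec A θ u (n + 1) := by
  simp [splitVec, nodePoly_succ, Algebra.algebraMap_eq_smul_one]

/-- `φ` is the split sequence attached to the vectors `τ_n(A) u`, normalized outside `1, …, d`. -/
structure IsSplitSeq (d : ℕ) (A B : Module.End K V) (θ θs : ℕ → K) (u : V) (φ : ℕ → K) : Prop where
  apply_zero : B u = θs 0 • u
  apply_succ : ∀ n, n < d →
    B (splitVec A θ u (n + 1)) = θs (n + 1) • splitVec A θ u (n + 1) + φ (n + 1) • splitVec A θ u n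
  zero : φ 0 = 0
  last : φ (d + 1) = 0

namespace LeonardSystem

variable {d : ℕ} {A B : Module.End K V} {E F : ℕ → Module.End K V} {θ θs : ℕ → K}

theorem E_splitVec (L : LeonardSystem d A B E F θ θs) (u : V) {j : ℕ} (hj : j ≤ d) (n : ℕ) :
    E j (splitVec A θ u n) = (nodePoly θ n).eval (θ j) • E j u :=
  L.apply_aeval hj _ u

theorem E_splitVec_eq_zero (L : LeonardSystem d A B E F θ θs) (u : V) {j n : ℕ} (hj : j ≤ d)
    (h : j < n) : E j (splitVec A θ u n) = 0 := by
  rw [L.E_splitVec u hj, nodePoly_eval_eq_zero θ h, zero_smul]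

theorem splitVec_eq_zero (L : LeonardSystem d A B E F θ θs) (u : V) {n : ℕ} (hn : d < n) :
    splitVec A θ u n = 0 :=
  L.idemE.eq_zero fun _ hj => L.E_splitVec_eq_zero u hj (by omega)

theorem splitVec_ne_zero (L : LeonardSystem d A B E F θ θs) {u : V} (hu : F 0 u = u)
    (hu0 : u ≠ 0) {n : ℕ} (hn : n ≤ d) : splitVec A θ u n ≠ 0 := fun h =>
  (nodePoly_monic θ n).ne_zero (L.eq_zero_of_aeval hu hu0 ((nodePoly_natDegree θ n).trans_le hn) h)

theorem F_splitVec_eq_zero (L : LeonardSystem d A B E F θ θs) {u : V} (hu : F 0 u = u) {m n : ℕ}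
    (hm : m ≤ d) (h : n < m) : F m (splitVec A θ u n) = 0 :=
  L.F_aeval_eq_zero hu hm (by rwa [nodePoly_natDegree])

theorem F_splitVec_self_ne_zero (L : LeonardSystem d A B E F θ θs) {u : V} (hu : F 0 u = u)
    (hu0 : u ≠ 0) {n : ℕ} (hn : n ≤ d) : F n (splitVec A θ u n) ≠ 0 := by
  have h := nodePoly_natDegree θ n
  rw [splitVec, L.F_aeval hu hn h.le]
  have : (nodePoly θ n).coeff n = 1 := by
    have := nodePoly_monic θ n
    rw [Monic, leadingCoeff, h] at this
    exact this
  rw [this, one_smul]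
  exact L.F_A_pow_self_ne_zero hu hu0 n hn

/-- The vector w = (B - θ*_{n+1})τ_{n+1}(A)u is trapped from two sides. It has no F_m-component for
m > n, so w = g(A)u with deg g ≤ n. As τ_{n+1}(A)u has no E_k-component for k ≤ n and B is
tridiagonal with respect to the E_k, also E_j w = 0 for j < n, so g vanishes at θ_0, …, θ_{n-1}.
Hence g is a scalar multiple of τ_n. -/
theorem exists_splitSeq (L : LeonardSystem d A B E F θ θs) {u : V} (hu : F 0 u = u)
    (hu0 : u ≠ 0) : ∃ φ, IsSplitSeq d A B θ θs u φ := by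
  have key : ∀ n, ∃ c : K, n < d → B (splitVec A θ u (n + 1))
      = θs (n + 1) • splitVec A θ u (n + 1) + c • splitVec A θ u n := by
    intro n
    by_cases hn : n < d
    swap
    · exact ⟨0, fun h => absurd h hn⟩
    set U := splitVec A θ u with hU
    set w := B (U (n + 1)) - θs (n + 1) • U (n + 1) with hw
    have hFw : ∀ m, n + 1 ≤ m → m ≤ d → F m w = 0 := by
      intro m hnm hm
      rw [hw, map_sub, L.dual.apply_A hm, map_smul]
      rcases hnm.eq_or_lt with rfl | h
      · rw [sub_self]
      · rw [L.F_splitVec_eq_zero hu hm h, smul_zero, smul_zero, sub_zero]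
    have hEw : ∀ j, j < n → E j w = 0 := by
      intro j hj
      rw [hw, map_sub, map_smul, L.E_splitVec_eq_zero u (by omega) (by omega), smul_zero, sub_zero,
        ← L.idemE.sum_apply (U (n + 1)), map_sum, map_sum]
      refine Finset.sum_eq_zero fun k hk => ?_
      have hk' : k < d + 1 := by simpa using hk
      by_cases hkn : k < n + 1
      · rw [L.E_splitVec_eq_zero u (by omega) hkn, map_zero, map_zero]
      · exact LinearMap.congr_fun (L.E_far j k (by omega) (by omega) (by omega)) (U (n + 1))
    obtain ⟨g, hg, hgw⟩ := L.exists_aeval hu hu0 w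
    have hdeg : g.degree < (n + 1 : ℕ) :=
      L.degree_lt_of_F_aeval hu hu0 hg fun m h1 h2 => by rw [← hgw, hFw m h1 h2]
    have hroot : ∀ j, j < n → g.eval (θ j) = 0 := by
      intro j hj
      have := hEw j hj
      rw [hgw, L.apply_aeval (by omega)] at this
      exact (smul_eq_zero.1 this).resolve_right (L.E_apply_ne_zero hu hu0 (by omega))
    have hdvd : nodePoly θ n ∣ g := by
      refine Finset.prod_dvd_of_coprime ?_ fun j hj =>
        dvd_iff_isRoot.2 (hroot j (Finset.mem_range.1 hj))
      intro i hi j hj hij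
      refine isCoprime_X_sub_C_of_isUnit_sub (sub_ne_zero.2 fun h => hij ?_).isUnit
      exact L.θ_inj i j (by simp at hi; omega) (by simp at hj; omega) h
    obtain ⟨k, hk⟩ := hdvd
    have hk0 : k.natDegree = 0 := by
      by_cases hkz : k = 0
      · simp [hkz]
      have hnd : g.natDegree = n + k.natDegree := by
        rw [hk, (nodePoly_monic θ n).natDegree_mul' hkz, nodePoly_natDegree]
      have : g.natDegree < n + 1 := by
        rw [natDegree_lt_iff_degree_lt]
        · exact hdeg
        · rw [hk]
          exact mul_ne_zero (nodePoly_monic θ n).ne_zero hkz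
      omega
    rw [eq_C_of_natDegree_eq_zero hk0] at hk
    refine ⟨k.coeff 0, fun _ => ?_⟩
    rw [← sub_eq_iff_eq_add', ← hw, hgw, hk, hU, splitVec]
    simp [Algebra.algebraMap_eq_smul_one]
  choose c hc using key
  -- The zeros placed at 0 and d+1 are the boundary conditions used to solve the recurrence.
  refine ⟨fun n => if n = 0 ∨ n = d + 1 then 0 else c (n - 1), ?_, ?_, by simp, by simp⟩
  · have := L.dual.A_apply (Nat.zero_le d) u
    rwa [hu] at this
  · intro n hn
    rw [if_neg (by omega), hc n hn, Nat.add_sub_cancel]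

/-! ### Basic properties of a split sequence -/

section

variable {u : V} {φ : ℕ → K}

/-- Apply E_n to the relation. Only the E_{n+1}-component of τ_{n+1}(A)u contributes to E_n B
τ_{n+1}(A)u, so φ_{n+1} = 0 would contradict E_n B E_{n+1} ≠ 0. -/
theorem splitSeq_ne_zero (L : LeonardSystem d A B E F θ θs) (hu : F 0 u = u) (hu0 : u ≠ 0)
    (hφ : IsSplitSeq d A B θ θs u φ) {n : ℕ} (hn : n < d) : φ (n + 1) ≠ 0 := by
  intro h0
  have h := hφ.apply_succ n hn
  rw [h0, zero_smul, add_zero] at h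
  have h1 := congrArg (E n) h
  rw [map_smul, L.E_splitVec_eq_zero u hn.le (Nat.lt_succ_self n), smul_zero] at h1
  have h2 : E n (B (E (n + 1) (splitVec A θ u (n + 1)))) = 0 := by
    rw [← h1]
    conv_rhs => rw [← L.idemE.sum_apply (splitVec A θ u (n + 1)), map_sum, map_sum]
    symm
    refine Finset.sum_eq_single (n + 1) (fun j hj hjn => ?_) (by simp; omega)
    have hj' : j < d + 1 := by simpa using hj
    rcases lt_or_gt_of_ne hjn with h | h
    · rw [L.E_splitVec_eq_zero u (by omega) h, map_zero, map_zero]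
    · exact LinearMap.congr_fun (L.E_far n j (by omega) (by omega) (by omega)) _
  refine (L.E_near n hn).2 (LinearMap.ext fun v => ?_)
  have hne : E (n + 1) (splitVec A θ u (n + 1)) ≠ 0 := by
    rw [L.E_splitVec u hn]
    exact smul_ne_zero (L.eval_ne_zero le_rfl hn) (L.E_apply_ne_zero hu hu0 hn)
  obtain ⟨c, hc⟩ := L.idemE.exists_eq_smul hn hne (L.idemE.apply_self hn _) v
  simp [hc, h2]

theorem prod_splitSeq_ne_zero (L : LeonardSystem d A B E F θ θs) (hu : F 0 u = u) (hu0 : u ≠ 0)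
    (hφ : IsSplitSeq d A B θ θs u φ) {n : ℕ} (hn : n ≤ d) :
    ∏ k ∈ Finset.range n, φ (k + 1) ≠ 0 := by
  rw [Finset.prod_ne_zero_iff]
  intro k hk
  have := Finset.mem_range.1 hk
  exact L.splitSeq_ne_zero hu hu0 hφ (by omega)

/-- Compare the F_0-components of the split relation at n = 0; there F_0 A u = a_0 u. The scalar a_0
does not depend on the order of the eigenvalues, which allows the first and second split sequences
to be compared. -/
theorem splitSeq_one (L : LeonardSystem d A B E F θ θs) (hd : 0 < d) (hu : F 0 u = u) (hu0 : u ≠ 0)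
    (hφ : IsSplitSeq d A B θ θs u φ) : φ 1 = (θs 0 - θs 1) * (aSeq A F 0 - θ 0) := by
  have h1 : F 0 (splitVec A θ u 1) = (aSeq A F 0 - θ 0) • u := by
    have := A_splitVec A θ u 0
    rw [← sub_eq_iff_eq_add'] at this
    rw [← this]
    have h := L.idemF.apply_eq_trace_smul (Nat.zero_le d) hu A
    simp only [splitVec, nodePoly_zero, map_one, Module.End.one_apply, map_sub, map_smul, h, hu,
      sub_smul]
    rfl
  have h := congrArg (F 0) (hφ.apply_succ 0 hd)
  rw [L.dual.apply_A (Nat.zero_le d), map_add, map_smul, map_smul, h1, splitVec, nodePoly_zero,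
    map_one, Module.End.one_apply, hu, smul_smul, smul_smul, ← add_smul] at h
  have := smul_left_injective K hu0 h
  linear_combination -this

/-- The eigenvalue property that defines the split sequence. -/
theorem splitSeq_eigenvalue (hφ : IsSplitSeq d A B θ θs u φ) {n : ℕ} (hn : n < d) :
    (A - θ n • 1) ((B - θs (n + 1) • 1) (splitVec A θ u (n + 1)))
      = φ (n + 1) • splitVec A θ u (n + 1) := by
  have h1 : (B - θs (n + 1) • 1) (splitVec A θ u (n + 1)) = φ (n + 1) • splitVec A θ u n := by
    simp [hφ.apply_succ n hn]
  have h2 := A_splitVec A θ u n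
  rw [h1, map_smul]
  simp [h2]

/-! #### Duality -/

/-- Biorthogonality: up to scalars, E_0 τ*_n(B) reads the n-th coordinate in the split basis. For m
< n the vector τ_m(A)u lies in F_0V + ⋯ + F_mV, which τ*_n(B) kills. For m > n, applying B at most n
times cannot lower the index to 0, and E_0 kills τ_k(A)u for k > 0. For m = n each lowering step
contributes one factor φ. -/
theorem aeval_B_splitVec (L : LeonardSystem d A B E F θ θs) (hu : F 0 u = u)
    (hφ : IsSplitSeq d A B θ θs u φ) (n m : ℕ) (hn : n ≤ d) (hm : m ≤ d) :
    E 0 (aeval B (nodePoly θs n) (splitVec A θ u m))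
      = (if m = n then ∏ k ∈ Finset.range n, φ (k + 1) else 0) • E 0 u := by
  have hE0 : ∀ m, m ≠ 0 → E 0 (splitVec A θ u m) = 0 := fun m hm =>
    L.E_splitVec_eq_zero u (Nat.zero_le d) (by omega)
  have hsu : splitVec A θ u 0 = u := by simp [splitVec, nodePoly_zero]
  have hkill : ∀ m n, m < n → m ≤ d → aeval B (nodePoly θs n) (splitVec A θ u m) = 0 := by
    intro m n hmn hm
    refine L.idemF.eq_zero fun j hj => ?_
    rw [L.dual.apply_aeval hj]
    by_cases hjm : j ≤ m
    · rw [nodePoly_eval_eq_zero θs (by omega), zero_smul]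
    · rw [L.F_splitVec_eq_zero hu hj (by omega), smul_zero]
  have hlow : ∀ g : K[X], ∀ m, m ≤ d → g.natDegree < m → E 0 (aeval B g (splitVec A θ u m)) = 0 := by
    have hpow : ∀ k m, m ≤ d → k < m → E 0 ((B ^ k) (splitVec A θ u m)) = 0 := by
      intro k
      induction k with
      | zero => intro m _ h; simpa using hE0 m (by omega)
      | succ k ih =>
        intro m hm hkm
        obtain ⟨m, rfl⟩ : ∃ m', m = m' + 1 := ⟨m - 1, by omega⟩
        rw [pow_succ, Module.End.mul_apply, hφ.apply_succ m (by omega), map_add, map_add, map_smul,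
          map_smul, map_smul, map_smul, ih _ hm (by omega), ih m (by omega) (by omega)]
        simp
    intro g m hm hgm
    rw [aeval_eq_sum_range, LinearMap.sum_apply, map_sum]
    refine Finset.sum_eq_zero fun k hk => ?_
    have hk' := Finset.mem_range.1 hk
    rw [LinearMap.smul_apply, map_smul, hpow k m hm (by omega), smul_zero]
  rcases lt_trichotomy m n with h | h | h
  · rw [hkill m n h hm, map_zero, if_neg (by omega), zero_smul]
  · subst h
    rw [if_pos rfl]
    clear hm
    induction m with
    | zero => simp [nodePoly_zero, hsu]
    | succ m ih =>
      have h1 : aeval B (nodePoly θs (m + 1)) (splitVec A θ u (m + 1))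
          = φ (m + 1) • aeval B (nodePoly θs m) (splitVec A θ u m)
            + (θs (m + 1) - θs m) • aeval B (nodePoly θs m) (splitVec A θ u (m + 1)) := by
        rw [nodePoly_succ, mul_comm, map_mul, Module.End.mul_apply]
        have : aeval B (X - C (θs m)) (splitVec A θ u (m + 1))
            = (θs (m + 1) - θs m) • splitVec A θ u (m + 1) + φ (m + 1) • splitVec A θ u m := by
          simp [Algebra.algebraMap_eq_smul_one, hφ.apply_succ m (by omega), sub_smul]
          abel
        rw [this, map_add, map_smul, map_smul]
        abel
      rw [h1, map_add, map_smul, map_smul, ih (by omega),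
        hlow _ (m + 1) hn (by rw [nodePoly_natDegree]; omega), smul_zero, add_zero, smul_smul,
        Finset.prod_range_succ, mul_comm]
  · rw [hlow _ m hm (by rwa [nodePoly_natDegree]), if_neg (by omega), zero_smul]

/-- On the split vectors this is biorthogonality, because A - θ_{n+1} sends τ_m(A)u to a combination
of itself and its successor. These vectors span. -/
theorem E_aeval_B_sub (L : LeonardSystem d A B E F θ θs) (hu : F 0 u = u) (hu0 : u ≠ 0)
    (hφ : IsSplitSeq d A B θ θs u φ) {n : ℕ} (hn : n < d) (v : V) :
    E 0 (aeval B (nodePoly θs (n + 1)) (A v - θ (n + 1) • v))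
      = φ (n + 1) • E 0 (aeval B (nodePoly θs n) v) := by
  have hsplit : ∀ m, m ≤ d →
      E 0 (aeval B (nodePoly θs (n + 1)) (A (splitVec A θ u m) - θ (n + 1) • splitVec A θ u m))
        = φ (n + 1) • E 0 (aeval B (nodePoly θs n) (splitVec A θ u m)) := by
    intro m hm
    have h1 : A (splitVec A θ u m) - θ (n + 1) • splitVec A θ u m
        = (θ m - θ (n + 1)) • splitVec A θ u m + splitVec A θ u (m + 1) := by
      rw [A_splitVec, sub_smul]
      abel
    rw [h1, map_add, map_add, map_smul, map_smul, L.aeval_B_splitVec hu hφ n m hn.le hm,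
      L.aeval_B_splitVec hu hφ (n + 1) m hn hm, smul_smul, smul_smul]
    have h2 : E 0 (aeval B (nodePoly θs (n + 1)) (splitVec A θ u (m + 1)))
        = (if m = n then ∏ k ∈ Finset.range (n + 1), φ (k + 1) else 0) • E 0 u := by
      by_cases hmd : m < d
      · rw [L.aeval_B_splitVec hu hφ (n + 1) (m + 1) hn hmd]
        simp
      · rw [L.splitVec_eq_zero u (by omega), map_zero, map_zero, if_neg (by omega), zero_smul]
    rw [h2, ← add_smul]
    congr 1
    by_cases hmn : m = n
    · subst hmn
      simp [Finset.prod_range_succ, mul_comm]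
    · by_cases hmn' : m = n + 1
      · simp [hmn']
      · simp [hmn, hmn']
  suffices h : ∀ k, k ≤ d + 1 → ∀ g : K[X], g.degree < k →
      E 0 (aeval B (nodePoly θs (n + 1)) (A (aeval A g u) - θ (n + 1) • aeval A g u))
        = φ (n + 1) • E 0 (aeval B (nodePoly θs n) (aeval A g u)) by
    obtain ⟨g, hg, rfl⟩ := L.exists_aeval hu hu0 v
    refine h (d + 1) le_rfl g (lt_of_le_of_lt degree_le_natDegree ?_)
    exact_mod_cast Nat.lt_succ_of_le hg
  intro k
  induction k with
  | zero =>
    intro _ g hg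
    have : g = 0 := by simpa using hg
    simp [this]
  | succ k ih =>
    intro hk g hg
    have hg' : (g - C (g.coeff k) * nodePoly θ k).degree < k := by
      rw [degree_lt_iff_coeff_zero] at hg ⊢
      intro m hm
      rw [coeff_sub, coeff_C_mul]
      rcases hm.eq_or_lt with rfl | h
      · have h1 : (nodePoly θ k).coeff k = 1 := by
          have := nodePoly_monic θ k
          rw [Monic, leadingCoeff, nodePoly_natDegree] at this
          exact this
        rw [h1, mul_one, sub_self]
      · rw [hg m h, coeff_eq_zero_of_natDegree_lt (p := nodePoly θ k) (by rwa [nodePoly_natDegree])]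
        simp
    have h1 := ih (by omega) _ hg'
    have h2 := hsplit k (by omega)
    have h3 : aeval A g u = aeval A (g - C (g.coeff k) * nodePoly θ k) u
        + g.coeff k • splitVec A θ u k := by
      simp [splitVec, Algebra.algebraMap_eq_smul_one]
    rw [h3]
    simp only [map_add, map_smul, smul_add, add_sub_add_comm] at h1 h2 ⊢
    rw [h1, smul_comm (θ (n + 1)) (g.coeff k), ← smul_sub, map_smul, map_smul, h2, smul_comm]

/-- The first split sequence is self-dual. -/
theorem dual_splitSeq (L : LeonardSystem d A B E F θ θs) (hu : F 0 u = u) (hu0 : u ≠ 0)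
    (hφ : IsSplitSeq d A B θ θs u φ) {v : V} (hv : E 0 v = v) (hv0 : v ≠ 0) {φ' : ℕ → K}
    (hφ' : IsSplitSeq d B A θs θ v φ') {n : ℕ} (hn : n < d) : φ' (n + 1) = φ (n + 1) := by
  have hAv : A v = θ 0 • v := hφ'.apply_zero
  -- The nonzero vectors E_0 τ*_n(B)v satisfy two first-order recursions: one with φ, from the
  -- preceding identity and A v = θ_0 v, and one with φ', from applying E_0 to the split relation of
  -- the dual system.
  have h1 : ∀ n, n < d → (θ 0 - θ (n + 1)) • E 0 (splitVec B θs v (n + 1))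
      = φ (n + 1) • E 0 (splitVec B θs v n) := by
    intro n hn
    have := L.E_aeval_B_sub hu hu0 hφ hn v
    rwa [hAv, ← sub_smul, map_smul, map_smul] at this
  have h2 : ∀ n, n < d → (θ 0 - θ (n + 1)) • E 0 (splitVec B θs v (n + 1))
      = φ' (n + 1) • E 0 (splitVec B θs v n) := by
    intro n hn
    have := congrArg (E 0) (hφ'.apply_succ n hn)
    rw [L.apply_A (Nat.zero_le d), map_add, map_smul, map_smul] at this
    rw [sub_smul, this, add_sub_cancel_left]
  have h3 : ∀ n, n ≤ d → E 0 (splitVec B θs v n) ≠ 0 := by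
    intro n
    induction n with
    | zero => intro _; simpa [splitVec, nodePoly_zero, hv] using hv0
    | succ n ih =>
      intro hn h0
      have := h2 n hn
      rw [h0, smul_zero] at this
      rcases smul_eq_zero.1 this.symm with h | h
      · exact L.dual.splitSeq_ne_zero hv hv0 hφ' hn h
      · exact ih (by omega) h
  have := (h2 n hn).symm.trans (h1 n hn)
  exact smul_left_injective K (h3 n hn.le) this

/-- The last split vector generates the doubly reversed split decomposition. -/
theorem splitVec_last (L : LeonardSystem d A B E F θ θs) :
    E d (splitVec A θ u d) = splitVec A θ u d := by
  conv_rhs => rw [← L.idemE.sum_apply (splitVec A θ u d)]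
  symm
  refine Finset.sum_eq_single d (fun j hj hjd => ?_) (by simp)
  have hj' := Finset.mem_range.1 hj
  exact L.E_splitVec_eq_zero u (by omega) (by omega)

/-- The split sequence of the system in which both orderings are reversed and the roles of `A` and
`A*` are exchanged. -/
theorem splitSeq_reverse (L : LeonardSystem d A B E F θ θs)
    (hφ : IsSplitSeq d A B θ θs u φ) :
    IsSplitSeq d B A (fun i => θs (d - i)) (fun i => θ (d - i)) (splitVec A θ u d)
      (fun i => φ (d + 1 - i)) := by
  have hB : ∀ n, n ≤ d → B (splitVec A θ u n) = θs n • splitVec A θ u n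
      + φ n • splitVec A θ u (n - 1) := by
    intro n hn
    cases n with
    | zero => simpa [hφ.zero, splitVec, nodePoly_zero] using hφ.apply_zero
    | succ n => exact hφ.apply_succ n hn
  -- Starting from τ_d(A)u, each factor B - θ*_{d-n} lowers the split basis by one step and
  -- contributes φ_{d-n}. The new split vectors are thus the old ones in reverse order, up to
  -- scalars.
  have key : ∀ n, n ≤ d → splitVec B (fun i => θs (d - i)) (splitVec A θ u d) n
      = (∏ k ∈ Finset.range n, φ (d - k)) • splitVec A θ u (d - n) := by
    intro n
    induction n with
    | zero => simp [splitVec, nodePoly_zero]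
    | succ n ih =>
      intro hn
      have h1 := A_splitVec B (fun i => θs (d - i)) (splitVec A θ u d) n
      rw [← sub_eq_iff_eq_add'] at h1
      rw [← h1, ih (by omega), map_smul, hB (d - n) (by omega), Finset.prod_range_succ,
        smul_add, smul_comm (θs (d - n)), add_sub_cancel_left, smul_smul,
        show d - n - 1 = d - (n + 1) by omega]
  have hAd : A (splitVec A θ u d) = θ d • splitVec A θ u d := by
    rw [A_splitVec, L.splitVec_eq_zero u (Nat.lt_succ_self d), add_zero]
  refine ⟨by simpa using hAd, ?_, by simpa using hφ.last, by simpa using hφ.zero⟩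
  intro n hn
  rw [key n hn.le, key (n + 1) hn, map_smul, A_splitVec, Finset.prod_range_succ, smul_add,
    smul_comm _ (θ _), smul_smul, show d - (n + 1) + 1 = d - n by omega,
    show d + 1 - (n + 1) = d - n by omega]
  congr 1
  rw [smul_smul, mul_comm]

end

end LeonardSystem

end Abstract

end

section

section Abstract

variable {K V : Type*} [Field K] [AddCommGroup V] [Module K V]

/-! ### The tridiagonal relation and the shape of the split sequences -/

/-- `(α, β, γ)`-form of a sequence:  `θ_i = α + β q^i + γ q^{-i}`. -/
def qForm (q α β γ : K) (i : ℕ) : K := α + β * q ^ i + γ * (q ^ i)⁻¹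

/-- Here `U₀, …, U₃` are consecutive split vectors and `f` is a projection that kills everything
before `U₂`. The vector `z` is the term below `U₀`; leaving it abstract allows z = 0 at the start of
the basis. -/
theorem tridiagonal_relation_coeff (A B f : Module.End K V) {z U₀ U₁ U₂ U₃ : V}
    {t t₀ t₁ t₂ s₀ s₁ s₂ s₃ φ₀ φ₁ φ₂ φ₃ b ρ : K}
    (hAz : A z = t • z + φ₀ • U₀) (hA₀ : A U₀ = t₀ • U₀ + U₁) (hA₁ : A U₁ = t₁ • U₁ + U₂)
    (hA₂ : A U₂ = t₂ • U₂ + U₃) (hB₀ : B U₀ = s₀ • U₀ + z) (hB₁ : B U₁ = s₁ • U₁ + φ₁ • U₀)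
    (hB₂ : B U₂ = s₂ • U₂ + φ₂ • U₁) (hB₃ : B U₃ = s₃ • U₃ + φ₃ • U₂)
    (hfz : f z = 0) (hf₀ : f U₀ = 0) (hf₁ : f U₁ = 0)
    (h : A (A (A (B U₀))) - b • A (A (B (A U₀))) + b • A (B (A (A U₀))) - B (A (A (A U₀)))
      = ρ • (A (B U₀) - B (A U₀))) :
    (φ₀ - b * φ₁ + b * φ₂ - φ₃ + s₀ * (t₀ + t₁ + t₂) - b * (t₀ * s₀ + s₁ * (t₁ + t₂))
      + b * ((t₀ + t₁) * s₁ + t₂ * s₂) - (t₀ + t₁ + t₂) * s₂) • f U₂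
      + (s₀ - b * s₁ + b * s₂ - s₃) • f U₃ = 0 := by
  have h' := congrArg f h
  simp only [hAz, hA₀, hA₁, hA₂, hB₀, hB₁, hB₂, hB₃, map_add, map_sub, map_smul, hfz, hf₀, hf₁,
    smul_zero, zero_add, add_zero, sub_self] at h'
  refine Eq.trans ?_ (sub_eq_zero.2 h')
  module

/-- A solution of the homogeneous recurrence that vanishes at `0` and `N`. -/
theorem eq_of_recurrence {q : K} (hq0 : q ≠ 0) {N : ℕ} (hN : 2 ≤ N)
    (hq : ∀ k, 1 ≤ k → k ≤ N → q ^ k ≠ 1) {ψ : ℕ → K} (h0 : ψ 0 = 0) (hlast : ψ N = 0)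
    (hrec : ∀ n, n + 3 ≤ N →
      ψ n - (q + q⁻¹ + 1) * ψ (n + 1) + (q + q⁻¹ + 1) * ψ (n + 2) - ψ (n + 3) = 0) :
    ∃ c, ∀ n, n ≤ N → ψ n = c * ((1 - q ^ n) * (1 - q ^ N / q ^ n)) := by
  have hne : ∀ k, 1 ≤ k → k ≤ N → 1 - q ^ k ≠ 0 := fun k h1 h2 => sub_ne_zero.2 (hq k h1 h2).symm
  set g : ℕ → K := fun n => (1 - q ^ n) * (1 - q ^ N / q ^ n) with hg
  have hq1 : 1 - q ≠ 0 := by simpa using hne 1 le_rfl (by omega)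
  have hq2 : 1 - q ^ 2 ≠ 0 := hne 2 (by omega) hN
  have hg1 : g 1 ≠ 0 := by
    have e : q ^ N / q ^ 1 = q ^ (N - 1) := by
      rw [div_eq_iff (pow_ne_zero _ hq0), ← pow_add]
      congr 1
      omega
    simp only [hg, e]
    exact mul_ne_zero (hne 1 le_rfl (by omega)) (hne (N - 1) (by omega) (by omega))
  set χ : ℕ → K := fun n => ψ n - ψ 1 / g 1 * g n with hχ
  have hχ1 : χ 1 = 0 := by simp [hχ, div_mul_cancel₀ _ hg1]
  have hχ0 : χ 0 = 0 := by simp [hχ, h0, hg]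
  have hgrec : ∀ n, g n - (q + q⁻¹ + 1) * g (n + 1) + (q + q⁻¹ + 1) * g (n + 2) - g (n + 3) = 0 := by
    intro n
    simp only [hg, pow_add]
    have := pow_ne_zero n hq0
    field_simp
    ring
  have hχrec : ∀ n, n + 3 ≤ N →
      χ (n + 3) = χ n - (q + q⁻¹ + 1) * χ (n + 1) + (q + q⁻¹ + 1) * χ (n + 2) := by
    intro n hn
    simp only [hχ]
    linear_combination -(hrec n hn) + ψ 1 / g 1 * hgrec n
  -- The solution with initial values 0, 0, 1. It is nonzero at N because q^{N-1} and q^N differ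
  -- from 1.
  set m : ℕ → K := fun n => (1 - q ^ n) * (1 - q ^ n / q) * (q ^ 2 / q ^ n)
    / ((1 - q) * (1 - q ^ 2)) with hm
  have hmrec : ∀ n, m (n + 3) = m n - (q + q⁻¹ + 1) * m (n + 1) + (q + q⁻¹ + 1) * m (n + 2) := by
    intro n
    simp only [hm, pow_add]
    have := pow_ne_zero n hq0
    field_simp
    ring
  have hm0 : m 0 = 0 := by simp [hm]
  have hm1 : m 1 = 0 := by simp [hm, div_self hq0]
  have hm2 : m 2 = 1 := by
    simp only [hm]
    field_simp
  have hall : ∀ n, n ≤ N → χ n = χ 2 * m n := by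
    intro n
    induction n using Nat.strong_induction_on with
    | _ n ih =>
      intro hn
      match n, ih, hn with
      | 0, _, _ => rw [hχ0, hm0, mul_zero]
      | 1, _, _ => rw [hχ1, hm1, mul_zero]
      | 2, _, _ => rw [hm2, mul_one]
      | n + 3, ih, hn =>
        rw [hχrec n hn, hmrec, ih n (by omega) (by omega), ih (n + 1) (by omega) (by omega),
          ih (n + 2) (by omega) (by omega)]
        ring
  have hmN : m N ≠ 0 := by
    have e : q ^ N / q = q ^ (N - 1) := by
      rw [div_eq_iff hq0, ← pow_succ]
      congr 1
      omega
    simp only [hm, e]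
    have h1 := hne N (by omega) le_rfl
    have h2 := hne (N - 1) (by omega) (by omega)
    exact div_ne_zero (mul_ne_zero (mul_ne_zero h1 h2) (div_ne_zero (pow_ne_zero _ hq0)
      (pow_ne_zero _ hq0))) (mul_ne_zero hq1 hq2)
  have hχ2 : χ 2 = 0 := by
    have := hall N le_rfl
    have hgN : g N = 0 := by simp [hg, div_self (pow_ne_zero N hq0)]
    have hχN : χ N = 0 := by simp [hχ, hlast, hgN]
    rw [hχN] at this
    exact (mul_eq_zero.1 this.symm).resolve_right hmN
  refine ⟨ψ 1 / g 1, fun n hn => ?_⟩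
  have := hall n hn
  rw [hχ2, zero_mul] at this
  exact sub_eq_zero.1 this

namespace LeonardSystem

variable {d : ℕ} {A B : Module.End K V} {E F : ℕ → Module.End K V} {θ θs : ℕ → K}
  {q α₀ α₁ α₂ γ₀ γ₁ γ₂ : K} {u : V} {φ : ℕ → K}

/-- Between E_i and E_j the difference of the two sides is (t_i - t_j)(t_i² - (q + q⁻¹)t_i t_j +
t_j² - ρ) E_i B E_j, with t_i = θ_i - α₀. The first factor vanishes for i = j, the second for |i-j|
= 1 by the choice of ρ, and E_i B E_j vanishes in all other cases. -/
theorem tridiagonal_relation (L : LeonardSystem d A B E F θ θs) (hq0 : q ≠ 0)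
    (hθ : ∀ i, i ≤ d → θ i = qForm q α₀ α₁ α₂ i) (v : V) :
    letI A' := A - α₀ • (1 : Module.End K V)
    A' (A' (A' (B v))) - (q + q⁻¹ + 1) • A' (A' (B (A' v))) + (q + q⁻¹ + 1) • A' (B (A' (A' v)))
      - B (A' (A' (A' v))) = (-(α₁ * α₂ * (q - q⁻¹) ^ 2)) • (A' (B v) - B (A' v)) := by
  set A' := A - α₀ • (1 : Module.End K V) with hA'
  set ρ := -(α₁ * α₂ * (q - q⁻¹) ^ 2) with hρ
  set b := q + q⁻¹ + 1 with hb
  set D : Module.End K V := A' * A' * A' * B - b • (A' * A' * B * A') + b • (A' * B * A' * A')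
    - B * A' * A' * A' - ρ • (A' * B - B * A') with hD
  suffices h : D v = 0 by
    simp only [hD, LinearMap.sub_apply, LinearMap.add_apply, LinearMap.smul_apply,
      Module.End.mul_apply] at h
    exact sub_eq_zero.1 h
  set t : ℕ → K := fun i => α₁ * q ^ i + α₂ * (q ^ i)⁻¹ with ht
  have hA1 : ∀ i, i ≤ d → ∀ w, A' (E i w) = t i • E i w := by
    intro i hi w
    simp only [A', LinearMap.sub_apply, L.A_apply hi, LinearMap.smul_apply, Module.End.one_apply,
      hθ i hi, qForm, ht]
    module
  have hA2 : ∀ i, i ≤ d → ∀ w, E i (A' w) = t i • E i w := by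
    intro i hi w
    simp only [A', LinearMap.sub_apply, map_sub, map_smul, L.apply_A hi, LinearMap.smul_apply,
      Module.End.one_apply, hθ i hi, qForm, ht]
    module
  rw [← L.idemE.sum_apply v, map_sum]
  refine Finset.sum_eq_zero fun j hj => L.idemE.eq_zero fun i hi => ?_
  have hj' : j ≤ d := by simpa [Nat.lt_succ_iff] using hj
  have e : E i (D (E j v))
      = ((t i - t j) * (t i ^ 2 - (q + q⁻¹) * t i * t j + t j ^ 2 - ρ)) • E i (B (E j v)) := by
    simp only [hD, LinearMap.sub_apply, LinearMap.add_apply, LinearMap.smul_apply,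
      Module.End.mul_apply, hA1 j hj', hA2 i hi, map_sub, map_add, map_smul]
    module
  rw [e]
  by_cases hfar : i + 1 < j ∨ j + 1 < i
  · have : E i (B (E j v)) = 0 := LinearMap.congr_fun (L.E_far i j hi hj' hfar) v
    rw [this, smul_zero]
  · have hs : (t i - t j) * (t i ^ 2 - (q + q⁻¹) * t i * t j + t j ^ 2 - ρ) = 0 := by
      obtain rfl | rfl | rfl : i = j ∨ i = j + 1 ∨ j = i + 1 := by omega
      · rw [sub_self, zero_mul]
      · have := pow_ne_zero j hq0
        refine mul_eq_zero_of_right _ ?_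
        simp only [ht, hρ, pow_succ]
        field_simp
        ring
      · have := pow_ne_zero i hq0
        refine mul_eq_zero_of_right _ ?_
        simp only [ht, hρ, pow_succ]
        field_simp
        ring
    rw [hs, zero_smul]

/-- Apply the tridiagonal relation to τ_n(A)u and project with F_{n+2}. The coefficient of
τ_{n+3}(A)u vanishes because the dual eigenvalues solve the homogeneous recurrence, so the
coefficient of τ_{n+2}(A)u must vanish as well. -/
theorem splitSeq_recurrence (L : LeonardSystem d A B E F θ θs) (hu : F 0 u = u) (hu0 : u ≠ 0)
    (hφ : IsSplitSeq d A B θ θs u φ) (hq0 : q ≠ 0)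
    (hθ : ∀ i, i ≤ d → θ i = qForm q α₀ α₁ α₂ i) (hθs : ∀ i, i ≤ d → θs i = qForm q γ₀ γ₁ γ₂ i)
    {n : ℕ} (hn : n + 2 ≤ d) :
    letI t := qForm q 0 α₁ α₂
    letI s := qForm q γ₀ γ₁ γ₂
    letI b := q + q⁻¹ + 1
    φ n - b * φ (n + 1) + b * φ (n + 2) - φ (n + 3) + s n * (t n + t (n + 1) + t (n + 2))
      - b * (t n * s n + s (n + 1) * (t (n + 1) + t (n + 2)))
      + b * ((t n + t (n + 1)) * s (n + 1) + t (n + 2) * s (n + 2))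
      - (t n + t (n + 1) + t (n + 2)) * s (n + 2) = 0 := by
  set t := qForm q 0 α₁ α₂ with ht
  set s := qForm q γ₀ γ₁ γ₂ with hs
  have htd := L.tridiagonal_relation (B := B) hq0 hθ (splitVec A θ u n)
  set A' := A - α₀ • (1 : Module.End K V) with hA'
  have hA : ∀ m, m ≤ d → A' (splitVec A θ u m) = t m • splitVec A θ u m + splitVec A θ u (m + 1) := by
    intro m hm
    simp only [hA', LinearMap.sub_apply, A_splitVec, LinearMap.smul_apply, Module.End.one_apply,
      hθ m hm, qForm, t]
    module
  have hB : ∀ m, m ≤ d →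
      B (splitVec A θ u (m + 1)) = s (m + 1) • splitVec A θ u (m + 1) + φ (m + 1) • splitVec A θ u m := by
    intro m hm
    -- At m = d both τ_{d+1}(A)u and φ_{d+1} are zero, so the relation also holds with the formal
    -- value of s at d+1.
    rcases hm.eq_or_lt with rfl | hm
    · rw [L.splitVec_eq_zero u (Nat.lt_succ_self m), hφ.last]
      simp
    · rw [hφ.apply_succ m hm, hθs _ hm]
  -- The vector z is φ_n τ_{n-1}(A)u, or 0 when n = 0.
  have hz : ∃ z, ∃ t' : K, A' z = t' • z + φ n • splitVec A θ u n ∧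
      B (splitVec A θ u n) = s n • splitVec A θ u n + z ∧ F (n + 2) z = 0 := by
    cases n with
    | zero =>
      refine ⟨0, 0, by simp [hφ.zero], ?_, map_zero _⟩
      have := hφ.apply_zero
      rw [hθs 0 (by omega)] at this
      simpa [splitVec, nodePoly_zero] using this
    | succ n =>
      refine ⟨φ (n + 1) • splitVec A θ u n, t n, ?_, hB n (by omega), ?_⟩
      · rw [map_smul, hA n (by omega), smul_add, smul_comm]
      · rw [map_smul, L.F_splitVec_eq_zero hu hn (by omega), smul_zero]
  obtain ⟨z, t', hAz, hBz, hFz⟩ := hz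
  have key := tridiagonal_relation_coeff A' B (F (n + 2)) hAz (hA n (by omega))
    (hA (n + 1) (by omega)) (hA (n + 2) hn) hBz (hB n (by omega)) (hB (n + 1) (by omega))
    (hB (n + 2) hn) hFz (L.F_splitVec_eq_zero hu hn (by omega))
    (L.F_splitVec_eq_zero hu hn (by omega)) htd
  have h3 : s n - (q + q⁻¹ + 1) * s (n + 1) + (q + q⁻¹ + 1) * s (n + 2) - s (n + 3) = 0 := by
    have := pow_ne_zero n hq0
    simp only [s, qForm, pow_add]
    field_simp
    ring
  rw [show n + 2 + 1 = n + 3 from rfl, h3, zero_smul, add_zero] at key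
  exact (smul_eq_zero.1 key).resolve_right (L.F_splitVec_self_ne_zero hu hu0 hn)

/-- The shape of the split sequence of a Leonard system with eigenvalues of `q`-Racah form. -/
theorem splitSeq_form (L : LeonardSystem d A B E F θ θs) (hd : 0 < d) (hu : F 0 u = u)
    (hu0 : u ≠ 0) (hφ : IsSplitSeq d A B θ θs u φ) (hq0 : q ≠ 0)
    (hq : ∀ k, 1 ≤ k → k ≤ d + 1 → q ^ k ≠ 1)
    (hθ : ∀ i, i ≤ d → θ i = qForm q α₀ α₁ α₂ i)
    (hθs : ∀ i, i ≤ d → θs i = qForm q γ₀ γ₁ γ₂ i) :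
    ∃ c, ∀ n, n ≤ d + 1 → φ n = (1 - q ^ n) * (1 - q ^ (d + 1) / q ^ n) *
      (c - α₁ * γ₁ * (q ^ n / q) - α₂ * γ₂ / (q ^ n * q ^ d)) := by
  -- A particular solution of the inhomogeneous recurrence that vanishes at 0 and d+1; the
  -- difference φ - g is then homogeneous.
  set g : ℕ → K := fun n => (1 - q ^ n) * (1 - q ^ (d + 1) / q ^ n) *
    (- α₁ * γ₁ * (q ^ n / q) - α₂ * γ₂ / (q ^ n * q ^ d)) with hg
  have hqd := pow_ne_zero d hq0
  obtain ⟨c, hc⟩ := eq_of_recurrence (N := d + 1) (ψ := fun n => φ n - g n) hq0 (by omega) hq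
    (by simp [hφ.zero, hg]) (by
      have h1 : 1 - q ^ (d + 1) / q ^ (d + 1) = 0 := by
        rw [div_self (pow_ne_zero _ hq0), sub_self]
      simp [hφ.last, hg, h1]) (fun n hn => by
      have h := L.splitSeq_recurrence hu hu0 hφ hq0 hθ hθs (n := n) (by omega)
      have hqn := pow_ne_zero n hq0
      have e : g n - (q + q⁻¹ + 1) * g (n + 1) + (q + q⁻¹ + 1) * g (n + 2) - g (n + 3)
          = -(qForm q γ₀ γ₁ γ₂ n * (qForm q 0 α₁ α₂ n + qForm q 0 α₁ α₂ (n + 1)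
              + qForm q 0 α₁ α₂ (n + 2))
            - (q + q⁻¹ + 1) * (qForm q 0 α₁ α₂ n * qForm q γ₀ γ₁ γ₂ n
              + qForm q γ₀ γ₁ γ₂ (n + 1) * (qForm q 0 α₁ α₂ (n + 1) + qForm q 0 α₁ α₂ (n + 2)))
            + (q + q⁻¹ + 1) * ((qForm q 0 α₁ α₂ n + qForm q 0 α₁ α₂ (n + 1))
              * qForm q γ₀ γ₁ γ₂ (n + 1) + qForm q 0 α₁ α₂ (n + 2) * qForm q γ₀ γ₁ γ₂ (n + 2))
            - (qForm q 0 α₁ α₂ n + qForm q 0 α₁ α₂ (n + 1) + qForm q 0 α₁ α₂ (n + 2))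
              * qForm q γ₀ γ₁ γ₂ (n + 2)) := by
        simp only [hg, qForm, pow_add, pow_one]
        field_simp
        ring
      linear_combination h - e)
  refine ⟨c, fun n hn => ?_⟩
  have := hc n hn
  simp only [hg] at this
  linear_combination this

end LeonardSystem

end Abstract

end

section

section Abstract

variable {K V : Type*} [Field K] [AddCommGroup V] [Module K V]

/-! ### Askey-Wilson duality and intersection numbers -/

/-- The `(i,i+1)` entry of the matrix of `A` with respect to `β`, with value `0` at `i = d`. -/
def bSeq (A : Module.End K V) {d : ℕ} (β : Module.Basis (Fin (d + 1)) K V) (i : ℕ) : K :=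
  if hi : i < d then LinearMap.toMatrix β β A ⟨i, by omega⟩ ⟨i + 1, by omega⟩ else 0

/-- The `(i,i-1)` entry of the matrix of `A` with respect to `β`, with value `0` at `i = 0`. -/
def cSeq (A : Module.End K V) {d : ℕ} (β : Module.Basis (Fin (d + 1)) K V) (i : ℕ) : K :=
  if hi : 1 ≤ i ∧ i ≤ d then LinearMap.toMatrix β β A ⟨i, by omega⟩ ⟨i - 1, by omega⟩ else 0

/-- `∑_n τ*_n(θ*_i) τ_n / (φ_1 ⋯ φ_n)`. -/
def awPoly (θ θs φ : ℕ → K) (d i : ℕ) : K[X] :=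
  ∑ n ∈ Finset.range (d + 1),
    C ((nodePoly θs n).eval (θs i) / ∏ k ∈ Finset.range n, φ (k + 1)) * nodePoly θ n

theorem nodePoly_coeff_self (θ : ℕ → K) (n : ℕ) : (nodePoly θ n).coeff n = 1 := by
  have := nodePoly_monic θ n
  rw [Monic, leadingCoeff, nodePoly_natDegree] at this
  exact this

theorem awPoly_natDegree_le (θ θs φ : ℕ → K) (d i : ℕ) : (awPoly θ θs φ d i).natDegree ≤ i := by
  refine natDegree_sum_le_of_forall_le _ _ fun n _ => ?_
  by_cases h : i < n
  · simp [nodePoly_eval_eq_zero θs h]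
  · refine (natDegree_C_mul_le _ _).trans ?_
    rw [nodePoly_natDegree]
    omega

theorem awPoly_coeff (θ θs φ : ℕ → K) {d i : ℕ} (hi : i ≤ d) : (awPoly θ θs φ d i).coeff i
    = (nodePoly θs i).eval (θs i) / ∏ k ∈ Finset.range i, φ (k + 1) := by
  rw [awPoly, finsetSum_coeff, Finset.sum_eq_single i]
  · rw [coeff_C_mul, nodePoly_coeff_self, mul_one]
  · intro n _ hn
    rcases lt_or_gt_of_ne hn with h | h
    · rw [coeff_C_mul, coeff_eq_zero_of_natDegree_lt (by rwa [nodePoly_natDegree]), mul_zero]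
    · simp [nodePoly_eval_eq_zero θs h]
  · simp; omega

theorem awPoly_eval_zero (θ θs φ : ℕ → K) (d i : ℕ) : (awPoly θ θs φ d i).eval (θ 0) = 1 := by
  rw [awPoly, eval_finsetSum, Finset.sum_eq_single 0]
  · simp [nodePoly_zero]
  · intro n _ hn
    rw [eval_mul, nodePoly_eval_eq_zero θ (Nat.pos_of_ne_zero hn), mul_zero]
  · simp

namespace LeonardSystem

variable {d : ℕ} {A B : Module.End K V} {E F : ℕ → Module.End K V} {θ θs : ℕ → K}
  {u : V} {φ : ℕ → K}

/-- The coefficients T_n in the split basis satisfy T_{n+1}φ_{n+1} = (θ*_i - θ*_n)T_n, so B - θ*_i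
makes the sum telescope. The boundary term (θ*_i - θ*_d)T_d is zero: either i = d or τ*_d(θ*_i) = 0.
-/
theorem B_awPoly (L : LeonardSystem d A B E F θ θs) (hu : F 0 u = u) (hu0 : u ≠ 0)
    (hφ : IsSplitSeq d A B θ θs u φ) {i : ℕ} (hi : i ≤ d) :
    B (aeval A (awPoly θ θs φ d i) u) = θs i • aeval A (awPoly θ θs φ d i) u := by
  set T : ℕ → K := fun n => (nodePoly θs n).eval (θs i) / ∏ k ∈ Finset.range n, φ (k + 1) with hT
  have e : aeval A (awPoly θ θs φ d i) u
      = ∑ n ∈ Finset.range (d + 1), T n • splitVec A θ u n := by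
    simp [awPoly, splitVec, hT, Algebra.algebraMap_eq_smul_one]
  have hTd : ∀ n, n < d → T (n + 1) * φ (n + 1) = (θs i - θs n) * T n := by
    intro n hn
    have h1 := L.splitSeq_ne_zero hu hu0 hφ hn
    have h2 := L.prod_splitSeq_ne_zero hu hu0 hφ hn.le
    simp only [hT, nodePoly_succ, Finset.prod_range_succ, eval_mul, eval_sub, eval_X, eval_C]
    field_simp
  have hlast : (θs i - θs d) * T d = 0 := by
    rcases hi.eq_or_lt with rfl | h
    · rw [sub_self, zero_mul]
    · simp [hT, nodePoly_eval_eq_zero θs h]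
  have hB : ∀ m, m ≤ d → ∑ n ∈ Finset.range (m + 1), T n • B (splitVec A θ u n)
      = θs i • ∑ n ∈ Finset.range (m + 1), T n • splitVec A θ u n
        - ((θs i - θs m) * T m) • splitVec A θ u m := by
    intro m
    induction m with
    | zero =>
      intro _
      have : B (splitVec A θ u 0) = θs 0 • splitVec A θ u 0 := by
        simpa [splitVec, nodePoly_zero] using hφ.apply_zero
      simp only [Finset.sum_range_succ, Finset.sum_range_zero, this]
      module
    | succ m ih =>
      intro hm
      rw [Finset.sum_range_succ, ih (by omega), Finset.sum_range_succ _ (m + 1), hφ.apply_succ m hm,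
        ← hTd m hm]
      module
  rw [e, map_sum]
  simp only [map_smul]
  rw [hB d le_rfl, hlast, zero_smul, sub_zero]

/-- Both polynomials at A send u into F_iV, `recPoly` by construction and `awPoly` as an eigenvector
of B. The scalar matches the leading coefficients, so the difference sends u to 0, and g ↦ g(A)u is
injective in degree at most d. -/
theorem recPoly_eq_awPoly (L : LeonardSystem d A B E F θ θs) (hu : F 0 u = u) (hu0 : u ≠ 0)
    (hφ : IsSplitSeq d A B θ θs u φ) {i : ℕ} (hi : i ≤ d) :
    recPoly (aSeq A F) (xSeq A F) i
      = C ((∏ k ∈ Finset.range i, φ (k + 1)) / (nodePoly θs i).eval (θs i)) *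
        awPoly θ θs φ d i := by
  have ht : (nodePoly θs i).eval (θs i) ≠ 0 := L.dual.eval_ne_zero le_rfl hi
  have hΦ := L.prod_splitSeq_ne_zero hu hu0 hφ hi
  set c := (∏ k ∈ Finset.range i, φ (k + 1)) / (nodePoly θs i).eval (θs i) with hc
  set p := recPoly (aSeq A F) (xSeq A F) i with hp
  obtain ⟨hpm, hpd⟩ := recPoly_monic (aSeq A F) (xSeq A F) i
  set f := awPoly θ θs φ d i with hf
  have hcoeff : (p - C c * f).coeff i = 0 := by
    have h1 : p.coeff i = 1 := by
      rw [Monic, leadingCoeff, hpd] at hpm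
      exact hpm
    rw [coeff_sub, coeff_C_mul, h1, hf, awPoly_coeff θ θs φ hi, hc]
    field_simp
    ring
  have hdeg : (p - C c * f).natDegree ≤ i :=
    (natDegree_sub_le _ _).trans (max_le hpd.le
      ((natDegree_C_mul_le _ _).trans (awPoly_natDegree_le θ θs φ d i)))
  refine sub_eq_zero.1 (L.eq_zero_of_aeval hu hu0 (hdeg.trans hi) (L.idemF.eq_zero fun m hm => ?_))
  by_cases hmi : m = i
  · subst hmi
    rw [L.F_aeval hu hm hdeg, hcoeff, zero_smul]
  · have h1 : F m (aeval A p u) = 0 := by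
      rw [← (L.recPoly_apply hu i hi).1, L.idemF.apply_of_ne hm hi hmi]
    have h2 : F m (aeval A f u) = 0 := by
      have := congrArg (F m) (L.B_awPoly hu hu0 hφ hi)
      rw [L.dual.apply_A hm, map_smul, ← sub_eq_zero, ← sub_smul] at this
      refine (smul_eq_zero.1 this).resolve_left (sub_ne_zero.2 fun h => hmi ?_)
      exact L.θs_inj m i hm hi h
    rw [map_sub, map_mul, aeval_C, LinearMap.sub_apply, map_sub, h1, Module.End.mul_apply,
      Module.algebraMap_end_apply, map_smul, h2, smul_zero, sub_zero]

theorem recPoly_eval_zero (L : LeonardSystem d A B E F θ θs) (hu : F 0 u = u) (hu0 : u ≠ 0)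
    (hφ : IsSplitSeq d A B θ θs u φ) {i : ℕ} (hi : i ≤ d) :
    (recPoly (aSeq A F) (xSeq A F) i).eval (θ 0)
      = (∏ k ∈ Finset.range i, φ (k + 1)) / (nodePoly θs i).eval (θs i) := by
  rw [L.recPoly_eq_awPoly hu hu0 hφ hi, eval_mul, awPoly_eval_zero, eval_C, mul_one]

theorem recPoly_normalized (L : LeonardSystem d A B E F θ θs) (hu : F 0 u = u) (hu0 : u ≠ 0)
    (hφ : IsSplitSeq d A B θ θs u φ) {i : ℕ} (hi : i ≤ d) :
    C ((recPoly (aSeq A F) (xSeq A F) i).eval (θ 0))⁻¹ * recPoly (aSeq A F) (xSeq A F) i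
      = awPoly θ θs φ d i := by
  rw [L.recPoly_eval_zero hu hu0 hφ hi, L.recPoly_eq_awPoly hu hu0 hφ hi, ← mul_assoc, ← C_mul,
    inv_mul_cancel₀, C_1, one_mul]
  exact div_ne_zero (L.prod_splitSeq_ne_zero hu hu0 hφ hi) (L.dual.eval_ne_zero le_rfl hi)

/-! #### Standard bases -/

theorem exists_standardBasis (L : LeonardSystem d A B E F θ θs) {v : V} (hv : E 0 v = v)
    (hv0 : v ≠ 0) :
    ∃ β : Module.Basis (Fin (d + 1)) K V, ∀ i : Fin (d + 1), β i = F i v := by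
  obtain ⟨b, hb, -⟩ := L.idemF.exists_basis (w := fun i => F i v)
    (fun i hi => L.dual.E_apply_ne_zero hv hv0 hi) (fun i hi => L.idemF.apply_self hi v)
  exact ⟨b, hb⟩

section StandardBasis

variable {v : V} {β : Module.Basis (Fin (d + 1)) K V}

theorem F_apply_basis (L : LeonardSystem d A B E F θ θs) (hβ : ∀ i : Fin (d + 1), β i = F i v)
    (i : Fin (d + 1)) (w : V) : F i w = β.repr w i • β i := by
  conv_lhs => rw [← β.sum_repr w]
  rw [map_sum, Finset.sum_eq_single i]
  · rw [map_smul, hβ, L.idemF.apply_self (by omega)]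
  · intro j _ hj
    rw [map_smul, hβ, L.idemF.apply_of_ne (by omega) (by omega)
      (by simpa [Fin.ext_iff] using hj.symm), smul_zero]
  · simp

theorem F_A_basis (L : LeonardSystem d A B E F θ θs) (hβ : ∀ i : Fin (d + 1), β i = F i v)
    (i j : Fin (d + 1)) : F i (A (β j)) = LinearMap.toMatrix β β A i j • β i := by
  rw [L.F_apply_basis hβ, LinearMap.toMatrix_apply]

theorem toMatrix_diag (L : LeonardSystem d A B E F θ θs) (hβ : ∀ i : Fin (d + 1), β i = F i v)
    (i : Fin (d + 1)) : LinearMap.toMatrix β β A i i = aSeq A F i := by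
  have h := L.F_A_basis hβ i i
  rw [L.idemF.apply_eq_trace_smul (by omega) (w := β i)
    (by rw [hβ, L.idemF.apply_self (by omega)])] at h
  exact (smul_left_injective K (β.ne_zero i) h).symm

theorem toMatrix_far (L : LeonardSystem d A B E F θ θs) (hβ : ∀ i : Fin (d + 1), β i = F i v)
    (i j : Fin (d + 1)) (h : (i : ℕ) + 1 < j ∨ (j : ℕ) + 1 < i) :
    LinearMap.toMatrix β β A i j = 0 := by
  have h1 := L.F_A_basis hβ i j
  have h2 : F i (A (β j)) = 0 := by
    rw [hβ]
    exact LinearMap.congr_fun (L.F_far i j (by omega) (by omega) h) v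
  rw [h2] at h1
  exact (smul_eq_zero.1 h1.symm).resolve_right (β.ne_zero i)

/-- The standard basis sums to v, which is an eigenvector of A for θ_0. -/
theorem sum_toMatrix (L : LeonardSystem d A B E F θ θs) (hβ : ∀ i : Fin (d + 1), β i = F i v)
    (hv : E 0 v = v) (i : Fin (d + 1)) : ∑ j, LinearMap.toMatrix β β A i j = θ 0 := by
  have hsum : v = ∑ j, β j := by
    simp only [hβ]
    rw [Fin.sum_univ_eq_sum_range (fun j => F j v) (d + 1), L.idemF.sum_apply]
  have hA : A v = θ 0 • v := by
    have := L.A_apply (Nat.zero_le d) v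
    rwa [hv] at this
  have h1 : β.repr (A v) i = ∑ j, LinearMap.toMatrix β β A i j := by
    conv_lhs => rw [hsum]
    simp [LinearMap.toMatrix_apply]
  rw [← h1, hA, hsum]
  simp [Finsupp.single_apply]

theorem aSeq_add (L : LeonardSystem d A B E F θ θs) (hβ : ∀ i : Fin (d + 1), β i = F i v)
    (hv : E 0 v = v) {i : ℕ} (hi : i ≤ d) :
    aSeq A F i + bSeq A β i + cSeq A β i = θ 0 := by
  rw [← L.sum_toMatrix hβ hv ⟨i, by omega⟩, ← L.toMatrix_diag hβ ⟨i, by omega⟩]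
  set M := LinearMap.toMatrix β β A with hM
  set g : ℕ → K := fun j => if h : j < d + 1 then M ⟨i, by omega⟩ ⟨j, h⟩ else 0 with hg
  have e1 : ∑ j, M ⟨i, by omega⟩ j = ∑ j ∈ Finset.range (d + 1), g j := by
    rw [← Fin.sum_univ_eq_sum_range]
    exact Finset.sum_congr rfl fun j _ => by simp only [hg]; rw [dif_pos j.2]
  have hb : bSeq A β i = g (i + 1) := by
    simp only [bSeq, hg, Nat.add_lt_add_iff_right]
    rfl
  have ha : M ⟨i, by omega⟩ ⟨i, by omega⟩ = g i := by
    simp only [hg]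
    rw [dif_pos (by omega)]
  have hfar : ∀ j, (i + 1 < j ∨ j + 1 < i) → g j = 0 := by
    intro j hj
    simp only [hg]
    split_ifs with h
    · exact L.toMatrix_far hβ _ _ hj
    · rfl
  have hgd : g (d + 1) = 0 := by simp [hg]
  rw [e1, ha, hb]
  have hsub : ∑ j ∈ Finset.range (d + 1), g j = ∑ j ∈ Finset.range (d + 2), g j := by
    rw [Finset.sum_range_succ _ (d + 1), hgd, add_zero]
  rw [hsub]
  cases i with
  | zero =>
    have hc : cSeq A β 0 = 0 := by simp [cSeq]
    rw [hc, ← Finset.sum_subset (s₁ := {0, 1})]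
    · simp
    · intro j hj
      simp at hj ⊢
      omega
    · intro j _ hj
      simp at hj
      exact hfar j (by omega)
  | succ i =>
    have hc : cSeq A β (i + 1) = g i := by
      simp only [cSeq, hg]
      rw [dif_pos ⟨by omega, hi⟩, dif_pos (by omega)]
      rfl
    rw [hc, ← Finset.sum_subset (s₁ := {i, i + 1, i + 1 + 1})]
    · rw [Finset.sum_insert (by simp; omega), Finset.sum_insert (by simp), Finset.sum_singleton]
      ring
    · intro j hj
      simp at hj ⊢
      omega
    · intro j _ hj
      simp at hj
      exact hfar j (by omega)

theorem xSeq_eq (L : LeonardSystem d A B E F θ θs) (hβ : ∀ i : Fin (d + 1), β i = F i v)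
    {i : ℕ} (hi : i < d) : xSeq A F (i + 1) = bSeq A β i * cSeq A β (i + 1) := by
  rw [bSeq, dif_pos hi, cSeq, dif_pos ⟨by omega, hi⟩]
  have h1 := L.F_A_basis hβ ⟨i, by omega⟩ ⟨i + 1, by omega⟩
  have h2 := L.F_A_basis hβ ⟨i + 1, by omega⟩ ⟨i, by omega⟩
  have h3 := L.idemF.apply_eq_trace_smul (i := i + 1) hi (w := β ⟨i + 1, by omega⟩)
    (by rw [hβ, L.idemF.apply_self hi]) (A * F i * A)
  simp only [Module.End.mul_apply] at h1 h2 h3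
  rw [h1, map_smul, map_smul, h2, smul_smul] at h3
  have h4 := smul_left_injective K (β.ne_zero _) h3
  simp only [xSeq, Nat.add_sub_cancel, mul_assoc] at h4 ⊢
  exact h4.symm

/-- With x_{i+1} = b_i c_{i+1} and a_i + b_i + c_i = θ_0, the three-term recurrence at θ_0 collapses
to p_{i+1} = b_i p_i. -/
theorem recPoly_eval_eq_prod (L : LeonardSystem d A B E F θ θs)
    (hβ : ∀ i : Fin (d + 1), β i = F i v) (hv : E 0 v = v) :
    ∀ i, i ≤ d → (recPoly (aSeq A F) (xSeq A F) i).eval (θ 0) = ∏ k ∈ Finset.range i, bSeq A β k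
  | 0, _ => by simp [recPoly]
  | 1, h => by
    have := L.aSeq_add hβ hv (Nat.zero_le d)
    have hc : cSeq A β 0 = 0 := by simp [cSeq]
    simp only [recPoly, eval_sub, eval_X, eval_C, Finset.prod_range_one]
    linear_combination -this + hc
  | i + 2, h => by
    have h1 := L.recPoly_eval_eq_prod hβ hv (i + 1) (by omega)
    have h0 := L.recPoly_eval_eq_prod hβ hv i (by omega)
    have ha := L.aSeq_add hβ hv (i := i + 1) (by omega)
    have hx := L.xSeq_eq hβ (i := i) (by omega)
    simp only [recPoly, eval_sub, eval_mul, eval_X, eval_C, h1, h0, Finset.prod_range_succ, hx]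
    linear_combination -(∏ k ∈ Finset.range i, bSeq A β k) * bSeq A β i * ha

theorem bSeq_eq (L : LeonardSystem d A B E F θ θs) (hu : F 0 u = u) (hu0 : u ≠ 0)
    (hφ : IsSplitSeq d A B θ θs u φ) (hβ : ∀ i : Fin (d + 1), β i = F i v) (hv : E 0 v = v)
    {i : ℕ} (hi : i < d) :
    bSeq A β i = φ (i + 1) *
      ((nodePoly θs i).eval (θs i) / (nodePoly θs (i + 1)).eval (θs (i + 1))) := by
  have h1 := L.recPoly_eval_zero hu hu0 hφ hi
  have h0 := L.recPoly_eval_zero hu hu0 hφ hi.le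
  rw [L.recPoly_eval_eq_prod hβ hv (i + 1) hi, Finset.prod_range_succ,
    ← L.recPoly_eval_eq_prod hβ hv i hi.le, h0, Finset.prod_range_succ] at h1
  have ht := L.dual.eval_ne_zero (le_refl i) hi.le
  have ht' := L.dual.eval_ne_zero (le_refl (i + 1)) hi
  have hΦ := L.prod_splitSeq_ne_zero hu hu0 hφ hi.le
  field_simp at h1 ⊢
  linear_combination h1

/-- At θ_0 the recurrence only determines b_i. At θ_d the values of p_i come from the second split
sequence, and the recurrence becomes a linear equation for c_i. It includes i = d: there
p_{d+1}(θ_d) = 0 and φ_{d+1} = φ'_{d+1} = 0, so the value of θ* beyond the range is multiplied by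
zero. -/
theorem cSeq_eq (L : LeonardSystem d A B E F θ θs) (hu : F 0 u = u) (hu0 : u ≠ 0)
    (hφ : IsSplitSeq d A B θ θs u φ) {φ' : ℕ → K}
    (hφ' : IsSplitSeq d A B (fun i => θ (d - i)) θs u φ')
    (hβ : ∀ i : Fin (d + 1), β i = F i v) (hv : E 0 v = v) {i : ℕ} (hi1 : 1 ≤ i) (hi : i ≤ d) :
    cSeq A β i * (φ' i - φ i) = φ' i * (θ 0 - θ d + ((nodePoly θs i).eval (θs i) /
      (nodePoly θs (i + 1)).eval (θs (i + 1))) * (φ' (i + 1) - φ (i + 1))) := by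
  obtain ⟨k, rfl⟩ : ∃ k, i = k + 1 := ⟨i - 1, by omega⟩
  have hN : ∀ i, i ≤ d → (recPoly (aSeq A F) (xSeq A F) i).eval (θ d)
      = (∏ k ∈ Finset.range i, φ' (k + 1)) / (nodePoly θs i).eval (θs i) := by
    intro i hi
    simpa using L.reverse.recPoly_eval_zero hu hu0 hφ' hi
  have hN0 := hN k (by omega)
  have hN1 := hN (k + 1) hi
  rw [Finset.prod_range_succ] at hN1
  have ht0 := L.dual.eval_ne_zero (le_refl k) (by omega)
  have ht1 := L.dual.eval_ne_zero (le_refl (k + 1)) hi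
  have hΦ := L.reverse.prod_splitSeq_ne_zero hu hu0 hφ' (n := k) (by omega)
  have hb0 := L.bSeq_eq hu hu0 hφ hβ hv (i := k) hi
  have ha := L.aSeq_add hβ hv hi
  have hx := L.xSeq_eq hβ (i := k) hi
  set t0 := (nodePoly θs k).eval (θs k)
  set t1 := (nodePoly θs (k + 1)).eval (θs (k + 1))
  set e := t1 / (nodePoly θs (k + 1 + 1)).eval (θs (k + 1 + 1)) with he
  set Φ := ∏ k ∈ Finset.range k, φ' (k + 1)
  have hN2 : (recPoly (aSeq A F) (xSeq A F) (k + 2)).eval (θ d)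
      = Φ * φ' (k + 1) * φ' (k + 2) * e / t1 := by
    rcases hi.eq_or_lt with rfl | hlt
    · rw [show φ' (k + 2) = 0 from hφ'.last]
      have h := L.recPoly_last hu
      have h1 := congrArg (E (k + 1)) h
      rw [L.apply_aeval le_rfl, map_zero] at h1
      rw [(smul_eq_zero.1 h1).resolve_right (L.E_apply_ne_zero hu hu0 le_rfl)]
      simp
    · rw [hN (k + 2) hlt, Finset.prod_range_succ, Finset.prod_range_succ]
      have := L.dual.eval_ne_zero (le_refl (k + 2)) hlt
      rw [he]
      field_simp
      simp only [Φ]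
      ring
  have hb1 : bSeq A β (k + 1) = φ (k + 2) * e := by
    rcases hi.eq_or_lt with rfl | hlt
    · rw [show φ (k + 2) = 0 from hφ.last]
      simp [bSeq]
    · exact L.bSeq_eq hu hu0 hφ hβ hv hlt
  have hrec : (recPoly (aSeq A F) (xSeq A F) (k + 2)).eval (θ d)
      = (θ d - aSeq A F (k + 1)) * (recPoly (aSeq A F) (xSeq A F) (k + 1)).eval (θ d)
        - xSeq A F (k + 1) * (recPoly (aSeq A F) (xSeq A F) k).eval (θ d) := by
    simp [recPoly]
  have ha' : aSeq A F (k + 1) = θ 0 - φ (k + 2) * e - cSeq A β (k + 1) := by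
    linear_combination ha - hb1
  rw [hN2, hN1, hN0, hx, hb0, ha'] at hrec
  field_simp at hrec
  linear_combination -hrec

end StandardBasis

end LeonardSystem

end Abstract

end

section

section Abstract

variable {K V : Type*} [Field K] [AddCommGroup V] [Module K V]

/-! ### Intersection numbers in closed form -/

theorem qForm_sub {q : K} (hq0 : q ≠ 0) (α β γ : K) (i j : ℕ) :
    qForm q α β γ i - qForm q α β γ j
      = (q ^ j - q ^ i) * (γ / (q ^ i * q ^ j) - β) := by
  have hi := pow_ne_zero i hq0
  have hj := pow_ne_zero j hq0
  simp only [qForm]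
  field_simp
  ring

/-- Reversal exchanges the coefficients of q^i and q^{-i} up to powers of q^d, so the reversed
system again has eigenvalues of this form. -/
theorem qForm_reverse {q : K} (hq0 : q ≠ 0) (α β γ : K) {d i : ℕ} (hi : i ≤ d) :
    qForm q α β γ (d - i) = qForm q α (γ / q ^ d) (β * q ^ d) i := by
  have hqi := pow_ne_zero i hq0
  have hqd := pow_ne_zero d hq0
  have : q ^ (d - i) = q ^ d / q ^ i := by
    rw [eq_div_iff hqi, ← pow_add, Nat.sub_add_cancel hi]
  simp only [qForm, this]
  field_simp
  ring

/-- The ratio `τ*_i(θ*_i) / τ*_{i+1}(θ*_{i+1})` for sequences of `q`-Racah form. -/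
theorem nodePoly_ratio {q : K} (hq0 : q ≠ 0) {γ₀ γ₁ γ₂ : K} {θs : ℕ → K} {d : ℕ}
    (hθs : ∀ i, i ≤ d → θs i = qForm q γ₀ γ₁ γ₂ i)
    (hinj : ∀ i j, i ≤ d → j ≤ d → θs i = θs j → i = j) {i : ℕ} (hi1 : 1 ≤ i) (hi : i < d) :
    (nodePoly θs i).eval (θs i) / (nodePoly θs (i + 1)).eval (θs (i + 1))
      = q ^ (i + 1) * (γ₂ / q ^ i - γ₁) / ((1 - q ^ (i + 1)) * (γ₂ / q ^ i - γ₁ * q ^ i) *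
        (γ₂ / q ^ i - γ₁ * q ^ (i + 1))) := by
  have hne : ∀ a b, a ≤ d → b ≤ d → a ≠ b →
      q ^ b - q ^ a ≠ 0 ∧ γ₂ / (q ^ a * q ^ b) - γ₁ ≠ 0 := by
    intro a b ha hb hab
    have h := sub_ne_zero.2 fun h => hab (hinj a b ha hb h)
    rw [hθs a ha, hθs b hb, qForm_sub hq0] at h
    exact mul_ne_zero_iff.1 h
  have hp : ∀ n, q ^ n ≠ 0 := fun n => pow_ne_zero n hq0
  -- The difference θ*_i - θ*_h is (q^h - q^i) f(h), and with i+1 in place of i the last factor is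
  -- f(h+1). The two products of these factors therefore cancel except at the ends.
  set f : ℕ → K := fun h => γ₂ / (q ^ i * q ^ h) - γ₁ with hf
  have h1 : (nodePoly θs i).eval (θs i)
      = (∏ h ∈ Finset.range i, (q ^ h - q ^ i)) * ∏ h ∈ Finset.range i, f h := by
    rw [nodePoly_eval, ← Finset.prod_mul_distrib]
    refine Finset.prod_congr rfl fun h hh => ?_
    have := Finset.mem_range.1 hh
    rw [hθs i hi.le, hθs h (by omega), qForm_sub hq0]
  have h2 : (nodePoly θs (i + 1)).eval (θs (i + 1))
      = (∏ h ∈ Finset.range (i + 1), (q ^ h - q ^ (i + 1))) *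
        ∏ h ∈ Finset.range (i + 1), f (h + 1) := by
    rw [nodePoly_eval, ← Finset.prod_mul_distrib]
    refine Finset.prod_congr rfl fun h hh => ?_
    have := Finset.mem_range.1 hh
    rw [hθs (i + 1) hi, hθs h (by omega), qForm_sub hq0]
    have e : q ^ (i + 1) * q ^ h = q ^ i * q ^ (h + 1) := by ring
    rw [e]
  have h3 : ∏ h ∈ Finset.range (i + 1), (q ^ h - q ^ (i + 1))
      = (1 - q ^ (i + 1)) * (q ^ i * ∏ h ∈ Finset.range i, (q ^ h - q ^ i)) := by
    rw [Finset.prod_range_succ', pow_zero, mul_comm]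
    congr 1
    have : ∀ h, q ^ (h + 1) - q ^ (i + 1) = q * (q ^ h - q ^ i) := fun h => by ring
    simp only [this, Finset.prod_mul_distrib, Finset.prod_const, Finset.card_range]
  have h4 : f 0 * ∏ h ∈ Finset.range (i + 1), f (h + 1)
      = (∏ h ∈ Finset.range i, f h) * f i * f (i + 1) := by
    rw [mul_comm, ← Finset.prod_range_succ', Finset.prod_range_succ, Finset.prod_range_succ]
  have hd1 : ∏ h ∈ Finset.range i, (q ^ h - q ^ i) ≠ 0 :=
    Finset.prod_ne_zero_iff.2 fun h hh =>
      (hne i h hi.le (by simp at hh; omega) (by simp at hh; omega)).1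
  have hd2 : ∏ h ∈ Finset.range i, f h ≠ 0 :=
    Finset.prod_ne_zero_iff.2 fun h hh =>
      (hne i h hi.le (by simp at hh; omega) (by simp at hh; omega)).2
  have hd3 : ∏ h ∈ Finset.range (i + 1), f (h + 1) ≠ 0 :=
    Finset.prod_ne_zero_iff.2 fun h hh => by
      have := (hne (i + 1) h hi (by simp at hh; omega) (by simp at hh; omega)).2
      have e : q ^ (i + 1) * q ^ h = q ^ i * q ^ (h + 1) := by ring
      rwa [e] at this
  -- This is the factor of θ*_{i+1} - θ*_{i-1}, hence the requirement 1 ≤ i; the formula for b_0 is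
  -- separate for this reason.
  have hfi : f i ≠ 0 := by
    have := (hne (i + 1) (i - 1) hi (by omega) (by omega)).2
    rwa [← pow_add, show i + 1 + (i - 1) = i + i by omega, pow_add] at this
  have hfi1 : f (i + 1) ≠ 0 := by
    have := (hne (i + 1) i hi hi.le (by omega)).2
    rwa [mul_comm] at this
  have hq1 : 1 - q ^ (i + 1) ≠ 0 := by simpa using (hne (i + 1) 0 hi (by omega) (by omega)).1
  have e0 : γ₂ / q ^ i - γ₁ = f 0 := by simp [hf]
  have ei : γ₂ / q ^ i - γ₁ * q ^ i = q ^ i * f i := by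
    have := hp i
    simp only [hf]
    field_simp
  have ei1 : γ₂ / q ^ i - γ₁ * q ^ (i + 1) = q ^ (i + 1) * f (i + 1) := by
    have := hp i
    have := hp (i + 1)
    simp only [hf]
    field_simp
  rw [h1, h2, h3, e0, ei, ei1, div_eq_div_iff]
  · linear_combination (∏ h ∈ Finset.range i, (q ^ h - q ^ i)) * (-(q ^ (i + 1) * q ^ i
      * (1 - q ^ (i + 1)))) * h4
  · exact mul_ne_zero (mul_ne_zero hq1 (mul_ne_zero (hp i) hd1)) hd3
  · exact mul_ne_zero (mul_ne_zero hq1 (mul_ne_zero (hp i) hfi)) (mul_ne_zero (hp _) hfi1)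

namespace LeonardSystem

variable {d : ℕ} {A B : Module.End K V} {E F : ℕ → Module.End K V} {θ θs : ℕ → K}
  {q α₀ α₁ α₂ γ₀ γ₁ γ₂ : K} {u v : V} {φ φ' : ℕ → K} {β : Module.Basis (Fin (d + 1)) K V}

theorem qForm_ne (L : LeonardSystem d A B E F θ θs) (hq0 : q ≠ 0)
    (hθ : ∀ i, i ≤ d → θ i = qForm q α₀ α₁ α₂ i) {i j : ℕ} (hi : i ≤ d) (hj : j ≤ d)
    (hij : i ≠ j) : q ^ j - q ^ i ≠ 0 ∧ α₂ / (q ^ i * q ^ j) - α₁ ≠ 0 := by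
  have h := sub_ne_zero.2 fun h => hij (L.θ_inj i j hi hj h)
  rw [hθ i hi, hθ j hj, qForm_sub hq0] at h
  exact mul_ne_zero_iff.1 h

theorem one_sub_pow_ne_zero (L : LeonardSystem d A B E F θ θs) (hq0 : q ≠ 0)
    (hθ : ∀ i, i ≤ d → θ i = qForm q α₀ α₁ α₂ i) {i : ℕ} (hi1 : 1 ≤ i) (hi : i ≤ d) :
    1 - q ^ i ≠ 0 := by
  simpa using (L.qForm_ne hq0 hθ hi (Nat.zero_le d) (by omega)).1

theorem bSeq_zero_closed (L : LeonardSystem d A B E F θ θs) (hd : 0 < d) (hu : F 0 u = u)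
    (hu0 : u ≠ 0) (hφ : IsSplitSeq d A B θ θs u φ) (hβ : ∀ i : Fin (d + 1), β i = F i v)
    (hv : E 0 v = v) (hq0 : q ≠ 0) (hθs : ∀ i, i ≤ d → θs i = qForm q γ₀ γ₁ γ₂ i) :
    bSeq A β 0 = φ 1 / ((1 - q) * (γ₂ / q - γ₁)) := by
  rw [L.bSeq_eq hu hu0 hφ hβ hv hd, nodePoly_eval, nodePoly_eval, Finset.prod_range_zero, zero_add,
    Finset.prod_range_one, hθs 1 hd, hθs 0 (by omega), qForm_sub hq0]
  simp [div_eq_mul_inv]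

theorem bSeq_closed (L : LeonardSystem d A B E F θ θs) (hu : F 0 u = u)
    (hu0 : u ≠ 0) (hφ : IsSplitSeq d A B θ θs u φ) (hβ : ∀ i : Fin (d + 1), β i = F i v)
    (hv : E 0 v = v) (hq0 : q ≠ 0) (hθs : ∀ i, i ≤ d → θs i = qForm q γ₀ γ₁ γ₂ i)
    {i : ℕ} (hi1 : 1 ≤ i) (hi : i < d) :
    bSeq A β i = φ (i + 1) * (q ^ (i + 1) * (γ₂ / q ^ i - γ₁) / ((1 - q ^ (i + 1)) *
      (γ₂ / q ^ i - γ₁ * q ^ i) * (γ₂ / q ^ i - γ₁ * q ^ (i + 1)))) := by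
  rw [L.bSeq_eq hu hu0 hφ hβ hv hi, nodePoly_ratio hq0 hθs L.θs_inj hi1 hi]

/-- With φ' - φ in factored form, every term of the linear equation for c_i carries the factor (1 -
q^i)(α₁ - α₂q^{-d}). It is nonzero because θ_i ≠ θ_0 and θ_d ≠ θ_0, and it cancels. -/
theorem cSeq_closed (L : LeonardSystem d A B E F θ θs) (hu : F 0 u = u) (hu0 : u ≠ 0)
    (hφ : IsSplitSeq d A B θ θs u φ)
    (hφ' : IsSplitSeq d A B (fun i => θ (d - i)) θs u φ')
    (hβ : ∀ i : Fin (d + 1), β i = F i v) (hv : E 0 v = v) (hq0 : q ≠ 0)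
    (hθ : ∀ i, i ≤ d → θ i = qForm q α₀ α₁ α₂ i) (hθs : ∀ i, i ≤ d → θs i = qForm q γ₀ γ₁ γ₂ i)
    (hdiff : ∀ i, 1 ≤ i → i ≤ d → φ' i - φ i = -((1 - q ^ i) * (1 - q ^ (d + 1) / q ^ i) *
      (α₁ - α₂ / q ^ d) * (γ₂ / q ^ i - γ₁ * (q ^ i / q)))) {i : ℕ} (hi1 : 1 ≤ i) (hi : i < d) :
    cSeq A β i = -φ' i * (γ₂ / q ^ i - γ₁ * q ^ d) / ((1 - q ^ (d + 1) / q ^ i) *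
      (γ₂ / q ^ i - γ₁ * (q ^ i / q)) * (γ₂ / q ^ i - γ₁ * q ^ i)) := by
  have h := L.cSeq_eq hu hu0 hφ hφ' hβ hv hi1 hi.le
  rw [hdiff i hi1 hi.le, hdiff (i + 1) (by omega) hi, nodePoly_ratio hq0 hθs L.θs_inj hi1 hi,
    hθ 0 (by omega), hθ d le_rfl, qForm_sub hq0] at h
  have hp : ∀ n, q ^ n ≠ 0 := fun n => pow_ne_zero n hq0
  have hy := hp i
  have hQ := hp d
  have n1 := L.one_sub_pow_ne_zero hq0 hθ hi1 hi.le
  have n2 := L.one_sub_pow_ne_zero hq0 hθ (i := i + 1) (by omega) hi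
  have n3 : 1 - q ^ (d + 1) / q ^ i ≠ 0 := by
    have e : q ^ (d + 1) / q ^ i = q ^ (d + 1 - i) := by
      rw [div_eq_iff hy, ← pow_add, Nat.sub_add_cancel (by omega)]
    rw [e]
    exact L.one_sub_pow_ne_zero hq0 hθ (by omega) (by omega)
  have n4 : α₁ - α₂ / q ^ d ≠ 0 := by
    have := (L.qForm_ne hq0 hθ le_rfl (Nat.zero_le d) (by omega)).2
    rw [pow_zero, mul_one] at this
    exact sub_ne_zero.2 (sub_ne_zero.1 this).symm
  -- Such a factor, with c = q^{a+b-i}, divides θ*_a - θ*_b; a suitable pair a ≠ b is chosen for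
  -- each denominator below.
  have aux : ∀ a b, a ≤ d → b ≤ d → a ≠ b → ∀ c, c * q ^ i = q ^ a * q ^ b →
      γ₂ / q ^ i - γ₁ * c ≠ 0 := by
    intro a b ha hb hab c hc h0
    refine (L.dual.qForm_ne hq0 hθs ha hb hab).2 ?_
    have hc0 : c ≠ 0 := by
      rintro rfl
      rw [zero_mul] at hc
      exact mul_ne_zero (hp a) (hp b) hc.symm
    rw [← hc]
    field_simp at h0 ⊢
    rw [mul_zero] at h0 ⊢
    exact h0
  have n5 : γ₂ / q ^ i - γ₁ * (q ^ i / q) ≠ 0 := by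
    refine aux i (i - 1) hi.le (by omega) (by omega) _ ?_
    have : q ^ i = q ^ (i - 1) * q := by rw [← pow_succ, Nat.sub_add_cancel hi1]
    rw [this]
    field_simp
  have n6 : γ₂ / q ^ i - γ₁ * q ^ i ≠ 0 := by
    refine aux (i + 1) (i - 1) hi (by omega) (by omega) _ ?_
    rw [← pow_add, ← pow_add]
    congr 1
    omega
  have n7 : γ₂ / q ^ i - γ₁ * q ^ (i + 1) ≠ 0 :=
    aux (i + 1) i hi hi.le (by omega) _ rfl
  simp only [pow_succ, pow_zero] at h n2 n3 n7 ⊢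
  set y := q ^ i with hy'
  set Q := q ^ d with hQ'
  set κ := α₁ - α₂ / Q with hκ
  have hα : α₁ = κ + α₂ / Q := by rw [hκ]; ring
  set z := γ₂ / y with hz'
  have hγ : γ₂ = z * y := by rw [hz', div_mul_cancel₀ _ hy]
  -- The bracket in the linear equation collapses to a single product containing κ and 1 - q^i.
  have hbr : (Q - 1) * (α₂ / (1 * Q) - α₁) + y * q * (z - γ₁) / ((1 - y * q) * (z - γ₁ * y) *
      (z - γ₁ * (y * q))) * -((1 - y * q) * (1 - Q * q / (y * q)) * κ *
      (γ₂ / (y * q) - γ₁ * (y * q / q))) = κ * ((1 - y) * (z - γ₁ * Q) / (z - γ₁ * y)) := by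
    have e1 : γ₂ / (y * q) - γ₁ * (y * q / q) = (z - γ₁ * (y * q)) / q := by
      rw [hγ]
      field_simp
    have e2 : (1 - y * q) * (1 - Q * q / (y * q)) = (1 - y * q) * (1 - Q / y) := by
      field_simp
    rw [e1, e2, hα]
    generalize z - γ₁ * (y * q) = M at n7 ⊢
    generalize 1 - y * q = P at n2 ⊢
    have hN : z = (z - γ₁ * y) + γ₁ * y := by ring
    generalize z - γ₁ * y = N at n6 hN ⊢
    rw [hN]
    field_simp
    ring
  rw [hbr] at h
  have hk : κ * (1 - y) * (cSeq A β i * ((1 - Q * q / y) * (z - γ₁ * (y / q)))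
      + φ' i * ((z - γ₁ * Q) / (z - γ₁ * y))) = 0 := by
    linear_combination -h
  have hk' := (mul_eq_zero.1 hk).resolve_left (mul_ne_zero n4 n1)
  rw [eq_div_iff (mul_ne_zero (mul_ne_zero n3 n5) n6)]
  have hm : (z - γ₁ * Q) / (z - γ₁ * y) * (z - γ₁ * y) = z - γ₁ * Q := div_mul_cancel₀ _ n6
  linear_combination (z - γ₁ * y) * hk' - φ' i * hm

/-- For i = d the terms with index d+1 drop out of the linear equation, so no ratio involving
θ*_{d+1} is needed. -/
theorem cSeq_last_closed (L : LeonardSystem d A B E F θ θs) (hd : 0 < d) (hu : F 0 u = u)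
    (hu0 : u ≠ 0) (hφ : IsSplitSeq d A B θ θs u φ)
    (hφ' : IsSplitSeq d A B (fun i => θ (d - i)) θs u φ')
    (hβ : ∀ i : Fin (d + 1), β i = F i v) (hv : E 0 v = v) (hq0 : q ≠ 0)
    (hθ : ∀ i, i ≤ d → θ i = qForm q α₀ α₁ α₂ i)
    (hdiff : ∀ i, 1 ≤ i → i ≤ d → φ' i - φ i = -((1 - q ^ i) * (1 - q ^ (d + 1) / q ^ i) *
      (α₁ - α₂ / q ^ d) * (γ₂ / q ^ i - γ₁ * (q ^ i / q)))) :
    cSeq A β d * ((1 - q) * (γ₂ / q ^ d - γ₁ * (q ^ d / q))) = -φ' d := by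
  have h := L.cSeq_eq hu hu0 hφ hφ' hβ hv hd le_rfl
  rw [hdiff d hd le_rfl, hφ.last, hφ'.last, sub_zero, mul_zero, add_zero,
    hθ 0 (by omega), hθ d le_rfl, qForm_sub hq0] at h
  have hQ := pow_ne_zero d hq0
  have n1 := L.one_sub_pow_ne_zero hq0 hθ hd le_rfl
  have n4 : α₁ - α₂ / q ^ d ≠ 0 := by
    have := (L.qForm_ne hq0 hθ le_rfl (Nat.zero_le d) (by omega)).2
    rw [pow_zero, mul_one] at this
    exact sub_ne_zero.2 (sub_ne_zero.1 this).symm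
  have e : q ^ (d + 1) / q ^ d = q := by rw [pow_succ]; field_simp
  rw [e, pow_zero, one_mul] at h
  refine mul_left_cancel₀ (mul_ne_zero n1 n4) ?_
  linear_combination -h

end LeonardSystem

end Abstract

end

section

/-! ### Leonard systems of `q`-Racah type -/

/-- The first split sequence in terms of `τ`. -/
def tauFirst (q h hs s ss : ℂ) (r t d : ℕ) (τ : ℂ) (i : ℕ) : ℂ :=
  h * hs * (1 - q ^ i) * (1 - q ^ ((d : ℤ) - i + 1)) *
    (τ - s * ss * q ^ (r + t + i + 1) - q ^ (-(r : ℤ) - t - i - d))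

/-- The second split sequence in terms of `τ`. -/
def tauSecond (q h hs s ss : ℂ) (r t d : ℕ) (τ : ℂ) (i : ℕ) : ℂ :=
  h * hs * (1 - q ^ i) * (1 - q ^ ((d : ℤ) - i + 1)) *
    (τ - ss * q ^ ((r : ℤ) - t - d + i) - s * q ^ ((t : ℤ) - r - i + 1))

/-- The first split sequence in factored form. -/
def rootFirst (q h hs ρ₁ ρ₂ : ℂ) (r t d : ℕ) (i : ℕ) : ℂ :=
  h * hs * q ^ (1 - 2 * (i : ℤ) - t - r) * (1 - q ^ i) * (1 - q ^ ((i : ℤ) - d - 1)) *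
    (1 - ρ₁ * q ^ i) * (1 - ρ₂ * q ^ i)

/-- The second split sequence in factored form. -/
def rootSecond (q h hs ss ρ₁ ρ₂ : ℂ) (r t d : ℕ) (i : ℕ) : ℂ :=
  h * hs * q ^ (1 - 2 * (i : ℤ) - t - r) * (1 - q ^ i) * (1 - q ^ ((i : ℤ) - d - 1)) *
    (ρ₁ - ss * q ^ (i + 2 * r)) * (ρ₂ - ss * q ^ (i + 2 * r)) / (ss * q ^ (2 * r))

/-! ### Passage between the τ form and the factored form of the split sequences -/

section Forms

variable {q h hs s ss ρ₁ ρ₂ τ : ℂ} {r t d : ℕ}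

theorem tauFirst_eq (hq0 : q ≠ 0) (i : ℕ) : tauFirst q h hs s ss r t d τ i
    = h * hs * (1 - q ^ i) * (1 - q ^ (d + 1) / q ^ i) *
      (τ - s * ss * (q ^ r * q ^ t * q ^ i * q) - 1 / (q ^ r * q ^ t * q ^ i * q ^ d)) := by
  simp only [tauFirst, zpow_sub₀ hq0, zpow_add₀ hq0, _root_.zpow_neg, zpow_natCast, pow_add, pow_one,
    zpow_one]
  field_simp

theorem tauSecond_eq (hq0 : q ≠ 0) (i : ℕ) : tauSecond q h hs s ss r t d τ i
    = h * hs * (1 - q ^ i) * (1 - q ^ (d + 1) / q ^ i) *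
      (τ - ss * (q ^ r * q ^ i / (q ^ t * q ^ d)) - s * (q ^ t * q / (q ^ r * q ^ i))) := by
  simp only [tauSecond, zpow_sub₀ hq0, zpow_add₀ hq0, zpow_natCast, pow_add, pow_one,
    zpow_one]
  field_simp

theorem rootFirst_eq (hq0 : q ≠ 0) (i : ℕ) : rootFirst q h hs ρ₁ ρ₂ r t d i
    = -(h * hs * (1 - q ^ i) * (1 - q ^ (d + 1) / q ^ i) *
      ((1 - ρ₁ * q ^ i) * (1 - ρ₂ * q ^ i)) / (q ^ r * q ^ t * q ^ i * q ^ d)) := by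
  have e : q ^ (2 * (i : ℤ)) = q ^ i * q ^ i := by
    rw [two_mul, zpow_add₀ hq0, zpow_natCast]
  simp only [rootFirst, zpow_sub₀ hq0, e, zpow_natCast, pow_add, pow_one, zpow_one]
  field_simp
  ring

theorem rootSecond_eq (hq0 : q ≠ 0) (hss : ss ≠ 0) (i : ℕ) :
    rootSecond q h hs ss ρ₁ ρ₂ r t d i
    = -(h * hs * (1 - q ^ i) * (1 - q ^ (d + 1) / q ^ i) *
      ((ρ₁ - ss * q ^ (2 * r + i)) * (ρ₂ - ss * q ^ (2 * r + i))) /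
      (ss * q ^ (3 * r) * q ^ t * q ^ i * q ^ d)) := by
  have e : q ^ (2 * (i : ℤ)) = q ^ i * q ^ i := by
    rw [two_mul, zpow_add₀ hq0, zpow_natCast]
  have e3 : q ^ (3 * r) = q ^ (2 * r) * q ^ r := by rw [← pow_add]; congr 1; ring
  simp only [rootSecond, zpow_sub₀ hq0, e, e3, zpow_natCast, zpow_one, pow_succ,
    add_comm i (2 * r)]
  field_simp
  ring

/-- Vieta: expanding (1 - ρ₁q^i)(1 - ρ₂q^i) involves only the sum and product of ρ₁, ρ₂, and
dividing by -q^{r+t+i+d} gives the bracket containing τ. -/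
theorem tauFirst_eq_rootFirst (hq0 : q ≠ 0) (hsum : ρ₁ + ρ₂ = τ * q ^ (r + t + d))
    (hprod : ρ₁ * ρ₂ = s * ss * q ^ (2 * r + 2 * t + d + 1)) (i : ℕ) :
    tauFirst q h hs s ss r t d τ i = rootFirst q h hs ρ₁ ρ₂ r t d i := by
  have e : (1 - ρ₁ * q ^ i) * (1 - ρ₂ * q ^ i)
      = 1 - τ * q ^ (r + t + d) * q ^ i + s * ss * q ^ (2 * r + 2 * t + d + 1) * (q ^ i) ^ 2 := by
    rw [← hsum, ← hprod]
    ring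
  rw [tauFirst_eq hq0, rootFirst_eq hq0, e]
  simp only [pow_add, pow_mul']
  field_simp
  ring

theorem tauSecond_eq_rootSecond (hq0 : q ≠ 0) (hss : ss ≠ 0)
    (hsum : ρ₁ + ρ₂ = τ * q ^ (r + t + d))
    (hprod : ρ₁ * ρ₂ = s * ss * q ^ (2 * r + 2 * t + d + 1)) (i : ℕ) :
    tauSecond q h hs s ss r t d τ i = rootSecond q h hs ss ρ₁ ρ₂ r t d i := by
  have e : (ρ₁ - ss * q ^ (2 * r + i)) * (ρ₂ - ss * q ^ (2 * r + i))
      = s * ss * q ^ (2 * r + 2 * t + d + 1) - τ * q ^ (r + t + d) * (ss * q ^ (2 * r + i))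
        + (ss * q ^ (2 * r + i)) ^ 2 := by
    rw [← hsum, ← hprod]
    ring
  rw [tauSecond_eq hq0, rootSecond_eq hq0 hss, e]
  simp only [pow_add, pow_mul']
  field_simp
  ring

theorem tauFirst_swap (i : ℕ) :
    tauFirst q hs h ss s t r d τ i = tauFirst q h hs s ss r t d τ i := by
  simp only [tauFirst]
  rw [show t + r + i + 1 = r + t + i + 1 by ring,
    show (-(t : ℤ) - r - i - d) = -(r : ℤ) - t - i - d by ring]
  ring

/-- The indices d-i and i+1 add up to d+1: exchanging the roles of A and A* reverses the second
split sequence. -/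
theorem tauSecond_swap {i : ℕ} (hi : i ≤ d) :
    tauSecond q hs h ss s t r d τ (d - i) = tauSecond q h hs s ss r t d τ (i + 1) := by
  simp only [tauSecond, Nat.cast_sub hi, ← zpow_natCast q (d - i), ← zpow_natCast q (i + 1),
    Nat.cast_add, Nat.cast_one]
  ring_nf

end Forms

section

variable {V : Type*} [AddCommGroup V] [Module ℂ V]

/-- A Leonard system of `q`-Racah type, together with its split sequences `φ`, `φ'`. -/
structure QRacahSystem (q h hs s ss : ℂ) (r t d : ℕ) (A B : Module.End ℂ V)
    (E F : ℕ → Module.End ℂ V) (θ θs : ℕ → ℂ) (τ : ℂ) (u : V) (φ φ' : ℕ → ℂ) : Prop where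
  leonard : LeonardSystem d A B E F θ θs
  pos : 0 < d
  q_ne_zero : q ≠ 0
  ne_zero : h ≠ 0 ∧ hs ≠ 0 ∧ s ≠ 0 ∧ ss ≠ 0
  eigenvalue : ∃ α₀, ∀ i, i ≤ d → θ i = qForm q α₀ (h * s * q ^ (t + 1)) (h / q ^ t) i
  dualEigenvalue : ∃ γ₀, ∀ i, i ≤ d → θs i = qForm q γ₀ (hs * ss * q ^ (r + 1)) (hs / q ^ r) i
  apply_u : F 0 u = u
  u_ne_zero : u ≠ 0
  first : IsSplitSeq d A B θ θs u φ
  second : IsSplitSeq d A B (fun i => θ (d - i)) θs u φ'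
  first_eq : ∀ i, 1 ≤ i → i ≤ d → φ i = tauFirst q h hs s ss r t d τ i
  second_eq : ∀ i, 1 ≤ i → i ≤ d → φ' i = tauSecond q h hs s ss r t d τ i

variable {q h hs s ss : ℂ} {r t d : ℕ} {A B : Module.End ℂ V}
    {E F : ℕ → Module.End ℂ V} {θ θs : ℕ → ℂ} {τ : ℂ} {u : V} {φ φ' : ℕ → ℂ}

theorem IsSplitSeq.congr {θs' : ℕ → ℂ} (hφ : IsSplitSeq d A B θ θs u φ)
    (hθs : ∀ i, i ≤ d → θs' i = θs i) : IsSplitSeq d A B θ θs' u φ where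
  apply_zero := by rw [hθs 0 (Nat.zero_le d), hφ.apply_zero]
  apply_succ n hn := by rw [hθs _ hn, hφ.apply_succ n hn]
  zero := hφ.zero
  last := hφ.last

/-- The scalar `τ` exists if `q` is not a root of unity of small order. -/
theorem LeonardSystem.exists_tau (L : LeonardSystem d A B E F θ θs) (hd : 0 < d) (hq0 : q ≠ 0)
    (hq : ∀ k, 1 ≤ k → k ≤ d + 1 → q ^ k ≠ 1) (hne : h ≠ 0 ∧ hs ≠ 0 ∧ s ≠ 0 ∧ ss ≠ 0)
    (hθ : ∃ α₀, ∀ i, i ≤ d → θ i = qForm q α₀ (h * s * q ^ (t + 1)) (h / q ^ t) i)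
    (hθs : ∃ γ₀, ∀ i, i ≤ d → θs i = qForm q γ₀ (hs * ss * q ^ (r + 1)) (hs / q ^ r) i)
    (hu : F 0 u = u) (hu0 : u ≠ 0) (hφ : IsSplitSeq d A B θ θs u φ)
    (hφ' : IsSplitSeq d A B (fun i => θ (d - i)) θs u φ') :
    ∃ τ, (∀ i, 1 ≤ i → i ≤ d → φ i = tauFirst q h hs s ss r t d τ i) ∧
      ∀ i, 1 ≤ i → i ≤ d → φ' i = tauSecond q h hs s ss r t d τ i := by
  obtain ⟨hh, hhs, -, -⟩ := hne
  obtain ⟨α₀, hθ⟩ := hθ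
  obtain ⟨γ₀, hθs⟩ := hθs
  obtain ⟨c, hc⟩ := L.splitSeq_form hd hu hu0 hφ hq0 hq hθ hθs
  obtain ⟨c', hc'⟩ := L.reverse.splitSeq_form (α₀ := α₀) hd hu hu0 hφ' hq0 hq
    (fun i hi => by rw [hθ _ (by omega), qForm_reverse hq0 _ _ _ hi]) hθs
  have hqd := pow_ne_zero d hq0
  have hqt := pow_ne_zero t hq0
  have hqr := pow_ne_zero r hq0
  -- The first terms are (θ*_0 - θ*_1)(a_0 - θ_0) and (θ*_0 - θ*_1)(a_0 - θ_d). Their difference no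
  -- longer contains a_0 and determines c - c'.
  have hcc : c = c' := by
    have h1 := L.splitSeq_one hd hu hu0 hφ
    have h2 := L.reverse.splitSeq_one hd hu hu0 hφ'
    rw [hc 1 (by omega)] at h1
    rw [hc' 1 (by omega)] at h2
    have h3 : θ d - θ 0 = qForm q α₀ (h * s * q ^ (t + 1)) (h / q ^ t) d
        - qForm q α₀ (h * s * q ^ (t + 1)) (h / q ^ t) 0 := by
      rw [hθ d le_rfl, hθ 0 (by omega)]
    have h4 : θs 0 - θs 1 = qForm q γ₀ (hs * ss * q ^ (r + 1)) (hs / q ^ r) 0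
        - qForm q γ₀ (hs * ss * q ^ (r + 1)) (hs / q ^ r) 1 := by
      rw [hθs 1 hd, hθs 0 (by omega)]
    rw [qForm_sub hq0] at h3 h4
    have hn : (1 - q) * (1 - q ^ d) ≠ 0 := mul_ne_zero
      (by simpa using sub_ne_zero.2 (hq 1 le_rfl (by omega)).symm)
      (sub_ne_zero.2 (hq d hd (by omega)).symm)
    have h5 : (θs 0 - θs 1) * (θ d - θ 0) = (q - 1) * (hs / q ^ r / q - hs * ss * (q ^ r * q)) *
        ((1 - q ^ d) * (h / q ^ t / q ^ d - h * s * (q ^ t * q))) := by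
      rw [h3, h4]
      simp only [pow_succ, pow_zero, one_mul, mul_one]
    have e : q ^ (d + 1) / q ^ 1 = q ^ d := by rw [pow_succ]; field_simp
    rw [e] at h1 h2
    simp only [Nat.sub_zero] at h2
    -- The difference, at n = 1, of what is subtracted from c and from c' in the two brackets.
    set G := h * s * (q ^ t * q) * (hs * ss * (q ^ r * q)) * (q / q)
      + h / q ^ t * (hs / q ^ r) / (q * q ^ d)
      - h / q ^ t / q ^ d * (hs * ss * (q ^ r * q)) * (q / q)
      - h * s * (q ^ t * q) * q ^ d * (hs / q ^ r) / (q * q ^ d) with hG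
    simp only [pow_zero, pow_succ, one_mul] at h1 h2
    have key : (1 - q) * (1 - q ^ d) * (c - c') - (1 - q) * (1 - q ^ d) * G
        = (θs 0 - θs 1) * (θ d - θ 0) := by
      rw [hG]
      linear_combination h1 - h2
    have hG' : (q - 1) * (hs / q ^ r / q - hs * ss * (q ^ r * q)) *
        ((1 - q ^ d) * (h / q ^ t / q ^ d - h * s * (q ^ t * q)))
        = -((1 - q) * (1 - q ^ d) * G) := by
      rw [hG]
      field_simp
      ring
    refine mul_left_cancel₀ hn ?_
    linear_combination key + h5 + hG'
  subst hcc
  refine ⟨c / (h * hs), fun i _ hi => ?_, fun i _ hi => ?_⟩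
  · rw [hc i (by omega), tauFirst_eq hq0]
    simp only [pow_succ]
    field_simp
  · rw [hc' i (by omega), tauSecond_eq hq0]
    simp only [pow_succ]
    field_simp

/-! ### Duality and intersection numbers of `q`-Racah systems -/

namespace QRacahSystem

/-- The generator of E_0V is the last split vector of the eigenvalue-reversed system. The second
split basis read backwards is then a split basis of the dual system, which gives φ'_{d+1-i}. The
first split sequence is self-dual. -/
theorem exists_dual (S : QRacahSystem q h hs s ss r t d A B E F θ θs τ u φ φ') :
    ∃ v ψ ψ', QRacahSystem q hs h ss s t r d B A F E θs θ τ v ψ ψ' := by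
  have L := S.leonard
  have hv := L.reverse.splitVec_last (u := u)
  simp only [Nat.sub_self] at hv
  have hv0 := L.reverse.splitVec_ne_zero S.apply_u S.u_ne_zero le_rfl
  obtain ⟨ψ, hψ⟩ := L.dual.exists_splitSeq hv hv0
  refine ⟨_, ψ, fun i => φ' (d + 1 - i), L.dual, S.pos, S.q_ne_zero,
    ⟨S.ne_zero.2.1, S.ne_zero.1, S.ne_zero.2.2.2, S.ne_zero.2.2.1⟩, S.dualEigenvalue,
    S.eigenvalue, hv, hv0, hψ, ?_, fun i hi1 hi => ?_, fun i hi1 hi => ?_⟩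
  · refine IsSplitSeq.congr (L.reverse.splitSeq_reverse S.second) fun i hi => ?_
    rw [Nat.sub_sub_self hi]
  · obtain ⟨n, rfl⟩ : ∃ n, i = n + 1 := ⟨i - 1, by omega⟩
    rw [L.dual_splitSeq S.apply_u S.u_ne_zero S.first hv hv0 hψ hi, S.first_eq _ hi1 hi,
      tauFirst_swap]
  · rw [S.second_eq _ (by omega) (by omega)]
    have := tauSecond_swap (q := q) (h := h) (hs := hs) (s := s) (ss := ss) (τ := τ) (r := r)
      (t := t) (d := d) (i := d - i) (by omega)
    rw [Nat.sub_sub_self hi, show d - i + 1 = d + 1 - i by omega] at this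
    exact this.symm

theorem first_ne_zero (S : QRacahSystem q h hs s ss r t d A B E F θ θs τ u φ φ') {i : ℕ}
    (hi1 : 1 ≤ i) (hi : i ≤ d) : φ i ≠ 0 := by
  obtain ⟨n, rfl⟩ : ∃ n, i = n + 1 := ⟨i - 1, by omega⟩
  exact S.leonard.splitSeq_ne_zero S.apply_u S.u_ne_zero S.first hi

theorem one_sub_pow_ne_zero (S : QRacahSystem q h hs s ss r t d A B E F θ θs τ u φ φ') {i : ℕ}
    (hi1 : 1 ≤ i) (hi : i ≤ d) : 1 - q ^ i ≠ 0 := by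
  obtain ⟨α₀, hθ⟩ := S.eigenvalue
  exact S.leonard.one_sub_pow_ne_zero S.q_ne_zero hθ hi1 hi

/-- Each k in this range is 2r+1+a+b with distinct a, b in 0, …, d, and 1 - s*q^k is then a factor
of the nonzero number θ*_a - θ*_b. -/
theorem one_sub_ss_mul_pow_ne_zero (S : QRacahSystem q h hs s ss r t d A B E F θ θs τ u φ φ')
    {k : ℕ} (hk1 : 2 * r + 2 ≤ k) (hk : k ≤ 2 * r + 2 * d) : 1 - ss * q ^ k ≠ 0 := by
  obtain ⟨γ₀, hθs⟩ := S.dualEigenvalue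
  obtain ⟨a, b, ha, hb, hab, rfl⟩ : ∃ a b, a ≤ d ∧ b ≤ d ∧ a ≠ b ∧ k = 2 * r + 1 + (a + b) := by
    by_cases h : k - (2 * r + 1) ≤ d
    · exact ⟨k - (2 * r + 1), 0, h, by omega, by omega, by omega⟩
    · exact ⟨d, k - (2 * r + 1) - d, le_rfl, by omega, by omega, by omega⟩
  intro h0
  have hq0 := S.q_ne_zero
  refine (S.leonard.dual.qForm_ne hq0 hθs ha hb hab).2 ?_
  have e : hs / q ^ r / (q ^ a * q ^ b) - hs * ss * q ^ (r + 1)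
      = hs / (q ^ r * q ^ a * q ^ b) * (1 - ss * q ^ (2 * r + 1 + (a + b))) := by
    simp only [pow_add, pow_mul', pow_one]
    field_simp
  rw [e, h0, mul_zero]

theorem formulas (S : QRacahSystem q h hs s ss r t d A B E F θ θs τ u φ φ') {ρ₁ ρ₂ : ℂ}
    (hsum : ρ₁ + ρ₂ = τ * q ^ (r + t + d))
    (hprod : ρ₁ * ρ₂ = s * ss * q ^ (2 * r + 2 * t + d + 1))
    {v : V} (hv : E 0 v = v) {β : Module.Basis (Fin (d + 1)) ℂ V}
    (hβ : ∀ i : Fin (d + 1), β i = F i v) :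
    QRacahFormulas q h ss ρ₁ ρ₂ (θ 0) r t d (LeonardSystem.aSeq A F) (bSeq A β) (cSeq A β) := by
  have L := S.leonard
  have hq0 := S.q_ne_zero
  obtain ⟨hh, hhs, hs0, hss⟩ := S.ne_zero
  have hd := S.pos
  have hu := S.apply_u
  have hu0 := S.u_ne_zero
  have hden : ∀ k, 2 * r + 2 ≤ k → k ≤ 2 * r + 2 * d → 1 - ss * q ^ k ≠ 0 :=
    fun k => S.one_sub_ss_mul_pow_ne_zero
  have hpow : ∀ k, 1 ≤ k → k ≤ d → 1 - q ^ k ≠ 0 := fun k => S.one_sub_pow_ne_zero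
  have hp : ∀ n, q ^ n ≠ 0 := fun n => pow_ne_zero n hq0
  obtain ⟨α₀, hθ⟩ := S.eigenvalue
  obtain ⟨γ₀, hθs⟩ := S.dualEigenvalue
  have hfac : ∀ i k, hs / q ^ r / q ^ i - hs * ss * q ^ (r + 1) * q ^ k
      = hs / (q ^ r * q ^ i) * (1 - ss * q ^ (2 * r + i + k + 1)) := by
    intro i k
    simp only [pow_add, pow_mul', pow_one]
    field_simp
  -- In φ' - φ the scalar τ cancels and the remaining four terms factor.
  have hdiff : ∀ i, 1 ≤ i → i ≤ d → φ' i - φ i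
      = -((1 - q ^ i) * (1 - q ^ (d + 1) / q ^ i) * (h * s * q ^ (t + 1) - h / q ^ t / q ^ d) *
        (hs / q ^ r / q ^ i - hs * ss * q ^ (r + 1) * (q ^ i / q))) := by
    intro i hi1 hi
    rw [S.first_eq i hi1 hi, S.second_eq i hi1 hi, tauFirst_eq hq0, tauSecond_eq hq0]
    simp only [pow_succ]
    field_simp
    ring
  have hφ : ∀ i, 1 ≤ i → i ≤ d → φ i = -(h * hs * (1 - q ^ i) * (1 - q ^ (d + 1) / q ^ i) *
      ((1 - ρ₁ * q ^ i) * (1 - ρ₂ * q ^ i)) / (q ^ r * q ^ t * q ^ i * q ^ d)) := by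
    intro i hi1 hi
    rw [S.first_eq i hi1 hi, tauFirst_eq_rootFirst hq0 hsum hprod, rootFirst_eq hq0]
  have hφ' : ∀ i, 1 ≤ i → i ≤ d → φ' i = -(h * hs * (1 - q ^ i) * (1 - q ^ (d + 1) / q ^ i) *
      ((ρ₁ - ss * q ^ (2 * r + i)) * (ρ₂ - ss * q ^ (2 * r + i))) /
      (ss * q ^ (3 * r) * q ^ t * q ^ i * q ^ d)) := by
    intro i hi1 hi
    rw [S.second_eq i hi1 hi, tauSecond_eq_rootSecond hq0 hss hsum hprod, rootSecond_eq hq0 hss]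
  have hzneg : ∀ n : ℕ, q ^ (-(n : ℤ)) = (q ^ n)⁻¹ := fun n => by
    rw [_root_.zpow_neg, zpow_natCast]
  have hzsub : ∀ i : ℕ, q ^ ((i : ℤ) - d) = q ^ i / q ^ d := fun i => by
    rw [zpow_sub₀ hq0, zpow_natCast, zpow_natCast]
  refine ⟨⟨hq0, hss, hden⟩, ?_, fun i hi1 hi => ?_, fun i hi1 hi => ?_, ?_, fun i hi => ?_⟩
  · rw [L.bSeq_zero_closed hd hu hu0 S.first hβ hv hq0 hθs, hφ 1 le_rfl hd, hzneg, hzneg]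
    have e := hfac 1 0
    rw [pow_zero, mul_one, pow_one] at e
    rw [e]
    have h1 := hden (2 * r + 2) le_rfl (by omega)
    have h2 := hpow 1 le_rfl hd
    rw [pow_one] at h2
    rw [show 2 * r + 1 + 0 + 1 = 2 * r + 2 by ring]
    have e1 : 1 - q ^ (d + 1) / q ^ 1 = 1 - q ^ d := by rw [pow_succ]; field_simp
    rw [e1, pow_one]
    generalize 1 - ss * q ^ (2 * r + 2) = D at *
    generalize 1 - q = D2 at *
    field_simp
    ring
  · rw [L.bSeq_closed hu hu0 S.first hβ hv hq0 hθs hi1 (by omega), hφ (i + 1) (by omega) (by omega),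
      hzneg, hzsub, hfac, hfac]
    have e := hfac i 0
    rw [pow_zero, mul_one] at e
    rw [e, show 2 * r + i + i + 1 = 2 * r + 2 * i + 1 by ring,
      show 2 * r + i + (i + 1) + 1 = 2 * r + 2 * i + 2 by ring,
      show 2 * r + i + 0 + 1 = 2 * r + i + 1 by ring]
    have h1 := hden (2 * r + 2 * i + 1) (by omega) (by omega)
    have h2 := hden (2 * r + 2 * i + 2) (by omega) (by omega)
    have h3 := hpow (i + 1) (by omega) (by omega)
    have e1 : 1 - q ^ (d + 1) / q ^ (i + 1) = 1 - q ^ d / q ^ i := by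
      rw [pow_succ, pow_succ]
      field_simp
    rw [e1]
    generalize 1 - ss * q ^ (2 * r + 2 * i + 1) = D1 at *
    generalize 1 - ss * q ^ (2 * r + 2 * i + 2) = D2 at *
    generalize 1 - ss * q ^ (2 * r + i + 1) = D4 at *
    generalize 1 - q ^ (i + 1) = D3 at *
    generalize 1 - ρ₁ * q ^ (i + 1) = D5 at *
    generalize 1 - ρ₂ * q ^ (i + 1) = D6 at *
    field_simp
    ring
  · rw [L.cSeq_closed hu hu0 S.first S.second hβ hv hq0 hθ hθs hdiff hi1 (by omega),
      hφ' i hi1 (by omega), hzneg, hfac, hfac]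
    have e : q ^ i / q = q ^ (i - 1) := by
      rw [div_eq_iff hq0, ← pow_succ, Nat.sub_add_cancel hi1]
    rw [e, hfac, show 2 * r + i + (i - 1) + 1 = 2 * r + 2 * i by omega,
      show 2 * r + i + i + 1 = 2 * r + 2 * i + 1 by ring]
    have h1 := hden (2 * r + 2 * i + 1) (by omega) (by omega)
    have h2 := hden (2 * r + 2 * i) (by omega) (by omega)
    have h3 : 1 - q ^ (d + 1) / q ^ i ≠ 0 := by
      have e : q ^ (d + 1) / q ^ i = q ^ (d + 1 - i) := by
        rw [div_eq_iff (hp i), ← pow_add, Nat.sub_add_cancel (by omega)]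
      rw [e]
      exact hpow _ (by omega) (by omega)
    have e3 : q ^ (3 * r) = q ^ (2 * r) * q ^ r := by rw [← pow_add]; congr 1; ring
    rw [e3, pow_add q (2 * r) d]
    generalize 1 - ss * q ^ (2 * r + 2 * i + 1) = D1 at *
    generalize 1 - ss * q ^ (2 * r + 2 * i) = D2 at *
    generalize 1 - ss * q ^ (2 * r + i + d + 1) = D4 at *
    generalize 1 - q ^ (d + 1) / q ^ i = D3 at *
    generalize ρ₁ - ss * q ^ (2 * r + i) = D5 at *
    generalize ρ₂ - ss * q ^ (2 * r + i) = D6 at *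
    have hr2 := hp (2 * r)
    generalize q ^ (2 * r) = R2 at *
    field_simp
  · have hc := L.cSeq_last_closed hd hu hu0 S.first S.second hβ hv hq0 hθ hdiff
    have e : q ^ d / q = q ^ (d - 1) := by
      rw [div_eq_iff hq0, ← pow_succ, Nat.sub_add_cancel hd]
    rw [e, hfac, hφ' d hd le_rfl, show 2 * r + d + (d - 1) + 1 = 2 * r + 2 * d by omega] at hc
    have h2 := hden (2 * r + 2 * d) (by omega) (by omega)
    have h3 := hpow 1 le_rfl hd
    rw [pow_one] at h3
    have e1 : 1 - q ^ (d + 1) / q ^ d = 1 - q := by rw [pow_succ]; field_simp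
    have e3 : q ^ (3 * r) = q ^ (2 * r) * q ^ r := by rw [← pow_add]; congr 1; ring
    rw [e1, e3] at hc
    rw [hzneg, pow_add q (2 * r) d]
    have hr2 := hp (2 * r)
    rw [pow_add q (2 * r) d] at hc
    generalize 1 - ss * q ^ (2 * r + 2 * d) = D2 at *
    generalize ρ₁ - ss * (q ^ (2 * r) * q ^ d) = D5 at *
    generalize ρ₂ - ss * (q ^ (2 * r) * q ^ d) = D6 at *
    generalize q ^ (2 * r) = R2 at *
    generalize 1 - q = D1 at *
    field_simp at hc ⊢
    linear_combination hc
  · linear_combination L.aSeq_add hβ hv hi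

end QRacahSystem

end

end

section

section

variable {V : Type*} [AddCommGroup V] [Module ℂ V]
  {q h hs s ss : ℂ} {r t d : ℕ} {A B : Module.End ℂ V}
  {E F : ℕ → Module.End ℂ V} {θ θs : ℕ → ℂ} {τ : ℂ} {u : V} {φ φ' : ℕ → ℂ}

/-! ### The `₄φ₃` series -/

theorem qPoch_zpow_neg_eq_zero {q : ℂ} (hq0 : q ≠ 0) {i n : ℕ} (h : i < n) :
    qPoch (q ^ (-(i : ℤ))) q n = 0 := by
  refine Finset.prod_eq_zero (Finset.mem_range.2 h) ?_
  rw [_root_.zpow_neg, zpow_natCast, inv_mul_cancel₀ (pow_ne_zero _ hq0), sub_self]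

theorem phi43Num_eq_zero {q : ℂ} (hq0 : q ≠ 0) {i j n : ℕ} (hn : min i j < n) (a b : ℂ) :
    phi43Num (q ^ (-(i : ℤ))) a (q ^ (-(j : ℤ))) b q n = 0 := by
  rw [phi43Num]
  rcases min_lt_iff.1 hn with h | h <;> rw [qPoch_zpow_neg_eq_zero hq0 h] <;> simp

namespace QRacahSystem

/-- Up to a power of q and a sign, all four numbers are factors of φ_{k+1}, which is nonzero. -/
theorem root_factors_ne_zero (S : QRacahSystem q h hs s ss r t d A B E F θ θs τ u φ φ')
    {ρ₁ ρ₂ : ℂ} (hsum : ρ₁ + ρ₂ = τ * q ^ (r + t + d))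
    (hprod : ρ₁ * ρ₂ = s * ss * q ^ (2 * r + 2 * t + d + 1)) {k : ℕ} (hk : k < d) :
    1 - q * q ^ k ≠ 0 ∧ 1 - ρ₁ * q * q ^ k ≠ 0 ∧ 1 - ρ₂ * q * q ^ k ≠ 0 ∧
      1 - q ^ (-(d : ℤ)) * q ^ k ≠ 0 := by
  have h0 := S.first_ne_zero (i := k + 1) (by omega) hk
  have hq0 := S.q_ne_zero
  have hp : ∀ n, q ^ n ≠ 0 := fun n => pow_ne_zero n hq0
  rw [S.first_eq _ (by omega) hk, tauFirst_eq_rootFirst hq0 hsum hprod, rootFirst_eq hq0] at h0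
  have e4 : 1 - q ^ (-(d : ℤ)) * q ^ k = -(q ^ k / q ^ d) * (1 - q ^ (d + 1) / q ^ (k + 1)) := by
    have := hp k
    have := hp d
    rw [_root_.zpow_neg, zpow_natCast, pow_succ, pow_succ]
    field_simp
    ring
  refine ⟨fun h => h0 ?_, fun h => h0 ?_, fun h => h0 ?_, fun h => h0 ?_⟩
  · rw [← pow_succ'] at h
    rw [h]
    simp
  · rw [mul_assoc, ← pow_succ'] at h
    rw [h]
    simp
  · rw [mul_assoc, ← pow_succ'] at h
    rw [h]
    simp
  · rw [e4] at h
    rw [(mul_eq_zero.1 h).resolve_left (neg_ne_zero.2 (div_ne_zero (hp k) (hp d)))]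
    simp

theorem phi43Den_ne_zero (S : QRacahSystem q h hs s ss r t d A B E F θ θs τ u φ φ')
    {ρ₁ ρ₂ : ℂ} (hsum : ρ₁ + ρ₂ = τ * q ^ (r + t + d))
    (hprod : ρ₁ * ρ₂ = s * ss * q ^ (2 * r + 2 * t + d + 1)) {n : ℕ} (hn : n ≤ d) :
    phi43Den (ρ₁ * q) (ρ₂ * q) (q ^ (-(d : ℤ))) q n ≠ 0 := by
  have key : ∀ k ∈ Finset.range n, 1 - q * q ^ k ≠ 0 ∧ 1 - ρ₁ * q * q ^ k ≠ 0 ∧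
      1 - ρ₂ * q * q ^ k ≠ 0 ∧ 1 - q ^ (-(d : ℤ)) * q ^ k ≠ 0 := fun k hk =>
    S.root_factors_ne_zero hsum hprod (by have := Finset.mem_range.1 hk; omega)
  refine mul_ne_zero (mul_ne_zero (mul_ne_zero ?_ ?_) ?_) ?_ <;>
    refine Finset.prod_ne_zero_iff.2 fun k hk => ?_
  · exact (key k hk).1
  · exact (key k hk).2.1
  · exact (key k hk).2.2.1
  · exact (key k hk).2.2.2

/-- The two sums agree term by term, and each term agrees factor by factor: (θ*_i - θ*_k)(θ_j -
θ_k)/φ_{k+1} is the k-th quotient of the q-shifted factorials times q, and this q is the argument of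
the series. -/
theorem awPoly_eval (S : QRacahSystem q h hs s ss r t d A B E F θ θs τ u φ φ')
    {ρ₁ ρ₂ : ℂ} (hsum : ρ₁ + ρ₂ = τ * q ^ (r + t + d))
    (hprod : ρ₁ * ρ₂ = s * ss * q ^ (2 * r + 2 * t + d + 1)) {i j : ℕ} (hi : i ≤ d) (hj : j ≤ d) :
    (awPoly θ θs φ d i).eval (θ j) = phi43 (q ^ (-(i : ℤ))) (ss * q ^ (2 * r + i + 1))
      (q ^ (-(j : ℤ))) (s * q ^ (2 * t + j + 1)) (ρ₁ * q) (ρ₂ * q) (q ^ (-(d : ℤ))) q q := by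
  have hq0 := S.q_ne_zero
  have hp : ∀ n, q ^ n ≠ 0 := fun n => pow_ne_zero n hq0
  obtain ⟨hh, hhs, -, -⟩ := S.ne_zero
  obtain ⟨α₀, hθ⟩ := S.eigenvalue
  obtain ⟨γ₀, hθs⟩ := S.dualEigenvalue
  rw [phi43, tsum_eq_sum (s := Finset.range (d + 1)), awPoly, eval_finsetSum]
  -- Terms of index n > d have numerator zero, since min(i, j) ≤ d.
  swap
  · intro n hn
    have hn' : ¬ n < d + 1 := fun h => hn (Finset.mem_range.2 h)
    rw [phi43Num_eq_zero hq0 (by omega), zero_div, zero_mul]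
  refine Finset.sum_congr rfl fun n hn => ?_
  have hn' : n ≤ d := by simpa [Nat.lt_succ_iff] using hn
  rw [eval_mul, eval_C, nodePoly_eval, nodePoly_eval, phi43Num, phi43Den]
  simp only [qPoch, ← Finset.prod_mul_distrib, ← Finset.prod_div_distrib]
  have hqn : q ^ n = ∏ _k ∈ Finset.range n, q := by simp
  rw [hqn, ← Finset.prod_mul_distrib]
  refine Finset.prod_congr rfl fun k hk => ?_
  have hk' : k < d := by
    have := Finset.mem_range.1 hk
    omega
  obtain ⟨n1, n2, n3, n4⟩ := S.root_factors_ne_zero hsum hprod hk'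
  have e1 : θs i - θs k = -(hs / (q ^ r * q ^ k)) * (1 - q ^ (-(i : ℤ)) * q ^ k) *
      (1 - ss * q ^ (2 * r + i + 1) * q ^ k) := by
    rw [hθs i hi, hθs k hk'.le, qForm_sub hq0, _root_.zpow_neg, zpow_natCast]
    simp only [pow_add, pow_mul', pow_one]
    have := hp i
    field_simp
    ring
  have e2 : θ j - θ k = -(h / (q ^ t * q ^ k)) * (1 - q ^ (-(j : ℤ)) * q ^ k) *
      (1 - s * q ^ (2 * t + j + 1) * q ^ k) := by
    rw [hθ j hj, hθ k hk'.le, qForm_sub hq0, _root_.zpow_neg, zpow_natCast]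
    simp only [pow_add, pow_mul', pow_one]
    have := hp j
    field_simp
    ring
  have e3 : φ (k + 1) = h * hs / (q ^ r * q ^ t * q ^ k * q ^ k * q) * (1 - q * q ^ k) *
      (1 - q ^ (-(d : ℤ)) * q ^ k) * (1 - ρ₁ * q * q ^ k) * (1 - ρ₂ * q * q ^ k) := by
    rw [S.first_eq _ (by omega) hk', tauFirst_eq_rootFirst hq0 hsum hprod, rootFirst_eq hq0,
      _root_.zpow_neg, zpow_natCast]
    simp only [pow_succ]
    field_simp
    ring
  rw [e1, e2, e3]
  generalize 1 - q * q ^ k = D1 at *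
  generalize 1 - ρ₁ * q * q ^ k = D2 at *
  generalize 1 - ρ₂ * q * q ^ k = D3 at *
  generalize 1 - q ^ (-(d : ℤ)) * q ^ k = D4 at *
  generalize 1 - q ^ (-(i : ℤ)) * q ^ k = D5 at *
  generalize 1 - q ^ (-(j : ℤ)) * q ^ k = D6 at *
  field_simp

end QRacahSystem

end

end

section

/-! ### Generation of the Bose-Mesner algebras -/

/-- In the expansion of B M_j the highest term M_{j+1} has a nonzero coefficient, so it can be
solved for. This serves both A with the A_j and A* with the dual distance matrices. -/
theorem mem_adjoin_of_recurrence {R : Type*} [Ring R] [Algebra ℂ R] {B : R} {M : ℕ → R}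
    {c : ℕ → ℕ → ℂ} {D : ℕ} (h0 : M 0 = 1)
    (hmul : ∀ j, j + 1 ≤ D → B * M j = ∑ h ∈ Finset.range (D + 1), c h j • M h)
    (hzero : ∀ h j, h ≤ D → j + 1 < h → c h j = 0) (hne : ∀ j, j + 1 ≤ D → c (j + 1) j ≠ 0) :
    ∀ j, j ≤ D → M j ∈ Algebra.adjoin ℂ {B} := by
  intro j
  induction j using Nat.strong_induction_on with
  | _ j ih =>
    intro hj
    cases j with
    | zero => rw [h0]; exact one_mem _
    | succ j =>
      have h1 := hmul j hj
      rw [← Finset.sum_erase_add _ _ (Finset.mem_range.2 (show j + 1 < D + 1 by omega)),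
        ← sub_eq_iff_eq_add'] at h1
      have h2 : M (j + 1) = (c (j + 1) j)⁻¹ •
          (B * M j - ∑ h ∈ (Finset.range (D + 1)).erase (j + 1), c h j • M h) := by
        rw [h1, smul_smul, inv_mul_cancel₀ (hne j hj), one_smul]
      rw [h2]
      refine Subalgebra.smul_mem _ (sub_mem (mul_mem (Algebra.self_mem_adjoin_singleton ℂ B)
        (ih j (by omega) (by omega))) (sum_mem fun h hh => ?_)) _
      obtain ⟨hhj, hhD⟩ := Finset.mem_erase.1 hh
      have hhD' := Finset.mem_range.1 hhD
      by_cases hlt : j + 1 < h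
      · rw [hzero h j (by omega) hlt, zero_smul]
        exact zero_mem _
      · exact Subalgebra.smul_mem _ (ih h (by omega) (by omega)) _

/-- Write F_i = g(B). It acts on F_k as the scalar g(θ_k), which is 1 for k = i and 0 for k = j ≠ i.
-/
theorem eigenvalue_injective {R : Type*} [Ring R] [Algebra ℂ R] {B : R} {F : ℕ → R}
    {θ : ℕ → ℂ} {D : ℕ} (hF : ∀ i j, i ≤ D → j ≤ D → F i * F j = if i = j then F i else 0)
    (hF0 : ∀ i, i ≤ D → F i ≠ 0) (hB : ∀ i, i ≤ D → B * F i = θ i • F i)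
    (hmem : ∀ i, i ≤ D → F i ∈ Algebra.adjoin ℂ {B}) {i j : ℕ} (hi : i ≤ D) (hj : j ≤ D)
    (h : θ i = θ j) : i = j := by
  by_contra hij
  have hm := hmem i hi
  rw [Algebra.adjoin_singleton_eq_range_aeval] at hm
  obtain ⟨g, hg⟩ := hm
  have key : ∀ k, k ≤ D → F i * F k = g.eval (θ k) • F k := by
    intro k hk
    rw [← hg]
    change aeval B g * F k = _
    clear hg
    induction g using Polynomial.induction_on' with
    | add p q hp hq => simp [add_mul, add_smul, hp, hq]
    | monomial n a =>
      have : ∀ n, B ^ n * F k = θ k ^ n • F k := by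
        intro n
        induction n with
        | zero => simp
        | succ n ih => rw [pow_succ, mul_assoc, hB k hk, mul_smul_comm, ih, smul_smul, pow_succ']
      simp [aeval_monomial, Algebra.algebraMap_eq_smul_one, this, smul_smul]
  have h1 := key i hi
  have h2 := key j hj
  rw [hF i i hi hi, if_pos rfl] at h1
  rw [hF i j hi hj, if_neg hij] at h2
  have hFj := (smul_eq_zero.1 h2.symm).resolve_right (hF0 j hj)
  rw [h, hFj, zero_smul] at h1
  exact hF0 i hi h1

theorem distMatrix_mem_boseMesner {X : Type*} {G : SimpleGraph X} {i : ℕ} (hi : i ≤ G.diam) :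
    distMatrix G i ∈ boseMesner G := Submodule.subset_span ⟨⟨i, by omega⟩, rfl⟩

theorem boseMesner_symm {X : Type*} {G : SimpleGraph X} {M : Matrix X X ℂ} (hM : M ∈ boseMesner G) :
    Mᵀ = M ∧ Mᴴ ∈ boseMesner G := by
  induction hM using Submodule.span_induction with
  | mem M h =>
    obtain ⟨i, rfl⟩ := h
    have h1 : (distMatrix G i)ᵀ = distMatrix G i := by
      ext y z
      simp [distMatrix, SimpleGraph.dist_comm]
    have h2 : (distMatrix G i)ᴴ = distMatrix G i := by
      ext y z
      simp [distMatrix, SimpleGraph.dist_comm, Matrix.conjTranspose_apply, apply_ite]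
    exact ⟨h1, by rw [h2]; exact Submodule.subset_span ⟨i, rfl⟩⟩
  | zero => simp
  | add M N _ _ hM hN =>
    exact ⟨by rw [Matrix.transpose_add, hM.1, hN.1],
      by rw [Matrix.conjTranspose_add]; exact add_mem hM.2 hN.2⟩
  | smul a M _ hM =>
    exact ⟨by rw [Matrix.transpose_smul, hM.1],
      by rw [Matrix.conjTranspose_smul]; exact Submodule.smul_mem _ _ hM.2⟩

variable {X : Type*} [Fintype X] [DecidableEq X]

/-- The data of a distance-regular graph with a `Q`-polynomial structure and a base vertex. -/
structure QPolynomialGraph (G : SimpleGraph X) (p : ℕ → ℕ → ℕ → ℕ) (E : ℕ → Matrix X X ℂ)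
    (kr : ℕ → ℕ → ℕ → ℂ) (θ : ℕ → ℂ) (x : X) (θs : ℕ → ℂ) : Prop where
  connected : G.Connected
  diam_pos : 1 ≤ G.diam
  intersection : IsIntersectionNumbers G p
  idempotents : IsPrimitiveIdempotents G E
  krein : IsKreinParameters G E kr
  qPolynomial : IsQPolynomial G kr
  eigenvalues : IsEigenvalues G E θ
  dualEigenvalues : IsDualEigenvalues G E x θs

/-- The `j`th dual distance matrix, whose `(y,y)` entry is `|X| (E_j)_{xy}`. -/
def dualDist (E : ℕ → Matrix X X ℂ) (x : X) (j : ℕ) : Matrix X X ℂ :=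
  Matrix.diagonal fun y => (Fintype.card X : ℂ) * E j x y

/-! ### The Bose-Mesner algebra: generation by A and its primitive idempotents -/

namespace QPolynomialGraph

variable {G : SimpleGraph X} {p : ℕ → ℕ → ℕ → ℕ} {E : ℕ → Matrix X X ℂ} {kr : ℕ → ℕ → ℕ → ℂ}
  {θ : ℕ → ℂ} {x : X} {θs : ℕ → ℂ}

theorem dist_le (Q : QPolynomialGraph G p E kr θ x θs) (y z : X) : G.dist y z ≤ G.diam :=
  SimpleGraph.dist_le_diam (SimpleGraph.ediam_ne_top_of_diam_ne_zero (by have := Q.diam_pos; omega))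

theorem exists_dist_pred (Q : QPolynomialGraph G p E kr θ x θs) {y z : X} {h : ℕ}
    (hyz : G.dist y z = h + 1) : ∃ w, G.dist y w = 1 ∧ G.dist w z = h := by
  obtain ⟨c, hc⟩ := Q.connected.exists_walk_length_eq_dist y z
  rw [hyz] at hc
  cases c with
  | nil => simp at hc
  | cons hadj c' =>
    rename_i w
    have h1 : c'.length = h := by simpa using hc
    have h2 : G.dist w z ≤ h := h1 ▸ SimpleGraph.dist_le c'
    have h3 := Q.connected.dist_triangle (u := y) (v := w) (w := z)
    have h4 := SimpleGraph.dist_eq_one_iff_adj.2 hadj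
    exact ⟨w, h4, by omega⟩

theorem exists_dist_eq (Q : QPolynomialGraph G p E kr θ x θs) :
    ∀ k h, h + k = G.diam → ∃ y z, G.dist y z = h := by
  intro k
  induction k with
  | zero =>
    intro h hh
    have : Nonempty X := ⟨x⟩
    obtain ⟨y, z, hyz⟩ := SimpleGraph.exists_dist_eq_diam (G := G)
    exact ⟨y, z, by omega⟩
  | succ k ih =>
    intro h hh
    obtain ⟨y, z, hyz⟩ := ih (h + 1) (by omega)
    obtain ⟨w, -, hw⟩ := Q.exists_dist_pred hyz
    exact ⟨w, z, hw⟩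

/-- Every vertex has p^0_{hh} vertices at distance h, and for some vertex this number is positive.
-/
theorem exists_dist_eq_base (Q : QPolynomialGraph G p E kr θ x θs) {h : ℕ} (hh : h ≤ G.diam) :
    ∃ y, G.dist x y = h := by
  obtain ⟨y, z, hyz⟩ := Q.exists_dist_eq (G.diam - h) h (by omega)
  have h1 := Q.intersection 0 h h (by omega) hh hh y y (by simp)
  have h2 := Q.intersection 0 h h (by omega) hh hh x x (by simp)
  rw [← h2] at h1
  have h3 : 0 < (Finset.univ.filter fun w => G.dist x w = h ∧ G.dist x w = h).card := by
    rw [← h1]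
    exact Finset.card_pos.2 ⟨z, by simp [hyz]⟩
  obtain ⟨w, hw⟩ := Finset.card_pos.1 h3
  exact ⟨w, by simpa using hw⟩

theorem distMatrix_zero (Q : QPolynomialGraph G p E kr θ x θs) : distMatrix G 0 = 1 := by
  ext y z
  simp [distMatrix, Q.connected.dist_eq_zero_iff, Matrix.one_apply]

theorem distMatrix_mul (Q : QPolynomialGraph G p E kr θ x θs) {j : ℕ} (hj : j ≤ G.diam) :
    distMatrix G 1 * distMatrix G j
      = ∑ h ∈ Finset.range (G.diam + 1), (p h 1 j : ℂ) • distMatrix G h := by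
  ext y z
  have h1 := Q.intersection (G.dist y z) 1 j (Q.dist_le y z) Q.diam_pos hj y z rfl
  rw [Matrix.sum_apply, Finset.sum_eq_single (G.dist y z)]
  · simp only [distMatrix, Matrix.mul_apply, Matrix.of_apply, Matrix.smul_apply, if_true, smul_eq_mul,
      mul_one, ← h1, Finset.card_filter, Nat.cast_sum]
    refine Finset.sum_congr rfl fun w _ => ?_
    rw [SimpleGraph.dist_comm (u := w)]
    by_cases ha : G.dist y w = 1 <;> by_cases hb : G.dist z w = j <;> simp [ha, hb]
  · intro h _ hh
    simp [distMatrix, hh.symm]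
  · intro hh
    exact absurd (Finset.mem_range.2 (by have := Q.dist_le y z; omega)) hh

theorem p_eq_zero (Q : QPolynomialGraph G p E kr θ x θs) {h j : ℕ} (hh : h ≤ G.diam)
    (hlt : j + 1 < h) : p h 1 j = 0 := by
  obtain ⟨y, z, hyz⟩ := Q.exists_dist_eq (G.diam - h) h (by omega)
  rw [← Q.intersection h 1 j hh Q.diam_pos (by omega) y z hyz, Finset.card_eq_zero,
    Finset.filter_eq_empty_iff]
  rintro w - ⟨h1, h2⟩
  have := Q.connected.dist_triangle (u := y) (v := w) (w := z)
  rw [SimpleGraph.dist_comm (u := w)] at this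
  omega

theorem p_ne_zero (Q : QPolynomialGraph G p E kr θ x θs) {j : ℕ} (hj : j + 1 ≤ G.diam) :
    p (j + 1) 1 j ≠ 0 := by
  obtain ⟨y, z, hyz⟩ := Q.exists_dist_eq (G.diam - (j + 1)) (j + 1) (by omega)
  obtain ⟨w, h1, h2⟩ := Q.exists_dist_pred hyz
  rw [← Q.intersection (j + 1) 1 j hj Q.diam_pos (by omega) y z hyz]
  refine (Finset.card_pos.2 ⟨w, ?_⟩).ne'
  simp [h1, SimpleGraph.dist_comm (u := z), h2]

theorem distMatrix_mem (Q : QPolynomialGraph G p E kr θ x θs) {j : ℕ} (hj : j ≤ G.diam) :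
    distMatrix G j ∈ Algebra.adjoin ℂ {distMatrix G 1} :=
  mem_adjoin_of_recurrence (c := fun h j => (p h 1 j : ℂ)) Q.distMatrix_zero
    (fun _ hj => Q.distMatrix_mul (by omega))
    (fun _ _ hh hlt => by rw [Q.p_eq_zero hh hlt, Nat.cast_zero])
    (fun _ hj => Nat.cast_ne_zero.2 (Q.p_ne_zero hj)) j hj

theorem boseMesner_le (Q : QPolynomialGraph G p E kr θ x θs) :
    boseMesner G ≤ Subalgebra.toSubmodule (Algebra.adjoin ℂ {distMatrix G 1}) := by
  refine Submodule.span_le.2 ?_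
  rintro _ ⟨i, rfl⟩
  exact Q.distMatrix_mem (by omega)

theorem E_mem_boseMesner (Q : QPolynomialGraph G p E kr θ x θs) {i : ℕ} (hi : i ≤ G.diam) :
    E i ∈ boseMesner G := by
  rw [← Q.idempotents.span_eq]
  exact Submodule.subset_span ⟨⟨i, by omega⟩, rfl⟩

theorem E_ne_zero (Q : QPolynomialGraph G p E kr θ x θs) {i : ℕ} (hi : i ≤ G.diam) : E i ≠ 0 :=
  Q.idempotents.linearIndependent.ne_zero (⟨i, by omega⟩ : Fin (G.diam + 1))

theorem A_mul_E (Q : QPolynomialGraph G p E kr θ x θs) {i : ℕ} (hi : i ≤ G.diam) :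
    distMatrix G 1 * E i = θ i • E i := by
  rw [Q.eigenvalues, Finset.sum_mul, Finset.sum_eq_single i]
  · rw [smul_mul_assoc, Q.idempotents.mul i i hi hi, if_pos rfl]
  · intro j hj hji
    rw [smul_mul_assoc, Q.idempotents.mul j i (by simpa [Nat.lt_succ_iff] using hj) hi, if_neg hji,
      smul_zero]
  · simp; omega

theorem θ_injective (Q : QPolynomialGraph G p E kr θ x θs) {i j : ℕ} (hi : i ≤ G.diam)
    (hj : j ≤ G.diam) (h : θ i = θ j) : i = j :=
  eigenvalue_injective Q.idempotents.mul (fun _ => Q.E_ne_zero) (fun _ => Q.A_mul_E)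
    (fun _ hi => Q.boseMesner_le (Q.E_mem_boseMesner hi)) hi hj h

theorem E_transpose (Q : QPolynomialGraph G p E kr θ x θs) {i : ℕ} (hi : i ≤ G.diam) :
    (E i)ᵀ = E i := (boseMesner_symm (Q.E_mem_boseMesner hi)).1

theorem E_apply_comm (Q : QPolynomialGraph G p E kr θ x θs) {i : ℕ} (hi : i ≤ G.diam) (y z : X) :
    E i y z = E i z y := congrFun (congrFun (Q.E_transpose hi) z) y

theorem mul_E_of_mem (Q : QPolynomialGraph G p E kr θ x θs) {M : Matrix X X ℂ}
    (hM : M ∈ boseMesner G) : ∃ c : ℕ → ℂ, ∀ i, i ≤ G.diam → M * E i = c i • E i ∧ E i * M = c i • E i := by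
  rw [← Q.idempotents.span_eq] at hM
  induction hM using Submodule.span_induction with
  | mem M h =>
    obtain ⟨k, rfl⟩ := h
    refine ⟨fun i => if i = k then 1 else 0, fun i hi => ?_⟩
    simp only
    rw [Q.idempotents.mul _ _ (by omega) hi, Q.idempotents.mul _ _ hi (by omega)]
    by_cases h : i = k
    · simp [h]
    · simp [h, Ne.symm h]
  | zero => exact ⟨0, by simp⟩
  | add M N _ _ hM hN =>
    obtain ⟨a, ha⟩ := hM
    obtain ⟨b, hb⟩ := hN
    exact ⟨a + b, fun i hi => by
      rw [add_mul, mul_add, (ha i hi).1, (ha i hi).2, (hb i hi).1, (hb i hi).2, Pi.add_apply,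
        add_smul]
      exact ⟨rfl, rfl⟩⟩
  | smul s M _ hM =>
    obtain ⟨a, ha⟩ := hM
    exact ⟨s • a, fun i hi => by
      rw [smul_mul_assoc, mul_smul_comm, (ha i hi).1, (ha i hi).2, Pi.smul_apply, smul_smul,
        smul_eq_mul]
      exact ⟨rfl, rfl⟩⟩

open scoped ComplexOrder in
-- The conjugate transpose of E_i lies in the Bose-Mesner algebra, so E_i E_iᴴ = cE_i. It is nonzero
-- and E_iᴴ is idempotent, so c = 1; then E_i = E_i E_iᴴ is Hermitian.
theorem E_conjTranspose (Q : QPolynomialGraph G p E kr θ x θs) {i : ℕ} (hi : i ≤ G.diam) :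
    (E i)ᴴ = E i := by
  obtain ⟨c, hc⟩ := Q.mul_E_of_mem (boseMesner_symm (Q.E_mem_boseMesner hi)).2
  obtain ⟨h1, h2⟩ := hc i hi
  have hne : E i * (E i)ᴴ ≠ 0 := fun h => Q.E_ne_zero hi (Matrix.self_mul_conjTranspose_eq_zero.1 h)
  have hself : (E i)ᴴ * (E i)ᴴ = (E i)ᴴ := by
    rw [← Matrix.conjTranspose_mul, Q.idempotents.mul i i hi hi, if_pos rfl]
  have hcc : c i = 1 := by
    have h3 : c i • E i * (E i)ᴴ = c i • E i := by rw [← h2, mul_assoc, hself]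
    rw [smul_mul_assoc, h2, smul_smul, ← sub_eq_zero, ← sub_smul] at h3
    have h4 := (smul_eq_zero.1 h3).resolve_right (Q.E_ne_zero hi)
    have h5 : c i ≠ 0 := fun h => hne (by rw [h2, h, zero_smul])
    have h6 : c i * (c i - 1) = 0 := by linear_combination h4
    exact sub_eq_zero.1 ((mul_eq_zero.1 h6).resolve_left h5)
  rw [hcc, one_smul] at h2
  rw [← h2, Matrix.conjTranspose_mul, Matrix.conjTranspose_conjTranspose]

/-! ### The dual side -/

theorem dualDist_zero (Q : QPolynomialGraph G p E kr θ x θs) : dualDist E x 0 = 1 := by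
  have : (Fintype.card X : ℂ) ≠ 0 := by
    have : Nonempty X := ⟨x⟩
    exact Nat.cast_ne_zero.2 Fintype.card_ne_zero
  rw [dualDist, Q.idempotents.zero, ← Matrix.diagonal_one]
  congr 1
  ext y
  simp [this]

theorem card_smul_hadamard (Q : QPolynomialGraph G p E kr θ x θs) {i j : ℕ} (hi : i ≤ G.diam)
    (hj : j ≤ G.diam) (y z : X) : (Fintype.card X : ℂ) * (E i y z * E j y z)
      = ∑ h ∈ Finset.range (G.diam + 1), kr h i j * E h y z := by
  have hX : (Fintype.card X : ℂ) ≠ 0 := by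
    have : Nonempty X := ⟨x⟩
    exact Nat.cast_ne_zero.2 Fintype.card_ne_zero
  have h := congrFun (congrFun (Q.krein i j hi hj) y) z
  rw [Matrix.hadamard_apply, Matrix.smul_apply, Matrix.sum_apply] at h
  rw [h, smul_eq_mul, ← mul_assoc, mul_inv_cancel₀ hX, one_mul]
  rfl

theorem dualDist_mul (Q : QPolynomialGraph G p E kr θ x θs) {j : ℕ} (hj : j ≤ G.diam) :
    dualAdj E x * dualDist E x j
      = ∑ h ∈ Finset.range (G.diam + 1), kr h 1 j • dualDist E x h := by
  rw [dualAdj, dualDist, Matrix.diagonal_mul_diagonal]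
  ext y z
  rw [Matrix.sum_apply]
  by_cases hyz : y = z
  · subst hyz
    simp only [Matrix.diagonal_apply_eq, Matrix.smul_apply, dualDist, smul_eq_mul]
    have := Q.card_smul_hadamard Q.diam_pos hj x y
    calc _ = (Fintype.card X : ℂ) * ((Fintype.card X : ℂ) * (E 1 x y * E j x y)) := by ring
      _ = _ := by
        rw [this, Finset.mul_sum]
        exact Finset.sum_congr rfl fun h _ => by ring
  · simp [hyz, dualDist]

theorem dualDist_mem (Q : QPolynomialGraph G p E kr θ x θs) {j : ℕ} (hj : j ≤ G.diam) :
    dualDist E x j ∈ Algebra.adjoin ℂ {dualAdj E x} :=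
  mem_adjoin_of_recurrence (c := fun h j => kr h 1 j) Q.dualDist_zero
    (fun _ hj => Q.dualDist_mul (by omega))
    (fun h j hh hlt => Q.qPolynomial.eq_zero h 1 j hh Q.diam_pos (by omega) (by omega))
    (fun j hj => Q.qPolynomial.ne_zero (j + 1) 1 j hj Q.diam_pos (by omega) (by omega)) j hj

/-- The linear map sending M to the diagonal matrix of its row x takes A_i to E*_i and E_j to a
multiple of the j-th dual distance matrix. The latter are polynomials in A*, and the E_j span the
Bose-Mesner algebra. -/
theorem dualIdem_mem (Q : QPolynomialGraph G p E kr θ x θs) {i : ℕ} (hi : i ≤ G.diam) :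
    dualIdem G x i ∈ Algebra.adjoin ℂ {dualAdj E x} := by
  have hX : (Fintype.card X : ℂ) ≠ 0 := by
    have : Nonempty X := ⟨x⟩
    exact Nat.cast_ne_zero.2 Fintype.card_ne_zero
  have key : ∀ M ∈ boseMesner G, Matrix.diagonal (fun y => M x y) ∈ Algebra.adjoin ℂ {dualAdj E x} := by
    intro M hM
    rw [← Q.idempotents.span_eq] at hM
    induction hM using Submodule.span_induction with
    | mem M h =>
      obtain ⟨k, rfl⟩ := h
      have : Matrix.diagonal (fun y => E k x y) = (Fintype.card X : ℂ)⁻¹ • dualDist E x k := by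
        rw [dualDist, ← Matrix.diagonal_smul]
        congr 1
        ext y
        simp [hX]
      rw [this]
      exact Subalgebra.smul_mem _ (Q.dualDist_mem (by omega)) _
    | zero => simp
    | add M N _ _ hM hN =>
      have : Matrix.diagonal (fun y => (M + N) x y)
          = Matrix.diagonal (fun y => M x y) + Matrix.diagonal (fun y => N x y) := by
        rw [Matrix.diagonal_add]
        rfl
      rw [this]
      exact add_mem hM hN
    | smul a M _ hM =>
      have : Matrix.diagonal (fun y => (a • M) x y) = a • Matrix.diagonal (fun y => M x y) := by
        rw [← Matrix.diagonal_smul]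
        rfl
      rw [this]
      exact Subalgebra.smul_mem _ hM _
  exact key _ (distMatrix_mem_boseMesner hi)

theorem dualIdem_mul (i j : ℕ) :
    dualIdem G x i * dualIdem G x j = if i = j then dualIdem G x i else 0 := by
  rw [dualIdem, dualIdem, Matrix.diagonal_mul_diagonal]
  split_ifs with h
  · subst h
    simp
  · rw [← Matrix.diagonal_zero]
    congr 1
    ext y
    by_cases h1 : G.dist x y = i
    · simp [h1, h]
    · simp [h1]

theorem dualIdem_sum (Q : QPolynomialGraph G p E kr θ x θs) :
    ∑ i ∈ Finset.range (G.diam + 1), dualIdem G x i = 1 := by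
  ext y z
  rw [Matrix.sum_apply]
  by_cases hyz : y = z
  · subst hyz
    have := Q.dist_le x y
    simp [dualIdem]
    omega
  · simp [dualIdem, hyz]

theorem dualIdem_ne_zero (Q : QPolynomialGraph G p E kr θ x θs) {i : ℕ} (hi : i ≤ G.diam) :
    dualIdem G x i ≠ 0 := by
  obtain ⟨y, hy⟩ := Q.exists_dist_eq_base hi
  intro h
  have := congrFun (congrFun h y) y
  simp [dualIdem, hy] at this

theorem dualAdj_mul (Q : QPolynomialGraph G p E kr θ x θs) {i : ℕ} (hi : i ≤ G.diam) :
    dualAdj E x * dualIdem G x i = θs i • dualIdem G x i := by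
  rw [Q.dualEigenvalues, Finset.sum_mul, Finset.sum_eq_single i]
  · rw [smul_mul_assoc, dualIdem_mul, if_pos rfl]
  · intro j _ hji
    rw [smul_mul_assoc, dualIdem_mul, if_neg hji, smul_zero]
  · simp; omega

theorem θs_injective (Q : QPolynomialGraph G p E kr θ x θs) {i j : ℕ} (hi : i ≤ G.diam)
    (hj : j ≤ G.diam) (h : θs i = θs j) : i = j :=
  eigenvalue_injective (fun i j _ _ => dualIdem_mul i j) (fun _ => Q.dualIdem_ne_zero)
    (fun _ => Q.dualAdj_mul) (fun _ => Q.dualIdem_mem) hi hj h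

theorem dualIdem_far (Q : QPolynomialGraph G p E kr θ x θs) {i j : ℕ}
    (hij : i + 1 < j ∨ j + 1 < i) : dualIdem G x i * distMatrix G 1 * dualIdem G x j = 0 := by
  ext y z
  rw [dualIdem, dualIdem, Matrix.mul_diagonal, Matrix.diagonal_mul, Matrix.zero_apply, distMatrix,
    Matrix.of_apply]
  by_cases h1 : G.dist x y = i
  · by_cases h2 : G.dist x z = j
    · have h3 : G.dist y z ≠ 1 := by
        intro h3
        have a := Q.connected.dist_triangle (u := x) (v := y) (w := z)
        have b := Q.connected.dist_triangle (u := x) (v := z) (w := y)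
        rw [SimpleGraph.dist_comm (u := z)] at b
        omega
      simp [h3]
    · simp [h2]
  · simp [h1]

open scoped ComplexOrder in
-- Test the vanishing of N = E_i A* E_j by tr(N Nᴴ). Up to nonzero scalars this is a sum over w
-- whose terms contain the (w, x) entry of (E_i ∘ E_j)E_1 = |X|⁻¹ q^1_{ij} E_1, and q^1_{ij} = 0 by
-- the Q-polynomial property.
theorem E_far (Q : QPolynomialGraph G p E kr θ x θs) {i j : ℕ} (hi : i ≤ G.diam)
    (hj : j ≤ G.diam) (hij : i + 1 < j ∨ j + 1 < i) : E i * dualAdj E x * E j = 0 := by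
  have hX : (Fintype.card X : ℂ) ≠ 0 := by
    have : Nonempty X := ⟨x⟩
    exact Nat.cast_ne_zero.2 Fintype.card_ne_zero
  have h1 : 1 ≤ G.diam := Q.diam_pos
  have hk : kr 1 i j = 0 := Q.qPolynomial.eq_zero 1 i j h1 hi hj (by omega)
  have hB : (dualAdj E x)ᴴ = dualAdj E x := by
    rw [dualAdj, Matrix.diagonal_conjTranspose]
    congr 1
    ext y
    have := congrFun (congrFun (Q.E_conjTranspose h1) y) x
    rw [Matrix.conjTranspose_apply] at this
    simp [this, Q.E_apply_comm h1 y x]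
  have hhad : ∀ w, ∑ w', E i w w' * E j w w' * E 1 w' x = 0 := by
    intro w
    refine (mul_eq_zero.1 (?_ : (Fintype.card X : ℂ) * _ = 0)).resolve_left hX
    rw [Finset.mul_sum]
    have : ∀ w', (Fintype.card X : ℂ) * (E i w w' * E j w w' * E 1 w' x)
        = ∑ h ∈ Finset.range (G.diam + 1), kr h i j * (E h w w' * E 1 w' x) := by
      intro w'
      rw [← mul_assoc, Q.card_smul_hadamard hi hj, Finset.sum_mul]
      exact Finset.sum_congr rfl fun h _ => by ring
    simp only [this]
    rw [Finset.sum_comm]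
    refine Finset.sum_eq_zero fun h hh => ?_
    have hh' : h ≤ G.diam := by simpa [Nat.lt_succ_iff] using hh
    rw [← Finset.mul_sum, ← Matrix.mul_apply, Q.idempotents.mul h 1 hh' h1]
    by_cases h2 : h = 1
    · rw [h2, hk, zero_mul]
    · rw [if_neg h2, Matrix.zero_apply, mul_zero]
  rw [← Matrix.trace_mul_conjTranspose_self_eq_zero_iff, Matrix.conjTranspose_mul,
    Matrix.conjTranspose_mul, hB, Q.E_conjTranspose hi, Q.E_conjTranspose hj]
  have e : E i * dualAdj E x * E j * (E j * (dualAdj E x * E i))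
      = E i * (dualAdj E x * (E j * E j) * dualAdj E x * E i) := by simp only [mul_assoc]
  rw [e, Matrix.trace_mul_comm, mul_assoc, Q.idempotents.mul i i hi hi, if_pos rfl,
    Q.idempotents.mul j j hj hj, if_pos rfl, dualAdj, Matrix.trace]
  refine Finset.sum_eq_zero fun w _ => ?_
  rw [Matrix.diag_apply, Matrix.mul_apply]
  simp only [Matrix.mul_diagonal, Matrix.diagonal_mul]
  have : ∀ w', (Fintype.card X : ℂ) * E 1 x w * E j w w' * ((Fintype.card X : ℂ) * E 1 x w') * E i w' w
      = (Fintype.card X : ℂ) * E 1 x w * (Fintype.card X : ℂ) * (E i w w' * E j w w' * E 1 w' x) := by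
    intro w'
    rw [Q.E_apply_comm h1 x w', Q.E_apply_comm hi w' w]
    ring
  simp only [this]
  rw [← Finset.mul_sum, hhad, mul_zero]

end QPolynomialGraph

end

section

/-! ### From irreducible modules to Leonard systems -/

section Abstract

variable {K V : Type*} [Field K] [AddCommGroup V] [Module K V]

/-- The joint kernel of the F_i with P i is invariant, because A does not lead from the indices
outside P into those in P. Irreducibility makes it zero or everything. -/
theorem invariant_cut {D : ℕ} {F : ℕ → Module.End K V} {A : Module.End K V}
    (hmul : ∀ i j, i ≤ D → j ≤ D → F i * F j = if i = j then F i else 0)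
    (hsum : ∑ i ∈ Finset.range (D + 1), F i = 1)
    (hirr : ∀ S : Submodule K V, (∀ w ∈ S, A w ∈ S) → (∀ i, i ≤ D → ∀ w ∈ S, F i w ∈ S) →
      S = ⊥ ∨ S = ⊤)
    (P : ℕ → Prop) (hP : ∀ i j, i ≤ D → j ≤ D → P i → ¬ P j → F i * A * F j = 0) :
    (∀ j, j ≤ D → ¬ P j → F j = 0) ∨ (∀ i, i ≤ D → P i → F i = 0) := by
  let S : Submodule K V :=
    { carrier := {w | ∀ i, i ≤ D → P i → F i w = 0}
      add_mem' := fun ha hb i hi hPi => by rw [map_add, ha i hi hPi, hb i hi hPi, add_zero]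
      zero_mem' := fun i _ _ => map_zero _
      smul_mem' := fun c w hw i hi hPi => by rw [map_smul, hw i hi hPi, smul_zero] }
  have hS : ∀ w, w ∈ S ↔ ∀ i, i ≤ D → P i → F i w = 0 := fun w => Iff.rfl
  have hFF : ∀ i j, i ≤ D → j ≤ D → ∀ w, F i (F j w) = if i = j then F i w else 0 := by
    intro i j hi hj w
    rw [← Module.End.mul_apply, hmul i j hi hj]
    split_ifs <;> rfl
  have hSA : ∀ w ∈ S, A w ∈ S := by
    intro w hw
    rw [hS]
    intro i hi hPi
    have : w = ∑ j ∈ Finset.range (D + 1), F j w := by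
      rw [← LinearMap.sum_apply, hsum, Module.End.one_apply]
    rw [this, map_sum, map_sum]
    refine Finset.sum_eq_zero fun j hj => ?_
    have hj' : j ≤ D := by simpa [Nat.lt_succ_iff] using hj
    by_cases hPj : P j
    · rw [(hS w).1 hw j hj' hPj, map_zero, map_zero]
    · exact LinearMap.congr_fun (hP i j hi hj' hPi hPj) w
  have hSF : ∀ k, k ≤ D → ∀ w ∈ S, F k w ∈ S := by
    intro k hk w hw
    rw [hS]
    intro i hi hPi
    rw [hFF i k hi hk, (hS w).1 hw i hi hPi, ite_self]
  rcases hirr S hSA hSF with h | h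
  · left
    intro j hj hPj
    ext v
    have : F j v ∈ S := by
      rw [hS]
      intro i hi hPi
      rw [hFF i j hi hj, if_neg]
      rintro rfl
      exact hPj hPi
    rw [h, Submodule.mem_bot] at this
    exact this
  · right
    intro i hi hPi
    ext v
    exact (hS v).1 (h ▸ Submodule.mem_top) i hi hPi

/-- The support of an irreducible module is an interval. -/
theorem support_interval [Nontrivial V] {D : ℕ} {F : ℕ → Module.End K V} {A : Module.End K V}
    (hmul : ∀ i j, i ≤ D → j ≤ D → F i * F j = if i = j then F i else 0)
    (hsum : ∑ i ∈ Finset.range (D + 1), F i = 1)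
    (hfar : ∀ i j, i ≤ D → j ≤ D → (i + 1 < j ∨ j + 1 < i) → F i * A * F j = 0)
    (hirr : ∀ S : Submodule K V, (∀ w ∈ S, A w ∈ S) → (∀ i, i ≤ D → ∀ w ∈ S, F i w ∈ S) →
      S = ⊥ ∨ S = ⊤) :
    ∃ r d, r + d ≤ D ∧ (∀ i, i ≤ D → (F i ≠ 0 ↔ r ≤ i ∧ i ≤ r + d)) ∧
      ∀ i, i < d → F (r + (i + 1)) * A * F (r + i) ≠ 0 ∧ F (r + i) * A * F (r + (i + 1)) ≠ 0 := by
  classical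
  have cut1 : ∀ k, k + 1 ≤ D → F (k + 1) * A * F k = 0 →
      (∀ j, j ≤ k → F j = 0) ∨ ∀ i, k < i → i ≤ D → F i = 0 := by
    intro k hk h0
    rcases invariant_cut hmul hsum hirr (fun i => k < i) (fun i j hi hj hki hkj => by
      by_cases h : i = k + 1 ∧ j = k
      · rw [h.1, h.2, h0]
      · exact hfar i j hi hj (by omega)) with h | h
    · exact Or.inl fun j hj => h j (by omega) (by omega)
    · exact Or.inr fun i hki hi => h i hi hki
  have cut2 : ∀ k, k + 1 ≤ D → F k * A * F (k + 1) = 0 →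
      (∀ j, j ≤ k → F j = 0) ∨ ∀ i, k < i → i ≤ D → F i = 0 := by
    intro k hk h0
    rcases invariant_cut hmul hsum hirr (fun i => i ≤ k) (fun i j hi hj hki hkj => by
      by_cases h : i = k ∧ j = k + 1
      · rw [h.1, h.2, h0]
      · exact hfar i j hi hj (by omega)) with h | h
    · exact Or.inr fun i hki hi => h i hi (by omega)
    · exact Or.inl fun j hj => h j (by omega) hj
  set T := (Finset.range (D + 1)).filter fun i => F i ≠ 0 with hT
  have hmem : ∀ i, i ∈ T ↔ i ≤ D ∧ F i ≠ 0 := fun i => by simp [hT]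
  have hne : T.Nonempty := by
    by_contra h
    rw [Finset.not_nonempty_iff_eq_empty] at h
    have h1 : ∑ i ∈ Finset.range (D + 1), F i = 0 := Finset.sum_eq_zero fun i hi => by
      by_contra h0
      have : i ∈ T := (hmem i).2 ⟨by simpa [Nat.lt_succ_iff] using hi, h0⟩
      simp [h] at this
    exact one_ne_zero (hsum.symm.trans h1)
  set r := T.min' hne
  set e := T.max' hne
  have hr := (hmem r).1 (T.min'_mem hne)
  have he := (hmem e).1 (T.max'_mem hne)
  have hre : r ≤ e := T.min'_le e (T.max'_mem hne)
  refine ⟨r, e - r, by omega, fun i hi => ⟨fun h => ?_, fun h h0 => ?_⟩, fun i hi => ⟨fun h => ?_, fun h => ?_⟩⟩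
  · have h1 := T.min'_le i ((hmem i).2 ⟨hi, h⟩)
    have h2 := T.le_max' i ((hmem i).2 ⟨hi, h⟩)
    exact ⟨h1, by omega⟩
  · have hir : i ≠ r := by
      intro h
      exact hr.2 (h ▸ h0)
    obtain ⟨k, rfl⟩ : ∃ k, i = k + 1 := ⟨i - 1, by omega⟩
    rcases cut1 k hi (by rw [h0, zero_mul, zero_mul]) with h1 | h1
    · exact hr.2 (h1 r (by omega))
    · exact he.2 (h1 e (by omega) he.1)
  · rcases cut1 (r + i) (by omega) h with h1 | h1
    · exact hr.2 (h1 r (by omega))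
    · exact he.2 (h1 e (by omega) he.1)
  · rcases cut2 (r + i) (by omega) h with h1 | h1
    · exact hr.2 (h1 r (by omega))
    · exact he.2 (h1 e (by omega) he.1)

theorem rankOneIdempotents_of_support {D r d : ℕ} {F : ℕ → Module.End K V}
    (hmul : ∀ i j, i ≤ D → j ≤ D → F i * F j = if i = j then F i else 0)
    (hsum : ∑ i ∈ Finset.range (D + 1), F i = 1) (hrd : r + d ≤ D)
    (hsupp : ∀ i, i ≤ D → (F i ≠ 0 ↔ r ≤ i ∧ i ≤ r + d))
    (hthin : ∀ i, i ≤ D → ∃ w, ∀ v, ∃ c : K, F i v = c • w) :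
    RankOneIdempotents d fun i => F (r + i) where
  mul i j hi hj := by
    rw [hmul _ _ (by omega) (by omega)]
    simp
  sum := by
    have h1 : ∑ i ∈ Finset.Ico r (r + (d + 1)), F i = ∑ i ∈ Finset.range (D + 1), F i := by
      refine Finset.sum_subset (fun i hi => ?_) fun i hi hi' => ?_
      · have := Finset.mem_Ico.1 hi
        exact Finset.mem_range.2 (by omega)
      · by_contra h0
        have hiD : i ≤ D := by simpa [Nat.lt_succ_iff] using hi
        have := (hsupp i hiD).1 h0
        exact hi' (Finset.mem_Ico.2 (by omega))
    rw [Finset.sum_Ico_eq_sum_range, Nat.add_sub_cancel_left, hsum] at h1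
    exact h1
  rank_one i hi := by
    obtain ⟨w, hw⟩ := hthin (r + i) (by omega)
    have hne := (hsupp (r + i) (by omega)).2 ⟨by omega, by omega⟩
    obtain ⟨v, hv⟩ : ∃ v, F (r + i) v ≠ 0 := by
      by_contra h
      push Not at h
      exact hne (LinearMap.ext h)
    obtain ⟨a, ha⟩ := hw v
    have ha0 : a ≠ 0 := by
      rintro rfl
      rw [zero_smul] at ha
      exact hv ha
    refine ⟨F (r + i) v, hv, ?_, fun v' => ?_⟩
    · rw [← Module.End.mul_apply, hmul _ _ (by omega) (by omega), if_pos rfl]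
    · obtain ⟨b, hb⟩ := hw v'
      refine ⟨b * a⁻¹, ?_⟩
      rw [ha, hb, smul_smul, mul_assoc, inv_mul_cancel₀ ha0, mul_one]

/-- The line F_{i+1}V is reached from F_iV by applying A and removing components that already lie in
K[A]u. A cyclic vector for A is what makes the spaces E_iV at most one-dimensional. -/
theorem RankOneIdempotents.exists_generator {d : ℕ} {F : ℕ → Module.End K V} {A : Module.End K V}
    (hF : RankOneIdempotents d F)
    (hfar : ∀ i j, i ≤ d → j ≤ d → (i + 1 < j ∨ j + 1 < i) → F i * A * F j = 0)
    (hnear : ∀ i, i < d → F (i + 1) * A * F i ≠ 0) :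
    ∃ u, ∀ v, ∃ g : K[X], v = aeval A g u := by
  obtain ⟨u, hu0, hu, -⟩ := hF.rank_one 0 (Nat.zero_le d)
  let S : Submodule K V :=
    { carrier := {v | ∃ g : K[X], v = aeval A g u}
      add_mem' := by
        rintro _ _ ⟨g, rfl⟩ ⟨g', rfl⟩
        exact ⟨g + g', by simp⟩
      zero_mem' := ⟨0, by simp⟩
      smul_mem' := by
        rintro c _ ⟨g, rfl⟩
        exact ⟨c • g, by simp⟩ }
  have hSA : ∀ v ∈ S, A v ∈ S := by
    rintro _ ⟨g, rfl⟩
    exact ⟨X * g, by simp⟩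
  have key : ∀ i, i ≤ d → ∀ v, F i v ∈ S := by
    intro i
    induction i using Nat.strong_induction_on with
    | _ i ih =>
      intro hi v
      cases i with
      | zero =>
        obtain ⟨c, hc⟩ := hF.exists_eq_smul hi hu0 hu v
        rw [hc]
        exact S.smul_mem c ⟨1, by simp⟩
      | succ i =>
        obtain ⟨z, hz⟩ : ∃ z, F (i + 1) (A (F i z)) ≠ 0 := by
          by_contra h
          push Not at h
          exact hnear i hi (LinearMap.ext h)
        obtain ⟨c, hc⟩ := hF.exists_eq_smul hi hz (hF.apply_self hi _) v
        rw [hc]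
        refine S.smul_mem c ?_
        have h1 := hF.sum_apply (A (F i z))
        rw [← Finset.sum_erase_add _ _ (Finset.mem_range.2 (show i + 1 < d + 1 by omega)),
          ← eq_sub_iff_add_eq'] at h1
        rw [h1]
        refine S.sub_mem (hSA _ (ih i (by omega) (by omega) z)) (S.sum_mem fun j hj => ?_)
        obtain ⟨hj1, hj2⟩ := Finset.mem_erase.1 hj
        have hj3 := Finset.mem_range.1 hj2
        rcases lt_or_gt_of_ne hj1 with h | h
        · exact ih j h (by omega) _
        · have : F j (A (F i z)) = 0 :=
            LinearMap.congr_fun (hfar j i (by omega) (by omega) (by omega)) z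
          rw [this]
          exact S.zero_mem
  refine ⟨u, fun v => ?_⟩
  change v ∈ S
  rw [← hF.sum_apply v]
  exact S.sum_mem fun i hi => key i (by simpa [Nat.lt_succ_iff] using hi) v

/-- Thinness is assumed only for the F_i. A cyclic vector u shows that E_iV is spanned by E_i u, so
the E_i side is thin too; both supports then have dim V elements, hence the same diameter. -/
theorem exists_leonardSystem [Nontrivial V] {D : ℕ} {E F : ℕ → Module.End K V}
    {A B : Module.End K V} {θ θs : ℕ → K}
    (hE : ∀ i j, i ≤ D → j ≤ D → E i * E j = if i = j then E i else 0)
    (hEsum : ∑ i ∈ Finset.range (D + 1), E i = 1)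
    (hF : ∀ i j, i ≤ D → j ≤ D → F i * F j = if i = j then F i else 0)
    (hFsum : ∑ i ∈ Finset.range (D + 1), F i = 1)
    (hA : ∀ i, i ≤ D → A * E i = θ i • E i) (hB : ∀ i, i ≤ D → B * F i = θs i • F i)
    (hθ : ∀ i j, i ≤ D → j ≤ D → θ i = θ j → i = j)
    (hθs : ∀ i j, i ≤ D → j ≤ D → θs i = θs j → i = j)
    (hEfar : ∀ i j, i ≤ D → j ≤ D → (i + 1 < j ∨ j + 1 < i) → E i * B * E j = 0)
    (hFfar : ∀ i j, i ≤ D → j ≤ D → (i + 1 < j ∨ j + 1 < i) → F i * A * F j = 0)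
    (hEirr : ∀ S : Submodule K V, (∀ w ∈ S, B w ∈ S) → (∀ i, i ≤ D → ∀ w ∈ S, E i w ∈ S) →
      S = ⊥ ∨ S = ⊤)
    (hFirr : ∀ S : Submodule K V, (∀ w ∈ S, A w ∈ S) → (∀ i, i ≤ D → ∀ w ∈ S, F i w ∈ S) →
      S = ⊥ ∨ S = ⊤)
    (hthin : ∀ i, i ≤ D → ∃ w, ∀ v, ∃ c : K, F i v = c • w) :
    ∃ r t d, r + d ≤ D ∧ t + d ≤ D ∧ (∀ i, i ≤ D → (F i ≠ 0 ↔ r ≤ i ∧ i ≤ r + d)) ∧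
      (∀ i, i ≤ D → (E i ≠ 0 ↔ t ≤ i ∧ i ≤ t + d)) ∧
      LeonardSystem d A B (fun i => E (t + i)) (fun i => F (r + i)) (fun i => θ (t + i))
        (fun i => θs (r + i)) := by
  obtain ⟨r, d, hrd, hFsupp, hFnear⟩ := support_interval hF hFsum hFfar hFirr
  obtain ⟨t, d', htd, hEsupp, hEnear⟩ := support_interval hE hEsum hEfar hEirr
  have rF := rankOneIdempotents_of_support hF hFsum hrd hFsupp hthin
  obtain ⟨u, hu⟩ := rF.exists_generator (A := A)
    (fun i j hi hj h => hFfar _ _ (by omega) (by omega) (by omega)) (fun i hi => (hFnear i hi).1)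
  have hEA : ∀ i, i ≤ D → ∀ v, E i (A v) = θ i • E i v := by
    intro i hi v
    have hv : v = ∑ j ∈ Finset.range (D + 1), E j v := by
      rw [← LinearMap.sum_apply, hEsum, Module.End.one_apply]
    have hj : ∀ j, j ≤ D → E i (A (E j v)) = θ i • E i (E j v) := by
      intro j hj
      have h1 : A (E j v) = θ j • E j v := LinearMap.congr_fun (hA j hj) v
      rw [h1, map_smul, ← Module.End.mul_apply, hE i j hi hj]
      split_ifs with h
      · rw [h]
      · simp
    rw [hv, map_sum, map_sum, map_sum, Finset.smul_sum]
    exact Finset.sum_congr rfl fun j hj' => hj j (by simpa [Nat.lt_succ_iff] using hj')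
  have hEthin : ∀ i, i ≤ D → ∃ w, ∀ v, ∃ c : K, E i v = c • w := by
    intro i hi
    refine ⟨E i u, fun v => ?_⟩
    obtain ⟨g, rfl⟩ := hu v
    refine ⟨g.eval (θ i), ?_⟩
    induction g using Polynomial.induction_on' with
    | add p q hp hq => simp [hp, hq, add_smul]
    | monomial n a =>
      have : ∀ n, E i ((A ^ n) u) = θ i ^ n • E i u := by
        intro n
        induction n with
        | zero => simp
        | succ n ih => rw [pow_succ', Module.End.mul_apply, hEA i hi, ih, smul_smul, pow_succ']
      simp [aeval_monomial, this, smul_smul]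
  have rE := rankOneIdempotents_of_support hE hEsum htd hEsupp hEthin
  obtain rfl : d = d' := by
    have h1 := rF.finrank_eq
    have h2 := rE.finrank_eq
    omega
  refine ⟨r, t, d, hrd, htd, hFsupp, hEsupp, rE, rF, fun i hi => hA _ (by omega),
    fun i hi => hB _ (by omega), fun i j hi hj h => ?_, fun i j hi hj h => ?_,
    fun i j hi hj h => hEfar _ _ (by omega) (by omega) (by omega),
    fun i j hi hj h => hFfar _ _ (by omega) (by omega) (by omega), hEnear, hFnear⟩
  · have := hθ _ _ (by omega) (by omega) h
    omega
  · have := hθs _ _ (by omega) (by omega) h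
    omega

end Abstract

end

section

/-! ### Submodules of the standard module -/

variable {X : Type*} [Fintype X] [DecidableEq X]

/-- The matrices that leave `W` invariant. -/
def stabilizer (W : Submodule ℂ (X → ℂ)) : Subalgebra ℂ (Matrix X X ℂ) where
  carrier := {B | ∀ w ∈ W, B *ᵥ w ∈ W}
  mul_mem' := fun ha hb w hw => by
    rw [← Matrix.mulVec_mulVec]
    exact ha _ (hb w hw)
  add_mem' := fun ha hb w hw => by
    rw [Matrix.add_mulVec]
    exact W.add_mem (ha w hw) (hb w hw)
  algebraMap_mem' := fun c w hw => by
    rw [Algebra.algebraMap_eq_smul_one, Matrix.smul_mulVec, Matrix.one_mulVec]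
    exact W.smul_mem c hw

/-! ### Restriction of invariant matrices to a subspace -/

section ActOn

variable {W : Submodule ℂ (X → ℂ)} {B C : Matrix X X ℂ}

theorem coe_actOn (hB : B ∈ stabilizer W) (w : W) : (actOn W B w : X → ℂ) = B *ᵥ w := by
  have : ∀ w ∈ W, Matrix.toLin' B w ∈ W := fun w hw => by
    rw [Matrix.toLin'_apply]
    exact hB w hw
  rw [actOn, dif_pos this]
  rfl

theorem actOn_eq_iff (hB : B ∈ stabilizer W) {f : Module.End ℂ W} :
    actOn W B = f ↔ ∀ w : W, B *ᵥ (w : X → ℂ) = f w := by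
  refine ⟨fun h w => by rw [← h, coe_actOn hB], fun h => ?_⟩
  ext1 w
  exact Subtype.ext ((coe_actOn hB w).trans (h w))

theorem actOn_mul (hB : B ∈ stabilizer W) (hC : C ∈ stabilizer W) :
    actOn W (B * C) = actOn W B * actOn W C := by
  rw [actOn_eq_iff (mul_mem hB hC)]
  intro w
  rw [Module.End.mul_apply, coe_actOn hB, coe_actOn hC, Matrix.mulVec_mulVec]

theorem actOn_smul (hB : B ∈ stabilizer W) (c : ℂ) : actOn W (c • B) = c • actOn W B := by
  rw [actOn_eq_iff (Subalgebra.smul_mem _ hB c)]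
  intro w
  rw [LinearMap.smul_apply, Submodule.coe_smul, coe_actOn hB, Matrix.smul_mulVec]

theorem actOn_zero : actOn W (0 : Matrix X X ℂ) = 0 := by
  rw [actOn_eq_iff (zero_mem _)]
  intro w
  simp

theorem actOn_one : actOn W (1 : Matrix X X ℂ) = 1 := by
  rw [actOn_eq_iff (one_mem _)]
  intro w
  simp

theorem actOn_sum {ι : Type*} {s : Finset ι} {M : ι → Matrix X X ℂ}
    (hM : ∀ i ∈ s, M i ∈ stabilizer W) : actOn W (∑ i ∈ s, M i) = ∑ i ∈ s, actOn W (M i) := by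
  rw [actOn_eq_iff (sum_mem hM)]
  intro w
  rw [LinearMap.sum_apply, Submodule.coe_sum, Matrix.sum_mulVec]
  exact Finset.sum_congr rfl fun i hi => (coe_actOn (hM i hi) w).symm

theorem coe_aeval_actOn (hB : B ∈ stabilizer W) (g : ℂ[X]) (w : W) :
    (aeval (actOn W B) g w : X → ℂ) = aeval B g *ᵥ (w : X → ℂ) := by
  have hpow : ∀ n, ((actOn W B ^ n) w : X → ℂ) = (B ^ n) *ᵥ (w : X → ℂ) := by
    intro n
    induction n with
    | zero => simp
    | succ n ih =>
      rw [pow_succ', pow_succ', Module.End.mul_apply, coe_actOn hB, ih, Matrix.mulVec_mulVec]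
  induction g using Polynomial.induction_on' with
  | add f g hf hg =>
    rw [map_add, map_add, LinearMap.add_apply, Submodule.coe_add, hf, hg, Matrix.add_mulVec]
  | monomial n a =>
    simp only [aeval_monomial, Algebra.algebraMap_eq_smul_one, smul_mul_assoc, one_mul,
      LinearMap.smul_apply, Submodule.coe_smul, hpow, Matrix.smul_mulVec]

theorem mem_image {v : X → ℂ} : v ∈ image B W ↔ ∃ w ∈ W, B *ᵥ w = v := by
  simp [image, Submodule.mem_map]

theorem image_ne_bot_iff (hB : B ∈ stabilizer W) : image B W ≠ ⊥ ↔ actOn W B ≠ 0 := by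
  refine not_congr ⟨fun h => ?_, fun h => ?_⟩
  · rw [actOn_eq_iff hB]
    intro w
    have : B *ᵥ (w : X → ℂ) ∈ image B W := mem_image.2 ⟨w, w.2, rfl⟩
    rw [h, Submodule.mem_bot] at this
    simpa using this
  · rw [actOn_eq_iff hB] at h
    rw [eq_bot_iff]
    intro v hv
    obtain ⟨w, hw, rfl⟩ := mem_image.1 hv
    simpa using h ⟨w, hw⟩

theorem exists_eq_smul_of_finrank_image_le_one (hB : B ∈ stabilizer W)
    (h : Module.finrank ℂ (image B W) ≤ 1) :
    ∃ w : W, ∀ v : W, ∃ c : ℂ, actOn W B v = c • w := by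
  obtain ⟨w, hw⟩ := finrank_le_one_iff.1 h
  have hwW : (w : X → ℂ) ∈ W := by
    obtain ⟨w', hw', h'⟩ := mem_image.1 w.2
    rw [← h']
    exact hB w' hw'
  refine ⟨⟨w, hwW⟩, fun v => ?_⟩
  obtain ⟨c, hc⟩ := hw ⟨B *ᵥ v, mem_image.2 ⟨v, v.2, rfl⟩⟩
  refine ⟨c, Subtype.ext ?_⟩
  rw [coe_actOn hB]
  exact (congrArg Subtype.val hc).symm

end ActOn

namespace QPolynomialGraph

variable {G : SimpleGraph X} {p : ℕ → ℕ → ℕ → ℕ} {E : ℕ → Matrix X X ℂ} {kr : ℕ → ℕ → ℕ → ℂ}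
  {θ : ℕ → ℂ} {x : X} {θs : ℕ → ℂ} {W : Submodule ℂ (X → ℂ)}

theorem isTModule_iff : IsTModule G x W ↔ terwilliger G x ≤ stabilizer W := Iff.rfl

theorem isTModule_of_le (h : boseMesner G ≤ Subalgebra.toSubmodule (stabilizer W))
    (h' : dualBoseMesner G x ≤ Subalgebra.toSubmodule (stabilizer W)) : IsTModule G x W := by
  rw [isTModule_iff, terwilliger, Algebra.adjoin_le_iff, Set.union_subset_iff]
  exact ⟨h, h'⟩

/-- A generates the Bose-Mesner algebra, so A and the E*_i suffice. With its counterpart for A* and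
the E_i, this supplies the irreducibility conditions for both supports. -/
theorem isTModule_of_A (Q : QPolynomialGraph G p E kr θ x θs)
    (hA : distMatrix G 1 ∈ stabilizer W) (hF : ∀ i, i ≤ G.diam → dualIdem G x i ∈ stabilizer W) :
    IsTModule G x W := by
  refine isTModule_of_le (Q.boseMesner_le.trans ?_) (Submodule.span_le.2 ?_)
  · exact Algebra.adjoin_le (Set.singleton_subset_iff.2 hA)
  · rintro _ ⟨i, rfl⟩
    exact hF i (by omega)

theorem isTModule_of_dual (Q : QPolynomialGraph G p E kr θ x θs)
    (hB : dualAdj E x ∈ stabilizer W) (hE : ∀ i, i ≤ G.diam → E i ∈ stabilizer W) :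
    IsTModule G x W := by
  refine isTModule_of_le ?_ (Submodule.span_le.2 ?_)
  · rw [← Q.idempotents.span_eq]
    refine Submodule.span_le.2 ?_
    rintro _ ⟨i, rfl⟩
    exact hE i (by omega)
  · rintro _ ⟨i, rfl⟩
    exact Algebra.adjoin_le (Set.singleton_subset_iff.2 hB) (Q.dualIdem_mem (i := i) (by omega))

theorem E_mem_stabilizer (Q : QPolynomialGraph G p E kr θ x θs) (hW : IsTModule G x W) {i : ℕ}
    (hi : i ≤ G.diam) : E i ∈ stabilizer W :=
  isTModule_iff.1 hW (Algebra.subset_adjoin (Or.inl (Q.E_mem_boseMesner hi)))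

theorem distMatrix_mem_stabilizer (hW : IsTModule G x W) {i : ℕ} (hi : i ≤ G.diam) :
    distMatrix G i ∈ stabilizer W :=
  isTModule_iff.1 hW (Algebra.subset_adjoin (Or.inl (distMatrix_mem_boseMesner hi)))

theorem dualIdem_eq_zero (Q : QPolynomialGraph G p E kr θ x θs) {i : ℕ} (hi : G.diam < i) :
    dualIdem G x i = 0 := by
  rw [dualIdem, ← Matrix.diagonal_zero]
  congr 1
  ext y
  have := Q.dist_le x y
  rw [if_neg (by omega)]

theorem dualIdem_mem_stabilizer (Q : QPolynomialGraph G p E kr θ x θs) (hW : IsTModule G x W)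
    (i : ℕ) : dualIdem G x i ∈ stabilizer W := by
  by_cases hi : i ≤ G.diam
  · exact isTModule_iff.1 hW
      (Algebra.subset_adjoin (Or.inr (Submodule.subset_span ⟨⟨i, by omega⟩, rfl⟩)))
  · rw [Q.dualIdem_eq_zero (by omega)]
    exact zero_mem _

theorem dualAdj_mem_stabilizer (Q : QPolynomialGraph G p E kr θ x θs) (hW : IsTModule G x W) :
    dualAdj E x ∈ stabilizer W := by
  rw [Q.dualEigenvalues]
  exact sum_mem fun i _ => Subalgebra.smul_mem _ (Q.dualIdem_mem_stabilizer hW i) _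

theorem eq_bot_or_eq_top_of_isTModule_map (hW : IsIrreducible G x W) {S : Submodule ℂ W}
    (hS : IsTModule G x (S.map W.subtype)) : S = ⊥ ∨ S = ⊤ := by
  have hinj := Submodule.map_injective_of_injective W.injective_subtype
  rcases hW.eq_bot_or_eq _ (Submodule.map_subtype_le W S) hS with h | h
  · left
    apply hinj
    rw [h, Submodule.map_bot]
  · right
    apply hinj
    rw [h, Submodule.map_subtype_top]

theorem mem_stabilizer_map {S : Submodule ℂ W} {B : Matrix X X ℂ} (hB : B ∈ stabilizer W)
    (h : ∀ w ∈ S, actOn W B w ∈ S) : B ∈ stabilizer (S.map W.subtype) := by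
  rintro _ ⟨w, hw, rfl⟩
  exact ⟨actOn W B w, h w hw, coe_actOn hB w⟩

/-- A thin irreducible module supports a Leonard system. -/
theorem leonardSystem (Q : QPolynomialGraph G p E kr θ x θs) (hW : IsIrreducible G x W)
    (hthin : IsThin G x W) {r t d : ℕ} (hr : endpoint G x W = r) (ht : dualEndpoint G E W = t)
    (hd : diameter G x W = d) :
    r + d ≤ G.diam ∧ t + d ≤ G.diam ∧
      LeonardSystem d (actOn W (distMatrix G 1)) (actOn W (dualAdj E x))
        (fun i => actOn W (E (t + i))) (fun i => actOn W (dualIdem G x (r + i)))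
        (fun i => θ (t + i)) (fun i => θs (r + i)) := by
  have hT := hW.isTModule
  have hA := distMatrix_mem_stabilizer hT Q.diam_pos
  have hB := Q.dualAdj_mem_stabilizer hT
  have hE : ∀ i, i ≤ G.diam → E i ∈ stabilizer W := fun i hi => Q.E_mem_stabilizer hT hi
  have hF := Q.dualIdem_mem_stabilizer hT
  have : Nontrivial W := Submodule.nontrivial_iff_ne_bot.2 hW.ne_bot
  obtain ⟨r', t', d', hrd, htd, hFs, hEs, L⟩ := exists_leonardSystem (V := W) (D := G.diam)
    (E := fun i => actOn W (E i)) (F := fun i => actOn W (dualIdem G x i))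
    (A := actOn W (distMatrix G 1)) (B := actOn W (dualAdj E x)) (θ := θ) (θs := θs)
    (fun i j hi hj => by
      rw [← actOn_mul (hE i hi) (hE j hj), Q.idempotents.mul i j hi hj, apply_ite (actOn W),
        actOn_zero])
    (by
      rw [← actOn_sum fun i hi => hE i (by simpa [Nat.lt_succ_iff] using hi),
        Q.idempotents.sum_eq_one, actOn_one])
    (fun i j hi hj => by
      rw [← actOn_mul (hF i) (hF j), dualIdem_mul, apply_ite (actOn W), actOn_zero])
    (by rw [← actOn_sum fun i _ => hF i, Q.dualIdem_sum, actOn_one])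
    (fun i hi => by rw [← actOn_mul hA (hE i hi), Q.A_mul_E hi, actOn_smul (hE i hi)])
    (fun i hi => by rw [← actOn_mul hB (hF i), Q.dualAdj_mul hi, actOn_smul (hF i)])
    (fun i j => Q.θ_injective) (fun i j => Q.θs_injective)
    (fun i j hi hj hij => by
      rw [← actOn_mul (hE i hi) hB, ← actOn_mul (mul_mem (hE i hi) hB) (hE j hj),
        Q.E_far hi hj hij, actOn_zero])
    (fun i j hi hj hij => by
      rw [← actOn_mul (hF i) hA, ← actOn_mul (mul_mem (hF i) hA) (hF j),
        Q.dualIdem_far hij, actOn_zero])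
    (fun S hSB hSE => eq_bot_or_eq_top_of_isTModule_map hW <| Q.isTModule_of_dual
      (mem_stabilizer_map hB hSB) fun i hi => mem_stabilizer_map (hE i hi) (hSE i hi))
    (fun S hSA hSF => eq_bot_or_eq_top_of_isTModule_map hW <| Q.isTModule_of_A
      (mem_stabilizer_map hA hSA) fun i hi => mem_stabilizer_map (hF i) (hSF i hi))
    (fun i hi => exists_eq_smul_of_finrank_image_le_one (hF i) (hthin i hi))
  have hFset : {i | i ≤ G.diam ∧ image (dualIdem G x i) W ≠ ⊥} = Set.Icc r' (r' + d') := by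
    ext i
    rw [Set.mem_ofPred_eq, image_ne_bot_iff (hF i), Set.mem_Icc]
    exact ⟨fun h => (hFs i h.1).1 h.2, fun h => ⟨by omega, (hFs i (by omega)).2 h⟩⟩
  have hEset : {i | i ≤ G.diam ∧ image (E i) W ≠ ⊥} = Set.Icc t' (t' + d') := by
    ext i
    rw [Set.mem_ofPred_eq, Set.mem_Icc]
    refine ⟨fun h => (hEs i h.1).1 ((image_ne_bot_iff (hE i h.1)).1 h.2), fun h => ?_⟩
    have hi : i ≤ G.diam := by omega
    exact ⟨hi, (image_ne_bot_iff (hE i hi)).2 ((hEs i hi).2 h)⟩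
  obtain rfl : r' = r := by
    rw [← hr, endpoint, hFset, csInf_Icc (by omega)]
  obtain rfl : t' = t := by
    rw [← ht, dualEndpoint, hEset, csInf_Icc (by omega)]
  obtain rfl : d' = d := by
    rw [← hd, diameter, hFset, Set.ncard_eq_toFinset_card', Set.toFinset_Icc, Nat.card_Icc]
    omega
  exact ⟨hrd, htd, L⟩

end QPolynomialGraph

end

section

/-! ### Split sequences of modules -/

variable {X : Type*} [Fintype X] [DecidableEq X]

theorem image_span_singleton (B : Matrix X X ℂ) (w : X → ℂ) :
    image B (Submodule.span ℂ {w}) = Submodule.span ℂ {B *ᵥ w} := by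
  rw [image, Submodule.map_span, Set.image_singleton, Matrix.toLin'_apply]

theorem isEigenvalueOn_span_singleton {X : Type*} [Fintype X] {B : Matrix X X ℂ} {w : X → ℂ} {c : ℂ} :
    IsEigenvalueOn B (Submodule.span ℂ {w}) c ↔ w ≠ 0 ∧ B *ᵥ w = c • w := by
  rw [IsEigenvalueOn, Ne, Submodule.span_singleton_eq_bot]
  refine and_congr Iff.rfl ⟨fun h => h w (Submodule.mem_span_singleton_self w), fun h v hv => ?_⟩
  obtain ⟨a, rfl⟩ := Submodule.mem_span_singleton.1 hv
  rw [Matrix.mulVec_smul, h, smul_comm]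

theorem image_eq_span_singleton {W : Submodule ℂ (X → ℂ)} {B : Matrix X X ℂ} {u : W}
    (hB : B ∈ stabilizer W) (hu : actOn W B u = u) (h : ∀ v : W, ∃ c : ℂ, actOn W B v = c • u) :
    image B W = Submodule.span ℂ {(u : X → ℂ)} := by
  refine le_antisymm (fun v hv => ?_) (Submodule.span_le.2 (Set.singleton_subset_iff.2 ?_))
  · obtain ⟨w, hw, rfl⟩ := mem_image.1 hv
    obtain ⟨c, hc⟩ := h ⟨w, hw⟩
    exact Submodule.mem_span_singleton.2 ⟨c, by
      rw [← Submodule.coe_smul, ← hc, coe_actOn hB]⟩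
  · exact mem_image.2 ⟨u, u.2, by rw [← coe_actOn hB, hu]⟩

section Split

variable {W : Submodule ℂ (X → ℂ)} {A B : Matrix X X ℂ} {d : ℕ} {θ θs φ : ℕ → ℂ} {u : W}

/-- The split space is the line of τ_{n+1}(A)u, so its eigenvalue is unique. The factor of A* lowers
this vector to φ_{n+1}τ_n(A)u, and the factor of A raises it back. -/
theorem isEigenvalueOn_splitVec (hA : A ∈ stabilizer W) (hB : B ∈ stabilizer W)
    (hφ : IsSplitSeq d (actOn W A) (actOn W B) θ θs u φ) {n : ℕ} (hn : n < d)
    (h0 : splitVec (actOn W A) θ u (n + 1) ≠ 0) {c : ℂ} :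
    IsEigenvalueOn ((A - θ n • (1 : Matrix X X ℂ)) * (B - θs (n + 1) • (1 : Matrix X X ℂ)))
      (image (aeval A (nodePoly θ (n + 1))) (Submodule.span ℂ {(u : X → ℂ)})) c ↔
    c = φ (n + 1) := by
  rw [image_span_singleton, isEigenvalueOn_span_singleton, ← coe_aeval_actOn hA]
  change ((splitVec (actOn W A) θ u (n + 1) : W) : X → ℂ) ≠ 0 ∧ _ *ᵥ
    ((splitVec (actOn W A) θ u (n + 1) : W) : X → ℂ) =
    c • ((splitVec (actOn W A) θ u (n + 1) : W) : X → ℂ) ↔ _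
  have h := congrArg (Subtype.val) (LeonardSystem.splitSeq_eigenvalue hφ hn)
  simp only [LinearMap.sub_apply, LinearMap.smul_apply, Module.End.one_apply, Submodule.coe_sub,
    Submodule.coe_smul, map_sub, map_smul, coe_actOn hA, coe_actOn hB] at h
  set v := splitVec (actOn W A) θ u (n + 1)
  have h0' : (v : X → ℂ) ≠ 0 := fun h => h0 (Subtype.ext h)
  have e : ((A - θ n • (1 : Matrix X X ℂ)) * (B - θs (n + 1) • (1 : Matrix X X ℂ))) *ᵥ (v : X → ℂ)
      = φ (n + 1) • (v : X → ℂ) := by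
    rw [← h]
    simp only [← Matrix.mulVec_mulVec, Matrix.sub_mulVec, Matrix.smul_mulVec, Matrix.one_mulVec,
      Matrix.mulVec_sub, Matrix.mulVec_smul]
  rw [e]
  refine ⟨fun h => ?_, fun h => ⟨h0', by rw [h]⟩⟩
  have h1 : (φ (n + 1) - c) • (v : X → ℂ) = 0 := by rw [sub_smul, h.2, sub_self]
  exact (sub_eq_zero.1 ((smul_eq_zero.1 h1).resolve_right h0')).symm

end Split

namespace QPolynomialGraph

variable {G : SimpleGraph X} {p : ℕ → ℕ → ℕ → ℕ} {E : ℕ → Matrix X X ℂ} {kr : ℕ → ℕ → ℕ → ℂ}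
  {θ : ℕ → ℂ} {x : X} {θs : ℕ → ℂ} {W : Submodule ℂ (X → ℂ)} {r t d : ℕ} {u : W} {φ : ℕ → ℂ}

theorem image_dualIdem_eq_span (Q : QPolynomialGraph G p E kr θ x θs) (hT : IsTModule G x W)
    (L : LeonardSystem d (actOn W (distMatrix G 1)) (actOn W (dualAdj E x))
        (fun i => actOn W (E (t + i))) (fun i => actOn W (dualIdem G x (r + i)))
        (fun i => θ (t + i)) (fun i => θs (r + i)))
    (hu : actOn W (dualIdem G x r) u = u) (hu0 : u ≠ 0) :
    image (dualIdem G x r) W = Submodule.span ℂ {(u : X → ℂ)} :=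
  image_eq_span_singleton (Q.dualIdem_mem_stabilizer hT r) hu
    (L.idemF.exists_eq_smul (Nat.zero_le d) hu0 hu)

theorem isFirstSplitSequence_iff (Q : QPolynomialGraph G p E kr θ x θs) (hT : IsTModule G x W)
    (L : LeonardSystem d (actOn W (distMatrix G 1)) (actOn W (dualAdj E x))
        (fun i => actOn W (E (t + i))) (fun i => actOn W (dualIdem G x (r + i)))
        (fun i => θ (t + i)) (fun i => θs (r + i)))
    (hu : actOn W (dualIdem G x r) u = u) (hu0 : u ≠ 0)
    (hφ : IsSplitSeq d (actOn W (distMatrix G 1)) (actOn W (dualAdj E x)) (fun i => θ (t + i))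
      (fun i => θs (r + i)) u φ) {f : ℕ → ℂ} :
    IsFirstSplitSequence G E x θ θs r t d W f ↔ ∀ i, 1 ≤ i → i ≤ d → f i = φ i := by
  refine forall_congr' fun i => forall_congr' fun hi1 => forall_congr' fun hi => ?_
  obtain ⟨n, rfl⟩ : ∃ n, i = n + 1 := ⟨i - 1, by omega⟩
  rw [splitSpace, Q.image_dualIdem_eq_span hT L hu hu0]
  exact isEigenvalueOn_splitVec (distMatrix_mem_stabilizer hT Q.diam_pos)
    (Q.dualAdj_mem_stabilizer hT) hφ hi (L.splitVec_ne_zero hu hu0 hi)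

theorem isSecondSplitSequence_iff (Q : QPolynomialGraph G p E kr θ x θs) (hT : IsTModule G x W)
    (L : LeonardSystem d (actOn W (distMatrix G 1)) (actOn W (dualAdj E x))
        (fun i => actOn W (E (t + i))) (fun i => actOn W (dualIdem G x (r + i)))
        (fun i => θ (t + i)) (fun i => θs (r + i)))
    (hu : actOn W (dualIdem G x r) u = u) (hu0 : u ≠ 0)
    (hφ : IsSplitSeq d (actOn W (distMatrix G 1)) (actOn W (dualAdj E x))
      (fun i => θ (t + (d - i))) (fun i => θs (r + i)) u φ) {f : ℕ → ℂ} :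
    IsSecondSplitSequence G E x θ θs r t d W f ↔ ∀ i, 1 ≤ i → i ≤ d → f i = φ i := by
  refine forall_congr' fun i => forall_congr' fun hi1 => forall_congr' fun hi => ?_
  obtain ⟨n, rfl⟩ : ∃ n, i = n + 1 := ⟨i - 1, by omega⟩
  -- With i = n+1 the eigenvalue index t+d-i+1 is t+(d-n), the n-th index of the reversed order.
  have h1 : t + d - (n + 1) + 1 = t + (d - n) := by omega
  have h2 : etaPoly θ t d (n + 1) = nodePoly (fun i => θ (t + (d - i))) (n + 1) := by
    refine Finset.prod_congr rfl fun k hk => ?_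
    have := Finset.mem_range.1 hk
    rw [Nat.add_sub_assoc (by omega)]
  rw [splitSpaceDown, Q.image_dualIdem_eq_span hT L hu hu0, h1, h2]
  exact isEigenvalueOn_splitVec (distMatrix_mem_stabilizer hT Q.diam_pos)
    (Q.dualAdj_mem_stabilizer hT) hφ hi (L.reverse.splitVec_ne_zero hu hu0 hi)

/-! ### The trivial module -/

theorem dualIdem_zero_mulVec (Q : QPolynomialGraph G p E kr θ x θs) {v : X → ℂ} :
    dualIdem G x 0 *ᵥ v = v x • Pi.single x 1 := by
  ext y
  rw [dualIdem, Matrix.mulVec_diagonal]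
  by_cases hy : y = x
  · subst hy
    simp
  · simp [hy, Q.connected.dist_eq_zero_iff, Ne.symm hy]

theorem single_mem (Q : QPolynomialGraph G p E kr θ x θs) (hW : IsIrreducible G x W)
    (h0 : endpoint G x W = 0) : (Pi.single x 1 : X → ℂ) ∈ W := by
  have hT := hW.isTModule
  have hF := Q.dualIdem_mem_stabilizer hT
  -- The infimum of the empty set is also 0, so the support must first be shown to be nonempty.
  have hne : {i | i ≤ G.diam ∧ image (dualIdem G x i) W ≠ ⊥}.Nonempty := by
    by_contra h
    rw [Set.not_nonempty_iff_eq_empty] at h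
    refine hW.ne_bot (eq_bot_iff.2 fun w hw => ?_)
    have : ∀ i ∈ Finset.range (G.diam + 1), dualIdem G x i *ᵥ w = 0 := by
      intro i hi
      by_contra h1
      have : i ∈ {i | i ≤ G.diam ∧ image (dualIdem G x i) W ≠ ⊥} := by
        refine ⟨by simpa [Nat.lt_succ_iff] using hi, fun h2 => h1 ?_⟩
        rw [← Submodule.mem_bot ℂ, ← h2]
        exact mem_image.2 ⟨w, hw, rfl⟩
      rw [h] at this
      exact this
    rw [Submodule.mem_bot, ← Matrix.one_mulVec w, ← Q.dualIdem_sum (x := x), Matrix.sum_mulVec]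
    exact Finset.sum_eq_zero this
  have h1 := (Nat.sInf_mem hne).2
  rw [show sInf _ = endpoint G x W from rfl, h0] at h1
  obtain ⟨v, hv, hv0⟩ := (Submodule.ne_bot_iff _).1 h1
  obtain ⟨w, hw, rfl⟩ := mem_image.1 hv
  have h2 := hF 0 w hw
  rw [Q.dualIdem_zero_mulVec] at h2 hv0
  have h3 : w x ≠ 0 := by
    rintro h
    rw [h, zero_smul] at hv0
    exact hv0 rfl
  exact (W.smul_mem_iff h3).1 h2

theorem le_of_single_mem (hW : IsIrreducible G x W) (h : (Pi.single x 1 : X → ℂ) ∈ W)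
    {W' : Submodule ℂ (X → ℂ)} (hT' : IsTModule G x W') (h' : (Pi.single x 1 : X → ℂ) ∈ W') :
    W ≤ W' := by
  have hT : IsTModule G x (W ⊓ W') := fun B hB w hw =>
    ⟨hW.isTModule B hB w hw.1, hT' B hB w hw.2⟩
  rcases hW.eq_bot_or_eq _ inf_le_left hT with h1 | h1
  · have : (Pi.single x 1 : X → ℂ) ∈ W ⊓ W' := ⟨h, h'⟩
    rw [h1, Submodule.mem_bot] at this
    have := congrFun this x
    simp at this
  · exact h1 ▸ inf_le_right

/-- Endpoint 0 puts x̂ into both modules, and irreducible modules with a common nonzero vector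
coincide. -/
theorem eq_of_endpoint_eq_zero (Q : QPolynomialGraph G p E kr θ x θs) (hW : IsIrreducible G x W)
    (h0 : endpoint G x W = 0) {W' : Submodule ℂ (X → ℂ)} (hW' : IsIrreducible G x W')
    (h0' : endpoint G x W' = 0) : W = W' :=
  le_antisymm (le_of_single_mem hW (Q.single_mem hW h0) hW'.isTModule (Q.single_mem hW' h0'))
    (le_of_single_mem hW' (Q.single_mem hW' h0') hW.isTModule (Q.single_mem hW h0))

/-- The characteristic vector of the `i`th subconstituent. -/
def sphereVec (G : SimpleGraph X) (x : X) (i : ℕ) : X → ℂ := fun y => if G.dist x y = i then 1 else 0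

theorem dualIdem_mulVec_sphereVec (i j : ℕ) :
    dualIdem G x i *ᵥ sphereVec G x j = if i = j then sphereVec G x j else 0 := by
  ext y
  rw [dualIdem, Matrix.mulVec_diagonal, sphereVec]
  by_cases h1 : G.dist x y = i
  · by_cases h2 : i = j
    · simp [h1, h2, sphereVec]
    · simp [h1, h2]
  · by_cases h2 : i = j
    · subst h2
      simp [h1, sphereVec]
    · simp [h1, h2]

theorem distMatrix_mulVec_single (i : ℕ) :
    distMatrix G i *ᵥ (Pi.single x 1) = sphereVec G x i := by
  ext y
  simp [distMatrix, sphereVec, SimpleGraph.dist_comm]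

theorem A_mulVec_sphereVec (Q : QPolynomialGraph G p E kr θ x θs) {j : ℕ} (hj : j ≤ G.diam) :
    distMatrix G 1 *ᵥ sphereVec G x j
      = ∑ i ∈ Finset.range (G.diam + 1), (p i 1 j : ℂ) • sphereVec G x i := by
  rw [← distMatrix_mulVec_single, Matrix.mulVec_mulVec, Q.distMatrix_mul hj, Matrix.sum_mulVec]
  exact Finset.sum_congr rfl fun i _ => by rw [Matrix.smul_mulVec, distMatrix_mulVec_single]

/-- An irreducible module of endpoint `0` is thin. -/
theorem isThin_of_endpoint_eq_zero (Q : QPolynomialGraph G p E kr θ x θs)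
    (hW : IsIrreducible G x W) (h0 : endpoint G x W = 0) : IsThin G x W := by
  -- The sphere vectors span a module with at most one dimension in each E*_i. It contains x̂, hence
  -- contains W.
  set M : Submodule ℂ (X → ℂ) :=
    Submodule.span ℂ (Set.range fun i : Fin (G.diam + 1) => sphereVec G x i) with hM
  have hmem : ∀ i, i ≤ G.diam → sphereVec G x i ∈ M := fun i hi =>
    Submodule.subset_span ⟨⟨i, by omega⟩, rfl⟩
  have hstab : ∀ B : Matrix X X ℂ, (∀ j, j ≤ G.diam → B *ᵥ sphereVec G x j ∈ M) →
      B ∈ stabilizer M := by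
    intro B hB w hw
    induction hw using Submodule.span_induction with
    | mem w h =>
      obtain ⟨j, rfl⟩ := h
      exact hB j (by omega)
    | zero => simp
    | add v w _ _ hv hw =>
      rw [Matrix.mulVec_add]
      exact M.add_mem hv hw
    | smul c w _ hw =>
      rw [Matrix.mulVec_smul]
      exact M.smul_mem c hw
  have hT : IsTModule G x M := by
    refine Q.isTModule_of_A (hstab _ fun j hj => ?_) fun i _ => hstab _ fun j hj => ?_
    · rw [Q.A_mulVec_sphereVec hj]
      exact M.sum_mem fun i hi => M.smul_mem _ (hmem i (by simpa [Nat.lt_succ_iff] using hi))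
    · rw [dualIdem_mulVec_sphereVec]
      split_ifs
      · exact hmem j hj
      · exact M.zero_mem
  have hle := le_of_single_mem hW (Q.single_mem hW h0) hT (by
    have := hmem 0 (Nat.zero_le _)
    rwa [← distMatrix_mulVec_single, Q.distMatrix_zero, Matrix.one_mulVec] at this)
  intro i _
  have h1 : image (dualIdem G x i) W ≤ Submodule.span ℂ {sphereVec G x i} := by
    refine (Submodule.map_mono hle).trans ?_
    rw [hM, Submodule.map_span_le]
    rintro _ ⟨j, rfl⟩
    rw [Matrix.toLin'_apply, dualIdem_mulVec_sphereVec]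
    split_ifs with h
    · rw [h]
      exact Submodule.mem_span_singleton_self _
    · exact Submodule.zero_mem _
  refine (Submodule.finrank_mono h1).trans ?_
  simpa using finrank_span_le_card (R := ℂ) ({sphereVec G x i} : Set (X → ℂ))

end QPolynomialGraph

end

section

/-! ### Modules of graphs of `q`-Racah type -/

theorem QRacahFormulas.congr {q h σ ρ₁ ρ₂ θt : ℂ} {r t d : ℕ} {a b c a' b' c' : ℕ → ℂ}
    (H : QRacahFormulas q h σ ρ₁ ρ₂ θt r t d a b c) (ha : ∀ i, i ≤ d → a' i = a i)
    (hb : ∀ i, i ≤ d → b' i = b i) (hc : ∀ i, i ≤ d → c' i = c i) :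
    QRacahFormulas q h σ ρ₁ ρ₂ θt r t d a' b' c' where
  den_ne_zero := H.den_ne_zero
  b_zero := (hb 0 (Nat.zero_le d)).trans H.b_zero
  b_eq i hi1 hi := (hb i (by omega)).trans (H.b_eq i hi1 hi)
  c_eq i hi1 hi := (hc i (by omega)).trans (H.c_eq i hi1 hi)
  c_last := (hc d le_rfl).trans H.c_last
  a_eq i hi := by rw [ha i hi, hb i hi, hc i hi, H.a_eq i hi]

theorem add_mul_eq_of_roots {b c ρ₁ ρ₂ : ℂ}
    (h : (X ^ 2 - C b * X + C c : ℂ[X]).roots = {ρ₁, ρ₂}) : ρ₁ + ρ₂ = b ∧ ρ₁ * ρ₂ = c := by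
  have e : (X ^ 2 - C b * X + C c : ℂ[X]) = C 1 * X ^ 2 + C (-b) * X + C c := by
    rw [C_1, C_neg]
    ring
  rw [e] at h
  have := (Polynomial.roots_quadratic_eq_pair_iff_of_ne_zero (one_ne_zero (α := ℂ))).1 h
  constructor
  · linear_combination this.1
  · linear_combination -this.2

/-- Starting at θ_t instead of θ_0 only rescales the two coefficients, by q^t and q^{-t}. -/
theorem eigenvalue_qForm {q h s : ℂ} (hq0 : q ≠ 0) {D t d : ℕ} {θ : ℕ → ℂ}
    (hθ : ∀ i : ℕ, i ≤ D → θ i = θ 0 + h * q ^ (-(i : ℤ)) * (1 - q ^ i) * (1 - s * q ^ (i + 1)))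
    (ht : t + d ≤ D) :
    ∃ α₀, ∀ i, i ≤ d → θ (t + i) = qForm q α₀ (h * s * q ^ (t + 1)) (h / q ^ t) i := by
  refine ⟨θ 0 - h - h * s * q, fun i hi => ?_⟩
  rw [hθ (t + i) (by omega), qForm, _root_.zpow_neg, zpow_natCast]
  simp only [pow_add, pow_one]
  field_simp
  ring

variable {X : Type*} [Fintype X] [DecidableEq X]

theorem pPoly_eq_recPoly {G : SimpleGraph X} {x : X} {r : ℕ} {W : Submodule ℂ (X → ℂ)}
    {a b : ℕ → ℂ} (ha : ∀ i, aNum (dualIdem G x) (distMatrix G 1) r W i = a i)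
    (hb : ∀ i, xNum G x r W (i + 1) = b (i + 1)) : ∀ i, pPoly G x r W i = recPoly a b i
  | 0 => rfl
  | 1 => by rw [pPoly, recPoly, ha]
  | i + 2 => by
    rw [pPoly, recPoly, ha, hb, pPoly_eq_recPoly ha hb i, pPoly_eq_recPoly ha hb (i + 1)]

/-- A standard basis in terms of the action on `W`. -/
theorem isStandardBasis_iff {F F' : ℕ → Matrix X X ℂ} {m m' d : ℕ} {W : Submodule ℂ (X → ℂ)}
    (hF : ∀ i, i ≤ d → F (m + i) ∈ stabilizer W) (hF' : F' m' ∈ stabilizer W)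
    (hidem : F' m' * F' m' = F' m') {β : Module.Basis (Fin (d + 1)) ℂ W} :
    IsStandardBasis F m F' m' W β ↔
      ∃ v : W, actOn W (F' m') v = v ∧ v ≠ 0 ∧
        ∀ i : Fin (d + 1), β i = actOn W (F (m + i)) v := by
  constructor
  · rintro ⟨u, hu, hu0, hβ⟩
    obtain ⟨w, hw, rfl⟩ := mem_image.1 hu
    refine ⟨⟨F' m' *ᵥ w, hF' w hw⟩, Subtype.ext ?_, fun h => hu0 (congrArg Subtype.val h),
      fun i => Subtype.ext ?_⟩
    · rw [coe_actOn hF', Matrix.mulVec_mulVec, hidem]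
    · rw [coe_actOn (hF i (by omega))]
      exact hβ i
  · rintro ⟨v, hv, hv0, hβ⟩
    refine ⟨v, mem_image.2 ⟨v, v.2, ?_⟩, fun h => hv0 (Subtype.ext h), fun i => ?_⟩
    · rw [← coe_actOn hF', hv]
    · rw [hβ, coe_actOn (hF i (by omega))]

namespace QPolynomialGraph

variable {G : SimpleGraph X} {p : ℕ → ℕ → ℕ → ℕ} {E : ℕ → Matrix X X ℂ} {kr : ℕ → ℕ → ℕ → ℂ}
  {θ : ℕ → ℂ} {x : X} {θs : ℕ → ℂ} {W : Submodule ℂ (X → ℂ)} {r t d : ℕ}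
  {q h hs r₁ r₂ s ss τ : ℂ}

/-- The `q`-Racah system on a module `W`. -/
abbrev ModuleSystem (G : SimpleGraph X) (E : ℕ → Matrix X X ℂ) (x : X) (θ θs : ℕ → ℂ)
    (q h hs s ss : ℂ) (r t d : ℕ) (W : Submodule ℂ (X → ℂ)) (τ : ℂ) (u : W) (φ φ' : ℕ → ℂ) :
    Prop :=
  QRacahSystem q h hs s ss r t d (actOn W (distMatrix G 1)) (actOn W (dualAdj E x))
    (fun i => actOn W (E (t + i))) (fun i => actOn W (dualIdem G x (r + i)))
    (fun i => θ (t + i)) (fun i => θs (r + i)) τ u φ φ'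

/-- Otherwise θ_k = θ_0. Nothing is claimed for k = D+1, which is why the case d = D needs another
argument. -/
theorem q_pow_ne_one (Q : QPolynomialGraph G p E kr θ x θs)
    (R : IsQRacahType G E x θ θs q h hs r₁ r₂ s ss) {k : ℕ} (hk1 : 1 ≤ k) (hk : k ≤ G.diam) :
    q ^ k ≠ 1 := by
  intro h1
  have h2 := R.eigenvalue k hk
  rw [h1, sub_self, mul_zero, zero_mul, add_zero] at h2
  have := Q.θ_injective hk (Nat.zero_le _) h2
  omega

/-- The value of `τ` for the trivial module. -/
theorem split_trivial (R : IsQRacahType G E x θ θs q h hs r₁ r₂ s ss) :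
    ∃ W₀ : Submodule ℂ (X → ℂ), IsTrivialModule G E x W₀ ∧
      IsFirstSplitSequence G E x θ θs 0 0 G.diam W₀
        (tauFirst q h hs s ss 0 0 G.diam ((r₁ + r₂) / q ^ G.diam)) ∧
      IsSecondSplitSequence G E x θ θs 0 0 G.diam W₀
        (tauSecond q h hs s ss 0 0 G.diam ((r₁ + r₂) / q ^ G.diam)) := by
  obtain ⟨W₀, h1, h2, h3⟩ := R.split
  have hss : ss ≠ 0 := right_ne_zero_of_mul R.mul_ne_zero
  have hsum : r₁ + r₂ = (r₁ + r₂) / q ^ G.diam * q ^ (0 + 0 + G.diam) := by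
    have := pow_ne_zero G.diam R.q_ne_zero
    simp only [zero_add]
    field_simp
  have hprod : r₁ * r₂ = s * ss * q ^ (2 * 0 + 2 * 0 + G.diam + 1) := by
    rw [R.mul_eq]
    simp
  refine ⟨W₀, h1, ?_, ?_⟩
  · convert h2 using 2 with i
    rw [tauFirst_eq_rootFirst R.q_ne_zero hsum hprod, rootFirst]
    simp
  · convert h3 using 2 with i
    rw [tauSecond_eq_rootSecond R.q_ne_zero hss hsum hprod, rootSecond]
    simp

/-- For d < D the recurrence yields τ. For d = D the power q^{d+1} is not controlled, but `W` is
then the trivial module and τ comes from its prescribed split sequences. -/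
theorem exists_moduleSystem (Q : QPolynomialGraph G p E kr θ x θs)
    (R : IsQRacahType G E x θ θs q h hs r₁ r₂ s ss) (hW : IsIrreducible G x W)
    (hthin : IsThin G x W) (hr : endpoint G x W = r) (ht : dualEndpoint G E W = t)
    (hd : diameter G x W = d) (hd0 : 0 < d) :
    ∃ τ u φ φ', ModuleSystem G E x θ θs q h hs s ss r t d W τ u φ φ' ∧
      (d = G.diam → τ = (r₁ + r₂) / q ^ G.diam) := by
  obtain ⟨hrd, htd, L⟩ := Q.leonardSystem hW hthin hr ht hd
  obtain ⟨u, hu0, hu, -⟩ := L.idemF.rank_one 0 (Nat.zero_le d)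
  obtain ⟨φ, hφ⟩ := L.exists_splitSeq hu hu0
  obtain ⟨φ', hφ'⟩ := L.reverse.exists_splitSeq hu hu0
  have hne : h ≠ 0 ∧ hs ≠ 0 ∧ s ≠ 0 ∧ ss ≠ 0 := by
    have := R.mul_ne_zero
    simp only [mul_ne_zero_iff] at this
    tauto
  have hθ := eigenvalue_qForm R.q_ne_zero R.eigenvalue htd
  have hθs := eigenvalue_qForm R.q_ne_zero R.dualEigenvalue hrd
  rcases eq_or_ne d G.diam with hdD | hdD
  · obtain ⟨W₀, h1, h2, h3⟩ := split_trivial R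
    obtain rfl : r = 0 := by omega
    obtain rfl : t = 0 := by omega
    obtain rfl : W = W₀ := Q.eq_of_endpoint_eq_zero hW hr h1.isIrreducible h1.endpoint_eq
    rw [← hdD] at h2 h3
    exact ⟨(r₁ + r₂) / q ^ d, u, φ, φ', ⟨L, hd0, R.q_ne_zero, hne, hθ, hθs, hu, hu0, hφ, hφ',
      fun i hi1 hi =>
        ((Q.isFirstSplitSequence_iff hW.isTModule L hu hu0 hφ).1 h2 i hi1 hi).symm,
      fun i hi1 hi =>
        ((Q.isSecondSplitSequence_iff hW.isTModule L hu hu0 hφ').1 h3 i hi1 hi).symm⟩,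
      fun h => by rw [h]⟩
  · obtain ⟨τ, h1, h2⟩ := L.exists_tau hd0 R.q_ne_zero
      (fun k hk1 hk => Q.q_pow_ne_one R hk1 (by omega)) hne hθ hθs hu hu0 hφ hφ'
    exact ⟨τ, u, φ, φ', ⟨L, hd0, R.q_ne_zero, hne, hθ, hθs, hu, hu0, hφ, hφ', h1, h2⟩,
      fun h => absurd h hdD⟩

/-! ### Consequences for a single module -/

section System

variable {u : W} {φ φ' : ℕ → ℂ}

theorem isFirst_tauFirst (Q : QPolynomialGraph G p E kr θ x θs) (hT : IsTModule G x W)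
    (S : ModuleSystem G E x θ θs q h hs s ss r t d W τ u φ φ') :
    IsFirstSplitSequence G E x θ θs r t d W (tauFirst q h hs s ss r t d τ) :=
  (Q.isFirstSplitSequence_iff hT S.leonard S.apply_u S.u_ne_zero S.first).2
    fun i hi1 hi => (S.first_eq i hi1 hi).symm

theorem isSecond_tauSecond (Q : QPolynomialGraph G p E kr θ x θs) (hT : IsTModule G x W)
    (S : ModuleSystem G E x θ θs q h hs s ss r t d W τ u φ φ') :
    IsSecondSplitSequence G E x θ θs r t d W (tauSecond q h hs s ss r t d τ) :=
  (Q.isSecondSplitSequence_iff hT S.leonard S.apply_u S.u_ne_zero S.second).2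
    fun i hi1 hi => (S.second_eq i hi1 hi).symm

/-- The term φ_1 is affine in τ with slope hh*(1 - q)(1 - q^d) ≠ 0. -/
theorem tau_unique (Q : QPolynomialGraph G p E kr θ x θs) (hT : IsTModule G x W)
    (S : ModuleSystem G E x θ θs q h hs s ss r t d W τ u φ φ') {τ' : ℂ}
    (hτ' : IsFirstSplitSequence G E x θ θs r t d W (tauFirst q h hs s ss r t d τ')) : τ' = τ := by
  have h1 := (Q.isFirstSplitSequence_iff hT S.leonard S.apply_u S.u_ne_zero S.first).1 hτ' 1
    le_rfl S.pos
  rw [S.first_eq 1 le_rfl S.pos, tauFirst, tauFirst] at h1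
  have hd := S.one_sub_pow_ne_zero (i := d) S.pos le_rfl
  have hq := S.one_sub_pow_ne_zero (i := 1) le_rfl S.pos
  have e : q ^ ((d : ℤ) - (1 : ℕ) + 1) = q ^ d := by
    rw [Nat.cast_one, sub_add_cancel, zpow_natCast]
  rw [e] at h1
  have h2 := mul_left_cancel₀
    (mul_ne_zero (mul_ne_zero (mul_ne_zero S.ne_zero.1 S.ne_zero.2.1) hq) hd) h1
  linear_combination h2

theorem aNum_eq_aSeq {F : ℕ → Matrix X X ℂ} {B : Matrix X X ℂ} {m i : ℕ}
    (hF : F (m + i) ∈ stabilizer W) (hB : B ∈ stabilizer W) :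
    aNum F B m W i = LeonardSystem.aSeq (actOn W B) (fun i => actOn W (F (m + i))) i := by
  rw [aNum, trOn, actOn_mul hF hB]
  rfl

theorem uPoly_eval (Q : QPolynomialGraph G p E kr θ x θs) (hT : IsTModule G x W)
    (S : ModuleSystem G E x θ θs q h hs s ss r t d W τ u φ φ') {ρ₁ ρ₂ : ℂ}
    (hsum : ρ₁ + ρ₂ = τ * q ^ (r + t + d))
    (hprod : ρ₁ * ρ₂ = s * ss * q ^ (2 * r + 2 * t + d + 1)) {i j : ℕ} (hi : i ≤ d) (hj : j ≤ d) :
    (uPoly G x θ r t W i).eval (θ (t + j)) = phi43 (q ^ (-(i : ℤ))) (ss * q ^ (2 * r + i + 1))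
      (q ^ (-(j : ℤ))) (s * q ^ (2 * t + j + 1)) (ρ₁ * q) (ρ₂ * q) (q ^ (-(d : ℤ))) q q := by
  have hF := Q.dualIdem_mem_stabilizer hT
  have hA := distMatrix_mem_stabilizer hT Q.diam_pos
  rw [← S.awPoly_eval hsum hprod hi hj, ← S.leonard.recPoly_normalized S.apply_u S.u_ne_zero S.first hi,
    uPoly, pPoly_eq_recPoly (fun i => aNum_eq_aSeq (hF _) hA)]
  · rfl
  · intro i
    rw [xNum, if_neg (Nat.succ_ne_zero i), trOn, actOn_mul (mul_mem (mul_mem (hF _) hA) (hF _)) hA,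
      actOn_mul (mul_mem (hF _) hA) (hF _), actOn_mul (hF _) hA]
    rfl

theorem exists_isStandardBasis (Q : QPolynomialGraph G p E kr θ x θs) (hT : IsTModule G x W)
    (ht : t ≤ G.diam) (S : ModuleSystem G E x θ θs q h hs s ss r t d W τ u φ φ') :
    ∃ β : Module.Basis (Fin (d + 1)) ℂ W, IsStandardBasis (dualIdem G x) r E t W β := by
  obtain ⟨v, hv0, hv, -⟩ := S.leonard.idemE.rank_one 0 (Nat.zero_le d)
  obtain ⟨β, hβ⟩ := S.leonard.exists_standardBasis hv hv0
  refine ⟨β, (isStandardBasis_iff (fun i _ => Q.dualIdem_mem_stabilizer hT _)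
    (Q.E_mem_stabilizer hT ht) ?_).2 ⟨v, hv, hv0, hβ⟩⟩
  rw [Q.idempotents.mul t t ht ht, if_pos rfl]

theorem exists_isDualStandardBasis (Q : QPolynomialGraph G p E kr θ x θs) (hT : IsTModule G x W)
    (ht : t + d ≤ G.diam) (S : ModuleSystem G E x θ θs q h hs s ss r t d W τ u φ φ') :
    ∃ β : Module.Basis (Fin (d + 1)) ℂ W, IsStandardBasis E t (dualIdem G x) r W β := by
  obtain ⟨β, hβ⟩ := S.leonard.dual.exists_standardBasis S.apply_u S.u_ne_zero
  refine ⟨β, (isStandardBasis_iff (fun i _ => Q.E_mem_stabilizer hT (by omega))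
    (Q.dualIdem_mem_stabilizer hT r) ?_).2 ⟨u, S.apply_u, S.u_ne_zero, hβ⟩⟩
  rw [dualIdem_mul, if_pos rfl]

theorem formulas (Q : QPolynomialGraph G p E kr θ x θs) (hT : IsTModule G x W)
    (ht : t ≤ G.diam) (S : ModuleSystem G E x θ θs q h hs s ss r t d W τ u φ φ') {ρ₁ ρ₂ : ℂ}
    (hsum : ρ₁ + ρ₂ = τ * q ^ (r + t + d))
    (hprod : ρ₁ * ρ₂ = s * ss * q ^ (2 * r + 2 * t + d + 1))
    {β : Module.Basis (Fin (d + 1)) ℂ W} (hβ : IsStandardBasis (dualIdem G x) r E t W β) :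
    QRacahFormulas q h ss ρ₁ ρ₂ (θ t) r t d (aNum (dualIdem G x) (distMatrix G 1) r W)
      (bNum (distMatrix G 1) W β) (cNum (distMatrix G 1) W β) := by
  obtain ⟨v, hv, hv0, hβ'⟩ := (isStandardBasis_iff (fun i _ => Q.dualIdem_mem_stabilizer hT _)
    (Q.E_mem_stabilizer hT ht) (by rw [Q.idempotents.mul t t ht ht, if_pos rfl])).1 hβ
  exact (S.formulas hsum hprod hv hβ').congr
    (fun i _ => aNum_eq_aSeq (Q.dualIdem_mem_stabilizer hT _)
      (distMatrix_mem_stabilizer hT Q.diam_pos)) (fun _ _ => rfl) (fun _ _ => rfl)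

/-- These are the formulas for the system with A and A* exchanged. The same ρ₁, ρ₂ serve, since
their sum and product are symmetric under (r, s) ↔ (t, s*). -/
theorem dual_formulas (Q : QPolynomialGraph G p E kr θ x θs) (hT : IsTModule G x W)
    (ht : t + d ≤ G.diam) (S : ModuleSystem G E x θ θs q h hs s ss r t d W τ u φ φ') {ρ₁ ρ₂ : ℂ}
    (hsum : ρ₁ + ρ₂ = τ * q ^ (r + t + d))
    (hprod : ρ₁ * ρ₂ = s * ss * q ^ (2 * r + 2 * t + d + 1))
    {β : Module.Basis (Fin (d + 1)) ℂ W} (hβ : IsStandardBasis E t (dualIdem G x) r W β) :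
    QRacahFormulas q hs s ρ₁ ρ₂ (θs r) t r d (aNum E (dualAdj E x) t W)
      (bNum (dualAdj E x) W β) (cNum (dualAdj E x) W β) := by
  have hE : ∀ i, i ≤ d → E (t + i) ∈ stabilizer W := fun i hi => Q.E_mem_stabilizer hT (by omega)
  obtain ⟨v, hv, hv0, hβ'⟩ := (isStandardBasis_iff hE
    (Q.dualIdem_mem_stabilizer hT r) (by rw [dualIdem_mul, if_pos rfl])).1 hβ
  obtain ⟨_, _, _, S'⟩ := S.exists_dual
  exact (S'.formulas (by rw [hsum, add_comm r t]) (by rw [hprod, add_comm (2 * r), mul_comm s]) hv hβ').congr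
    (fun i hi => aNum_eq_aSeq (hE i hi) (Q.dualAdj_mem_stabilizer hT)) (fun _ _ => rfl)
    (fun _ _ => rfl)

end System

end QPolynomialGraph

end

section

/-! ### Intersection numbers of the graph -/

variable {X : Type*} [Fintype X] [DecidableEq X]

theorem toMatrix_actOn {W : Submodule ℂ (X → ℂ)} {B : Matrix X X ℂ} {d : ℕ}
    {β : Module.Basis (Fin (d + 1)) ℂ W} {c : ℂ} {w : ℕ → X → ℂ} {P : ℕ → ℕ → ℂ}
    (hB : B ∈ stabilizer W) (hβ : ∀ i : Fin (d + 1), (β i : X → ℂ) = c • w i)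
    (hw : ∀ j, j ≤ d → B *ᵥ w j = ∑ i ∈ Finset.range (d + 1), P i j • w i) (i j : Fin (d + 1)) :
    LinearMap.toMatrix β β (actOn W B) i j = P i j := by
  have h : actOn W B (β j) = ∑ k : Fin (d + 1), P k j • β k := by
    refine Subtype.ext ?_
    rw [coe_actOn hB, hβ, Matrix.mulVec_smul, hw j (by omega), Submodule.coe_sum, Finset.smul_sum,
      Finset.sum_range]
    refine Finset.sum_congr rfl fun k _ => ?_
    rw [Submodule.coe_smul, hβ, smul_comm]
  rw [LinearMap.toMatrix_apply, h, β.repr_sum_self]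

theorem bNum_eq_ite {W : Submodule ℂ (X → ℂ)} {B : Matrix X X ℂ} {d : ℕ}
    {β : Module.Basis (Fin (d + 1)) ℂ W} {P : ℕ → ℕ → ℂ}
    (hP : ∀ i j : Fin (d + 1), LinearMap.toMatrix β β (actOn W B) i j = P i j) (i : ℕ) :
    (if i < d then P i (i + 1) else 0) = bNum B W β i := by
  rw [bNum]
  split_ifs
  · rw [hP]
  · rfl

theorem cNum_eq_ite {W : Submodule ℂ (X → ℂ)} {B : Matrix X X ℂ} {d : ℕ}
    {β : Module.Basis (Fin (d + 1)) ℂ W} {P : ℕ → ℕ → ℂ}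
    (hP : ∀ i j : Fin (d + 1), LinearMap.toMatrix β β (actOn W B) i j = P i j) {i : ℕ}
    (hi : i ≤ d) : (if 1 ≤ i then P i (i - 1) else 0) = cNum B W β i := by
  rw [cNum]
  split_ifs
  · rw [hP]
  · omega
  · omega
  · rfl

namespace QPolynomialGraph

variable {G : SimpleGraph X} {p : ℕ → ℕ → ℕ → ℕ} {E : ℕ → Matrix X X ℂ} {kr : ℕ → ℕ → ℕ → ℂ}
  {θ : ℕ → ℂ} {x : X} {θs : ℕ → ℂ} {W : Submodule ℂ (X → ℂ)}
  {q h hs r₁ r₂ s ss τ : ℂ} {u : W} {φ φ' : ℕ → ℂ}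

theorem dualAdj_mulVec_E (Q : QPolynomialGraph G p E kr θ x θs) {j : ℕ} (hj : j ≤ G.diam) :
    dualAdj E x *ᵥ (E j *ᵥ Pi.single x 1)
      = ∑ i ∈ Finset.range (G.diam + 1), kr i 1 j • (E i *ᵥ Pi.single x 1) := by
  ext y
  rw [dualAdj, Matrix.mulVec_diagonal, Finset.sum_apply]
  simp only [Pi.smul_apply, Matrix.mulVec_single_one, Matrix.col_apply, smul_eq_mul]
  rw [← Q.card_smul_hadamard Q.diam_pos hj y x, Q.E_apply_comm Q.diam_pos x y, mul_assoc]

/-- E_0 projects onto constant vectors, and E*_i cuts a constant vector down to a multiple of the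
i-th sphere. -/
theorem standardBasis_trivial (Q : QPolynomialGraph G p E kr θ x θs)
    {β : Module.Basis (Fin (G.diam + 1)) ℂ W} (hβ : IsStandardBasis (dualIdem G x) 0 E 0 W β) :
    ∃ c : ℂ, ∀ i : Fin (G.diam + 1), (β i : X → ℂ) = c • sphereVec G x i := by
  obtain ⟨v, hv, -, hβ⟩ := hβ
  obtain ⟨w, -, rfl⟩ := mem_image.1 hv
  refine ⟨(Fintype.card X : ℂ)⁻¹ * ∑ y, w y, fun i => ?_⟩
  rw [hβ, zero_add, Q.idempotents.zero, dualIdem, Matrix.smul_mulVec]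
  ext y
  rw [Matrix.mulVec_diagonal]
  simp only [Pi.smul_apply, sphereVec, smul_eq_mul, Matrix.mulVec, dotProduct,
    Matrix.of_apply, one_mul]
  ring

theorem dualStandardBasis_trivial (Q : QPolynomialGraph G p E kr θ x θs)
    {β : Module.Basis (Fin (G.diam + 1)) ℂ W} (hβ : IsStandardBasis E 0 (dualIdem G x) 0 W β) :
    ∃ c : ℂ, ∀ i : Fin (G.diam + 1), (β i : X → ℂ) = c • (E i *ᵥ Pi.single x 1) := by
  obtain ⟨v, hv, -, hβ⟩ := hβ
  obtain ⟨w, -, rfl⟩ := mem_image.1 hv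
  refine ⟨w x, fun i => ?_⟩
  rw [hβ, zero_add, Q.dualIdem_zero_mulVec, Matrix.mulVec_smul]

/-- A scalar common to all basis vectors does not change the matrix of A, so its entries in a
standard basis are the p^i_{1j} of the sphere vectors. -/
theorem graph_formulas (Q : QPolynomialGraph G p E kr θ x θs) (hT : IsTModule G x W)
    (S : ModuleSystem G E x θ θs q h hs s ss 0 0 G.diam W τ u φ φ') {ρ₁ ρ₂ : ℂ}
    (hsum : ρ₁ + ρ₂ = τ * q ^ (0 + 0 + G.diam))
    (hprod : ρ₁ * ρ₂ = s * ss * q ^ (2 * 0 + 2 * 0 + G.diam + 1)) :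
    QRacahFormulas q h ss ρ₁ ρ₂ (θ 0) 0 0 G.diam (fun i => (p i 1 i : ℂ))
      (fun i => if i < G.diam then (p i 1 (i + 1) : ℂ) else 0)
      (fun i => if 1 ≤ i then (p i 1 (i - 1) : ℂ) else 0) := by
  have hA := distMatrix_mem_stabilizer hT Q.diam_pos
  obtain ⟨β, hβ⟩ := Q.exists_isStandardBasis hT (Nat.zero_le _) S
  obtain ⟨c, hc⟩ := Q.standardBasis_trivial hβ
  have hP := toMatrix_actOn (P := fun i j => (p i 1 j : ℂ)) hA hc fun j => Q.A_mulVec_sphereVec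
  obtain ⟨v, -, -, hβ'⟩ := (isStandardBasis_iff (fun i _ => Q.dualIdem_mem_stabilizer hT _)
    (Q.E_mem_stabilizer hT (Nat.zero_le _))
    (by rw [Q.idempotents.mul 0 0 (Nat.zero_le _) (Nat.zero_le _), if_pos rfl])).1 hβ
  refine (Q.formulas hT (Nat.zero_le _) S hsum hprod hβ).congr (fun i hi => ?_)
    (fun i _ => bNum_eq_ite (P := fun i j => (p i 1 j : ℂ)) hP i) (fun i hi => cNum_eq_ite (P := fun i j => (p i 1 j : ℂ)) hP hi)
  rw [aNum_eq_aSeq (Q.dualIdem_mem_stabilizer hT _) hA]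
  exact (hP ⟨i, by omega⟩ ⟨i, by omega⟩).symm.trans
    (S.leonard.toMatrix_diag hβ' ⟨i, by omega⟩)

theorem dual_graph_formulas (Q : QPolynomialGraph G p E kr θ x θs) (hT : IsTModule G x W)
    (S : ModuleSystem G E x θ θs q h hs s ss 0 0 G.diam W τ u φ φ') {ρ₁ ρ₂ : ℂ}
    (hsum : ρ₁ + ρ₂ = τ * q ^ (0 + 0 + G.diam))
    (hprod : ρ₁ * ρ₂ = s * ss * q ^ (2 * 0 + 2 * 0 + G.diam + 1)) :
    QRacahFormulas q hs s ρ₁ ρ₂ (θs 0) 0 0 G.diam (fun i => kr i 1 i)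
      (fun i => if i < G.diam then kr i 1 (i + 1) else 0)
      (fun i => if 1 ≤ i then kr i 1 (i - 1) else 0) := by
  have hB := Q.dualAdj_mem_stabilizer hT
  have ht : 0 + G.diam ≤ G.diam := by omega
  have hE : ∀ i, i ≤ G.diam → E (0 + i) ∈ stabilizer W := fun i hi =>
    Q.E_mem_stabilizer hT (by omega)
  obtain ⟨β, hβ⟩ := Q.exists_isDualStandardBasis hT ht S
  obtain ⟨c, hc⟩ := Q.dualStandardBasis_trivial hβ
  have hP := toMatrix_actOn (w := fun i => E i *ᵥ Pi.single x 1) (P := fun i j => kr i 1 j) hB hc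
    fun j => Q.dualAdj_mulVec_E
  obtain ⟨v, -, -, hβ'⟩ := (isStandardBasis_iff hE (Q.dualIdem_mem_stabilizer hT 0)
    (by rw [dualIdem_mul, if_pos rfl])).1 hβ
  refine (Q.dual_formulas hT ht S hsum hprod hβ).congr (fun i hi => ?_)
    (fun i _ => bNum_eq_ite (P := fun i j => kr i 1 j) hP i) (fun i hi => cNum_eq_ite (P := fun i j => kr i 1 j) hP hi)
  rw [aNum_eq_aSeq (hE i hi) hB]
  exact (hP ⟨i, by omega⟩ ⟨i, by omega⟩).symm.trans
    (S.leonard.dual.toMatrix_diag hβ' ⟨i, by omega⟩)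

end QPolynomialGraph

end

end DRG

end

/-! ### The main theorem -/

theorem mainTheorem12 {X : Type*} [Fintype X] [DecidableEq X] (G : SimpleGraph X)
    (hconn : G.Connected) (hdiam : 3 ≤ G.diam)
    -- distance-regular, with intersection numbers `p h i j` and valency at least `3`
    (p : ℕ → ℕ → ℕ → ℕ) (hp : DRG.IsIntersectionNumbers G p) (hk : 3 ≤ p 0 1 1)
    -- `Q`-polynomial with respect to `E`, with Krein parameters `kr h i j`
    (E : ℕ → Matrix X X ℂ) (hE : DRG.IsPrimitiveIdempotents G E)
    (kr : ℕ → ℕ → ℕ → ℂ) (hkr : DRG.IsKreinParameters G E kr) (hQ : DRG.IsQPolynomial G kr)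
    -- eigenvalues, base vertex, dual eigenvalues
    (θ : ℕ → ℂ) (hθ : DRG.IsEigenvalues G E θ)
    (x : X) (θs : ℕ → ℂ) (hθs : DRG.IsDualEigenvalues G E x θs)
    (q h hs r₁ r₂ s ss : ℂ) (hqR : DRG.IsQRacahType G E x θ θs q h hs r₁ r₂ s ss) :
    -- thin irreducible modules `W` of positive diameter
    (∀ (W : Submodule ℂ (X → ℂ)) (r t d : ℕ),
      DRG.IsIrreducible G x W → DRG.IsThin G x W →
      DRG.endpoint G x W = r → DRG.dualEndpoint G E W = t → DRG.diameter G x W = d → 0 < d →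
      ∃ τ : ℂ, DRG.IsTau G E x θ θs q h hs s ss r t d W τ ∧
        (∀ τ' : ℂ, DRG.IsTau G E x θ θs q h hs s ss r t d W τ' → τ' = τ) ∧
        ∀ ρ₁ ρ₂ : ℂ,
          (Polynomial.X ^ 2 - Polynomial.C (τ * q ^ (r + t + d)) * Polynomial.X
            + Polynomial.C (s * ss * q ^ (2 * r + 2 * t + d + 1))).roots = {ρ₁, ρ₂} →
          -- the split sequences
          DRG.IsFirstSplitSequence G E x θ θs r t d W (fun i =>
            h * hs * q ^ (1 - 2 * (i : ℤ) - t - r) * (1 - q ^ i) * (1 - q ^ ((i : ℤ) - d - 1)) *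
              (1 - ρ₁ * q ^ i) * (1 - ρ₂ * q ^ i)) ∧
          DRG.IsSecondSplitSequence G E x θ θs r t d W (fun i =>
            h * hs * q ^ (1 - 2 * (i : ℤ) - t - r) * (1 - q ^ i) * (1 - q ^ ((i : ℤ) - d - 1)) *
              (ρ₁ - ss * q ^ (i + 2 * r)) * (ρ₂ - ss * q ^ (i + 2 * r)) / (ss * q ^ (2 * r))) ∧
          -- the values of the polynomials `u_i`, as terminating series
          (∀ i j : ℕ, i ≤ d → j ≤ d →
            (∀ n, n ≤ min i j →
              DRG.phi43Den (ρ₁ * q) (ρ₂ * q) (q ^ (-(d : ℤ))) q n ≠ 0) ∧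
            (∀ n, min i j < n →
              DRG.phi43Num (q ^ (-(i : ℤ))) (ss * q ^ (2 * r + i + 1))
                (q ^ (-(j : ℤ))) (s * q ^ (2 * t + j + 1)) q n = 0) ∧
            (DRG.uPoly G x θ r t W i).eval (θ (t + j)) =
              DRG.phi43 (q ^ (-(i : ℤ))) (ss * q ^ (2 * r + i + 1))
                (q ^ (-(j : ℤ))) (s * q ^ (2 * t + j + 1))
                (ρ₁ * q) (ρ₂ * q) (q ^ (-(d : ℤ))) q q) ∧
          -- the intersection numbers of `W`
          (∃ β : Module.Basis (Fin (d + 1)) ℂ W,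
            DRG.IsStandardBasis (DRG.dualIdem G x) r E t W β) ∧
          (∀ β : Module.Basis (Fin (d + 1)) ℂ W,
            DRG.IsStandardBasis (DRG.dualIdem G x) r E t W β →
            DRG.QRacahFormulas q h ss ρ₁ ρ₂ (θ t) r t d
              (DRG.aNum (DRG.dualIdem G x) (DRG.distMatrix G 1) r W)
              (DRG.bNum (DRG.distMatrix G 1) W β) (DRG.cNum (DRG.distMatrix G 1) W β)) ∧
          -- the dual intersection numbers of `W`
          (∃ β : Module.Basis (Fin (d + 1)) ℂ W,
            DRG.IsStandardBasis E t (DRG.dualIdem G x) r W β) ∧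
          (∀ β : Module.Basis (Fin (d + 1)) ℂ W,
            DRG.IsStandardBasis E t (DRG.dualIdem G x) r W β →
            DRG.QRacahFormulas q hs s ρ₁ ρ₂ (θs r) t r d
              (DRG.aNum E (DRG.dualAdj E x) t W)
              (DRG.bNum (DRG.dualAdj E x) W β) (DRG.cNum (DRG.dualAdj E x) W β))) ∧
    -- the intersection numbers of the graph
    DRG.QRacahFormulas q h ss r₁ r₂ (θ 0) 0 0 G.diam (fun i => (p i 1 i : ℂ))
      (fun i => if i < G.diam then (p i 1 (i + 1) : ℂ) else 0)
      (fun i => if 1 ≤ i then (p i 1 (i - 1) : ℂ) else 0) ∧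
    -- the dual intersection numbers of the graph
    DRG.QRacahFormulas q hs s r₁ r₂ (θs 0) 0 0 G.diam (fun i => kr i 1 i)
      (fun i => if i < G.diam then kr i 1 (i + 1) else 0)
      (fun i => if 1 ≤ i then kr i 1 (i - 1) else 0) := by
  have Q : DRG.QPolynomialGraph G p E kr θ x θs :=
    ⟨hconn, by omega, hp, hE, hkr, hQ, hθ, hθs⟩
  have hss : ss ≠ 0 := right_ne_zero_of_mul hqR.mul_ne_zero
  refine ⟨?_, ?_⟩
  · intro W r t d hW hthin hr ht hd hd0
    have hT := hW.isTModule
    obtain ⟨-, htd, -⟩ := Q.leonardSystem hW hthin hr ht hd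
    obtain ⟨τ, u, φ, φ', S, -⟩ := Q.exists_moduleSystem hqR hW hthin hr ht hd hd0
    have hfirst := Q.isFirst_tauFirst hT S
    have hsecond := Q.isSecond_tauSecond hT S
    refine ⟨τ, ⟨hfirst, hsecond⟩, fun τ' hτ' => Q.tau_unique hT S hτ'.1, fun ρ₁ ρ₂ hroots => ?_⟩
    obtain ⟨hsum, hprod⟩ := DRG.add_mul_eq_of_roots hroots
    refine ⟨?_, ?_, fun i j hi hj => ⟨fun n hn => ?_, fun n hn => ?_, ?_⟩, ?_, ?_, ?_, ?_⟩
    · rwa [funext (DRG.tauFirst_eq_rootFirst hqR.q_ne_zero hsum hprod)] at hfirst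
    · rwa [funext (DRG.tauSecond_eq_rootSecond hqR.q_ne_zero hss hsum hprod)] at hsecond
    · exact S.phi43Den_ne_zero hsum hprod (by omega)
    · exact DRG.phi43Num_eq_zero hqR.q_ne_zero hn _ _
    · exact Q.uPoly_eval hT S hsum hprod hi hj
    · exact Q.exists_isStandardBasis hT (by omega) S
    · exact fun β hβ => Q.formulas hT (by omega) S hsum hprod hβ
    · exact Q.exists_isDualStandardBasis hT htd S
    · exact fun β hβ => Q.dual_formulas hT htd S hsum hprod hβ
  · obtain ⟨W, hW, -⟩ := hqR.split
    have hT := hW.isIrreducible.isTModule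
    obtain ⟨τ, u, φ, φ', S, hτ⟩ := Q.exists_moduleSystem hqR hW.isIrreducible
      (Q.isThin_of_endpoint_eq_zero hW.isIrreducible hW.endpoint_eq) hW.endpoint_eq
      hW.dualEndpoint_eq hW.diameter_eq (by omega)
    -- For the trivial module τ = (r₁ + r₂)q^{-D}, so the given r₁, r₂ satisfy the sum and product
    -- conditions that define the roots.
    have hsum : r₁ + r₂ = τ * q ^ (0 + 0 + G.diam) := by
      rw [hτ rfl, zero_add, zero_add, div_mul_cancel₀ _ (pow_ne_zero _ hqR.q_ne_zero)]
    have hprod : r₁ * r₂ = s * ss * q ^ (2 * 0 + 2 * 0 + G.diam + 1) := by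
      rw [hqR.mul_eq, mul_zero, zero_add, zero_add]
    exact ⟨Q.graph_formulas hT S hsum hprod, Q.dual_graph_formulas hT S hsum hprod⟩
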